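/- Let $\mathbb D$ be the open unit disc, $dA$ normalized area measure on $\mathbb D$, $\mathbb T$ the unit circle with normalized arc length $m$. Let $\omega\in L^1(\mathbb D)$, $\omega\ge 0$, with $\|\omega\|_{L^1(\mathbb D)}=\int_{\mathbb D}\omega\,dA=1$. For $f$ holomorphic on $\mathbb D$ put $\mathcal D_\omega(f)=\int_{\mathbb D}|f'|^2\,\omega\,dA$; let $\mathcal D_\omega$ be the set of holomorphic $f$ on $\mathbb D$ with $\mathcal D_\omega(f)<\infty$, and put $\|f\|_{\mathcal D_\omega}^2=\|f\|_{H^2}^2+\mathcal D_\omega(f)$. For $b$ in the closed unit ball of $H^\infty$, let $T_\psi g=P_+(\psi g)$ denote the Toeplitz operator on $H^2$ with symbol $\psi\in L^\infty(\mathbb T)$ ($P_+$ being the orthogonal projection of $L^2(\mathbb T)$ onto $H^2$). The de Branges--Rovnyak space $\mathcal H(b)$ is the range of $(I-T_bT_{\overline b})^{1/2}$ on $H^2$, with the norm that makes $(I-T_bT_{\overline b})^{1/2}$ a partial isometry of $H^2$ onto $\mathcal H(b)$. For $\psi\in L^1(\mathbb D)$ the Bergman projection and the Berezin transform are $$Q\psi(z)=\int_{\mathbb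 D}\frac{\psi(w)}{(1-\overline w z)^2}\,dA(w),\qquad B\psi(z)=\int_{\mathbb D}\frac{(1-|z|^2)^2}{|1-\overline w z|^4}\,\psi(w)\,dA(w)\qquad(z\in\mathbb D).$$ A function $F$ on $\mathbb D$ is called outer if $F(z)=\gamma\exp\left(\int_{\mathbb T}\frac{\zeta+z}{\zeta-z}\,u(\zeta)\,dm(\zeta)\right)$ for all $z\in\mathbb D$, for some $|\gamma|=1$ and some real-valued $u\in L^1(\mathbb T)$. **Theorem.** There exists $b$ in the closed unit ball of $H^\infty$ such that $\mathcal D_\omega=\mathcal H(b)$ with equality of norms if and only if the following three conditions hold: (i) $\mathcal D_\omega\subset H^2$; (ii) polynomials are dense in $\mathcal D_\omega$ with respect to $\|\cdot\|_{\mathcal D_\omega}$; (iii) $Q\omega$ is outer and $(1-|z|^2)\,|Q\omega(z)|^2=B\omega(z)$ for all $z\in\mathbb D$. Moreover, whenever $b$ in the closed unit ball of $H^\infty$ satisfies $\mathcal D_\omega=\mathcal H(b)$ with equality of norms, there is a unique outer function $a\in H^\infty$ with $a(0)>0$ and $|a|^2+|b|^2=1$ a.e. on $\mathbb T$, and the associated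 function $\phi:=b/a$ is given by $\phi(z)=c\,z\,(Q\omega)(z)$ for all $z\in\mathbb D$, for some constant $c$ with $|c|=1$. -/

import Mathlib

open MeasureTheory Metric Set
open scoped ENNReal ComplexConjugate

noncomputable section

namespace WeightedDirichlet

/-! ### The disc -/

/-- The open unit disc `𝔻` as a subset of `ℂ`. -/
def disc : Set ℂ := ball (0 : ℂ) 1

/-- Normalized area measure on the disc, viewed as a (probability) measure on `ℂ`. -/
def areaD : Measure ℂ := (ENNReal.ofReal Real.pi)⁻¹ • volume.restrict disc

/-- `𝒟_ω(f) = ∫_𝔻 |f'|² ω dA`. -/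
def dirichletEnergy (ω : ℂ → ℝ) (f : ℂ → ℂ) : ℝ≥0∞ :=
  ∫⁻ z, ‖deriv f z‖ₑ ^ 2 * ENNReal.ofReal (ω z) ∂areaD

/-- The weighted Dirichlet space: functions holomorphic on the disc with `𝒟_ω(f) < ∞`.
Only the values on the disc matter. -/
def dirichletSpace (ω : ℂ → ℝ) : Set (ℂ → ℂ) :=
  {f | DifferentiableOn ℂ f disc ∧ dirichletEnergy ω f < ∞}

/-- The square of the `H²` norm: the supremum of the quadratic means over the circles `|z| = r`,
`0 ≤ r < 1`. The circle is parametrized by `t ↦ exp (2 π i t)`. -/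
def hardyNormSq (f : ℂ → ℂ) : ℝ≥0∞ :=
  ⨆ r ∈ Ico (0 : ℝ) 1,
    ∫⁻ t : UnitAddCircle, ‖f ((r : ℂ) * (t.toCircle : ℂ))‖ₑ ^ 2 ∂AddCircle.haarAddCircle

/-- The Hardy space `H²` as a set of holomorphic functions on the disc. -/
def hardySpace : Set (ℂ → ℂ) :=
  {f | DifferentiableOn ℂ f disc ∧ hardyNormSq f < ∞}

/-- `‖f‖²_{𝒟_ω} = ‖f‖²_{H²} + 𝒟_ω(f)`, with values in `[0, ∞]`. -/
def dirichletNormSq (ω : ℂ → ℝ) (f : ℂ → ℂ) : ℝ≥0∞ :=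
  hardyNormSq f + dirichletEnergy ω f

/-- Polynomials are dense in `𝒟_ω` with respect to `‖·‖_{𝒟_ω}`. -/
def PolynomialsDense (ω : ℂ → ℝ) : Prop :=
  ∀ f ∈ dirichletSpace ω, ∀ ε : ℝ≥0∞, 0 < ε →
    ∃ p : Polynomial ℂ, dirichletNormSq ω (fun z => f z - p.eval z) < ε

/-- The Bergman projection `Qψ(z) = ∫_𝔻 ψ(w) / (1 - w̄ z)² dA(w)`. -/
def bergman (ψ : ℂ → ℝ) (z : ℂ) : ℂ :=
  ∫ w, (ψ w : ℂ) / (1 - conj w * z) ^ 2 ∂areaD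

/-- The Berezin transform `Bψ(z) = ∫_𝔻 (1 - |z|²)² / |1 - w̄ z|⁴ ψ(w) dA(w)`. -/
def berezin (ψ : ℂ → ℝ) (z : ℂ) : ℝ :=
  ∫ w, (1 - ‖z‖ ^ 2) ^ 2 / ‖1 - conj w * z‖ ^ 4 * ψ w ∂areaD

/-- Outer functions on the disc:
`f(z) = c exp (∫_𝕋 (ζ + z) / (ζ - z) u(ζ) dm(ζ))` with `|c| = 1` and `u ∈ L¹(𝕋)` real. -/
def IsOuter (f : ℂ → ℂ) : Prop :=
  ∃ (c : ℂ) (u : UnitAddCircle → ℝ), ‖c‖ = 1 ∧ Integrable u AddCircle.haarAddCircle ∧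
    ∀ z ∈ disc, f z = c * Complex.exp (∫ t : UnitAddCircle,
      ((t.toCircle : ℂ) + z) / ((t.toCircle : ℂ) - z) * (u t : ℂ) ∂AddCircle.haarAddCircle)

/-! ### Hardy spaces on the circle, Toeplitz operators, and `ℋ(b)` -/

/-- `L²(𝕋)`, with normalized arc length. -/
abbrev LTwo : Type := Lp ℂ 2 (@AddCircle.haarAddCircle (1 : ℝ) _)

/-- `L^∞(𝕋)`. -/
abbrev LInf : Type := Lp ℂ ∞ (@AddCircle.haarAddCircle (1 : ℝ) _)

/-- The holomorphic function `z ↦ ∑_{n ≥ 0} f̂(n) zⁿ` on the disc attached to a boundary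
function `f` on the circle. -/
def ext (f : UnitAddCircle → ℂ) (z : ℂ) : ℂ :=
  ∑' n : ℕ, fourierCoeff f (n : ℤ) * z ^ n

/-- `H²` as the closed subspace of `L²(𝕋)` of functions whose negative Fourier coefficients
vanish. -/
def hardyTwo : Submodule ℂ LTwo where
  carrier := {f | ∀ n : ℤ, n < 0 → fourierCoeff (f : UnitAddCircle → ℂ) n = 0}
  zero_mem' := by
    intro n _
    rw [← fourierBasis_repr]
    simp
  add_mem' := by
    intro f g hf hg n hn
    have h1 := hf n hn
    have h2 := hg n hn
    rw [← fourierBasis_repr] at h1 h2 ⊢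
    simp [h1, h2]
  smul_mem' := by
    intro c f hf n hn
    have h1 := hf n hn
    rw [← fourierBasis_repr] at h1 ⊢
    simp [h1]

theorem isClosed_hardyTwo : IsClosed (hardyTwo : Set LTwo) := by
  have h : (hardyTwo : Set LTwo) =
      ⋂ n : ℤ, ⋂ _ : n < 0, {f : LTwo | inner ℂ (fourierBasis n : LTwo) f = 0} := by
    ext f
    simp only [mem_iInter, mem_ofPred_eq]
    refine forall_congr' fun n => forall_congr' fun _ => ?_
    rw [← fourierBasis_repr, HilbertBasis.repr_apply_apply]
  rw [h]
  exact isClosed_iInter fun n => isClosed_iInter fun _ =>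
    isClosed_eq (continuous_const.inner continuous_id) continuous_const

instance : CompleteSpace hardyTwo := isClosed_hardyTwo.completeSpace_coe

/-- Multiplication by `ψ ∈ L^∞(𝕋)` on `L²(𝕋)`. -/
def mulOp (ψ : LInf) : LTwo →L[ℂ] LTwo :=
  (ContinuousLinearMap.mul ℂ ℂ).holderL AddCircle.haarAddCircle ∞ 2 2 ψ

/-- The Toeplitz operator `T_ψ f = P₊(ψ f)` on `H²`. -/
def toeplitz (ψ : LInf) : hardyTwo →L[ℂ] hardyTwo :=
  hardyTwo.orthogonalProjectionOnto ∘L mulOp ψ ∘L hardyTwo.subtypeL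

/-- The closed unit ball of `H^∞`, functions being identified with their boundary values:
`b ∈ L^∞(𝕋)` with vanishing negative Fourier coefficients and `‖b‖_∞ ≤ 1`. -/
def hInfBall : Set LInf :=
  {b | (∀ n : ℤ, n < 0 → fourierCoeff (b : UnitAddCircle → ℂ) n = 0) ∧ ‖b‖ ≤ 1}

/-- The positive square root of a positive operator on a complex Hilbert space. -/
def opSqrt {H : Type*} [NormedAddCommGroup H] [InnerProductSpace ℂ H] [CompleteSpace H]
    (A : H →L[ℂ] H) : H →L[ℂ] H :=
  CFC.sqrt A

/-- The operator `(I - T_b T_{b̄})^{1/2}` on `H²`, whose range is `ℋ(b)`. -/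
def defectSqrt (b : LInf) : hardyTwo →L[ℂ] hardyTwo :=
  opSqrt (1 - toeplitz b ∘L toeplitz (star b))

/-- The de Branges--Rovnyak space `ℋ(b)`, as a linear subspace of `H²`. -/
def deBranges (b : LInf) : Submodule ℂ hardyTwo :=
  LinearMap.range (defectSqrt b : hardyTwo →ₗ[ℂ] hardyTwo)

/-- `𝒟_ω = ℋ(b)` with equality of norms: both consist of the same holomorphic functions on the
disc, and the two norms agree. The norm of `ℋ(b)` is the one making `(I - T_b T_{b̄})^{1/2}` a
partial isometry: the norm of `(I - T_b T_{b̄})^{1/2} g` is `‖g‖_{H²}` for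
`g ⊥ ker (I - T_b T_{b̄})^{1/2}`. -/
def DirichletEqDeBranges (ω : ℂ → ℝ) (b : LInf) : Prop :=
  (∀ f : ℂ → ℂ, f ∈ dirichletSpace ω ↔
    ∃ h ∈ deBranges b, EqOn f (ext ((h : LTwo) : UnitAddCircle → ℂ)) disc) ∧
  ∀ g ∈ (LinearMap.ker (defectSqrt b : hardyTwo →ₗ[ℂ] hardyTwo))ᗮ,
    dirichletNormSq ω (ext ((defectSqrt b g : LTwo) : UnitAddCircle → ℂ)) = ‖g‖ₑ ^ 2

/-- `(b, a)` is a pair: `a ∈ H^∞` is outer, `a(0) > 0` and `|a|² + |b|² = 1` a.e. on `𝕋`. -/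
structure IsPair (b a : LInf) : Prop where
  analytic : ∀ n : ℤ, n < 0 → fourierCoeff (a : UnitAddCircle → ℂ) n = 0
  outer : IsOuter (ext a)
  pos : ∃ r : ℝ, 0 < r ∧ ext a 0 = (r : ℂ)
  sq_add_sq : ∀ᵐ t ∂(@AddCircle.haarAddCircle (1 : ℝ) _), ‖a t‖ ^ 2 + ‖b t‖ ^ 2 = 1

end WeightedDirichlet

end

open MeasureTheory Metric Set
open scoped ENNReal ComplexConjugate

noncomputable section

namespace WeightedDirichlet

open Filter Topology

/-! ### Power series on the disc -/

/-! Both spaces become closed graphs over `H²`. The map `f ↦ (f, f')` identifies the `H²` functions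
of finite energy with the closed subspace `dirGraph` of `H² ⊕ L²(ω dA)`. If `a` is the outer
function with `|a|² + |b|² = 1` on the circle, then `ℋ(b)` is identified isometrically with
`pairGraph`, the pairs `(f, g)` in `H² ⊕ H²` with `T_{b̄} f = T_{ā} g` (`DefectData.exists_graph`,
`DefectData.exists_range`). In both graphs the first coordinate is the function itself, so the
theorem compares two Hilbert spaces over their first coordinates.

Each graph contains explicit vectors over the Cauchy kernel `k_w`: `(k_w, k_w')` in `dirGraph`, and
`(k_w, conj φ(w) k_w)` with `φ = b/a` in `pairGraph`. The second family always spans a dense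
subspace (`IsPair.closure_span_pairKer`). The closed span of the first is that of the polynomials
(`closure_span_kerSum`), which explains condition (ii). Both Gram matrices are `1/(1 - w̄v)` plus a
second term. On the diagonal the second terms are `|w|² Bω(w)/(1-|w|²)²` and `|φ(w)|²/(1-|w|²)`, so
for `|φ| = |w Qω|` their equality is the identity in (iii). A function holomorphic in `v` and
antiholomorphic in `w` is determined by its diagonal values (`eq_zero_of_diagonal`,
`gram_of_diagonal`). Equal Gram matrices then give an isometry of closed spans respecting first
coordinates (`exists_mem_closure_of_gram`). For sufficiency it remains to realize `z Qω` as `b/a`,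
which is possible because `Qω` is outer (`exists_pair_of_outer`).

For necessity the function `a` must first be found. A vector killed by `T_{b̄}` has the same norm in
`ℋ(b)` and in `H²`, hence zero energy, hence is constant. This forces `b = z b₁` with `b₁(0) ≠ 0`
and `b₁` outer (`DirichletEqDeBranges.exists_factor`). Since `ω` has mass one, `z` has squared norm
2, and this gives `|b₁(0) h(0)|² ≤ 2 ∫ |h|² (1-|b|²) dm` for all `h` in `H²`. Szegő's argument then
makes `log(1-|b|²)` integrable, so `a` exists. Pairing `z` with the kernels in both graphs yields
`φ(w) = c w Qω(w)` with `|c| = 1`. The diagonal of the Gram matrix gives the Berezin identity, `Qω =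
b₁/(c a)` is outer, and density of the kernels is transported back to `dirGraph`. -/

/-- Coefficient sequences whose power series converges absolutely on the unit disc. -/
def DiscSummable (c : ℕ → ℂ) : Prop :=
  ∀ r : ℝ, 0 ≤ r → r < 1 → Summable fun n => ‖c n‖ * r ^ n

/-- Linear growth is the bound assumed of all generating sequences below: `zⁿ` has norm 1 in `H²`,
and its derivative has norm at most `n` in `L²(ω dA)`. -/
theorem discSummable_of_le {c : ℕ → ℂ} {C : ℝ} (h : ∀ n, ‖c n‖ ≤ C * (n + 1)) :
    DiscSummable c := by
  intro r hr0 hr1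
  have h1 : Summable fun n : ℕ => (n : ℝ) ^ 1 * r ^ n :=
    summable_pow_mul_geometric_of_norm_lt_one 1 (by rwa [Real.norm_of_nonneg hr0])
  have h2 : Summable fun n : ℕ => r ^ n := summable_geometric_of_lt_one hr0 hr1
  refine Summable.of_nonneg_of_le (fun n => by positivity) (fun n => ?_) ((h1.add h2).mul_left C)
  calc ‖c n‖ * r ^ n ≤ (C * (n + 1)) * r ^ n := by gcongr; exact h n
    _ = _ := by ring

theorem mem_disc {z : ℂ} : z ∈ disc ↔ ‖z‖ < 1 := by simp [disc]

theorem isOpen_disc : IsOpen disc := isOpen_ball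

theorem DiscSummable.summable_norm {c : ℕ → ℂ} (hc : DiscSummable c) {z : ℂ} (hz : z ∈ disc) :
    Summable fun n => ‖c n * z ^ n‖ := by
  simpa [norm_mul, norm_pow] using hc ‖z‖ (norm_nonneg _) (mem_disc.1 hz)

theorem DiscSummable.hasFPowerSeriesOnBall {c : ℕ → ℂ} (hc : DiscSummable c) :
    HasFPowerSeriesOnBall (fun z => ∑' n, c n * z ^ n)
      (FormalMultilinearSeries.ofScalars ℂ c) 0 1 := by
  have hr : (1 : ℝ≥0∞) ≤ (FormalMultilinearSeries.ofScalars ℂ c).radius := by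
    refine ENNReal.le_of_forall_nnreal_lt fun r hr => ?_
    refine FormalMultilinearSeries.le_radius_of_summable_norm _ ?_
    have := hc r r.2 (by exact_mod_cast hr)
    refine this.congr fun n => ?_
    simp
  have h := (FormalMultilinearSeries.hasFPowerSeriesOnBall _
    (lt_of_lt_of_le one_pos hr)).mono one_pos hr
  convert h using 1
  ext z
  simp [FormalMultilinearSeries.sum, mul_comm]

theorem DiscSummable.differentiableOn {c : ℕ → ℂ} (hc : DiscSummable c) :
    DifferentiableOn ℂ (fun z => ∑' n, c n * z ^ n) disc := by
  have h := hc.hasFPowerSeriesOnBall.differentiableOn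
  rwa [show (eball (0 : ℂ) 1) = disc by
    rw [disc, ← Metric.eball_ofReal]; simp] at h

theorem DiscSummable.eq_zero {c : ℕ → ℂ} (hc : DiscSummable c)
    (h : ∀ z ∈ disc, ∑' n, c n * z ^ n = 0) (n : ℕ) : c n = 0 := by
  have h1 := hc.hasFPowerSeriesOnBall.hasFPowerSeriesAt
  have h2 : (fun z => ∑' n, c n * z ^ n) =ᶠ[nhds 0] 0 := by
    filter_upwards [isOpen_disc.mem_nhds (mem_disc.2 (by simp : ‖(0 : ℂ)‖ < 1))] with z hz
    exact h z hz
  have h3 := (h1.congr h2).eq_zero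
  have h4 : ‖FormalMultilinearSeries.ofScalars ℂ c n‖ = 0 := by rw [h3]; simp
  simpa [FormalMultilinearSeries.ofScalars_norm] using h4

theorem DiscSummable.congr_coeff {c d : ℕ → ℂ} (hc : DiscSummable c) (hd : DiscSummable d)
    (h : ∀ z ∈ disc, ∑' n, c n * z ^ n = ∑' n, d n * z ^ n) : c = d := by
  have hs : DiscSummable fun n => c n - d n := by
    intro r h0 h1
    refine Summable.of_nonneg_of_le (fun n => by positivity) (fun n => ?_)
      ((hc r h0 h1).add (hd r h0 h1))
    rw [← add_mul]
    gcongr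
    exact norm_sub_le _ _
  ext n
  refine sub_eq_zero.1 (hs.eq_zero (fun z hz => ?_) n)
  simp only [sub_mul]
  rw [((hc.summable_norm hz).of_norm).tsum_sub ((hd.summable_norm hz).of_norm), h z hz, sub_self]

theorem exists_discSummable {f : ℂ → ℂ} (hf : DifferentiableOn ℂ f disc) :
    ∃ c : ℕ → ℂ, DiscSummable c ∧ ∀ z ∈ disc, HasSum (fun n => c n * z ^ n) (f z) := by
  have key : ∀ z ∈ disc, HasSum (fun n => ((n.factorial : ℂ)⁻¹ * iteratedDeriv n f 0) * z ^ n)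
      (f z) := by
    intro z hz
    have := Complex.hasSum_taylorSeries_on_ball (c := 0) (r := 1) hf hz
    refine this.congr_fun fun n => ?_
    simp only [sub_zero, smul_eq_mul]
    ring
  refine ⟨_, fun r h0 h1 => ?_, key⟩
  have hr : ((r : ℝ) : ℂ) ∈ disc := mem_disc.2 (by simpa [abs_of_nonneg h0] using h1)
  have := (key r hr).summable.norm
  simpa [norm_mul, norm_pow, abs_of_nonneg h0] using this

/-! ### Kernel sums in a Hilbert space -/

section KernelSum

variable {Y : Type*} [NormedAddCommGroup Y] [InnerProductSpace ℂ Y]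

/-- `∑ w̄ⁿ eₙ`. -/
def kerSum (e : ℕ → Y) (w : ℂ) : Y := ∑' n : ℕ, (conj w) ^ n • e n

theorem summable_kerSum [CompleteSpace Y] {e : ℕ → Y} {C : ℝ} (he : ∀ n, ‖e n‖ ≤ C * (n + 1)) {w : ℂ}
    (hw : w ∈ disc) : Summable fun n : ℕ => (conj w) ^ n • e n := by
  refine Summable.of_norm ?_
  have h : DiscSummable fun n => ((‖e n‖ : ℝ) : ℂ) := discSummable_of_le (C := C) (by simpa using he)
  refine (h.summable_norm hw).congr fun n => ?_
  simp [norm_smul, mul_comm]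

/-- The conjugate in `kerSum` cancels the conjugate linearity of the first slot of the inner
product, so pairing with the kernels produces holomorphic functions of `w`. -/
theorem hasSum_inner_kerSum [CompleteSpace Y] {e : ℕ → Y} {C : ℝ} (he : ∀ n, ‖e n‖ ≤ C * (n + 1)) {w : ℂ}
    (hw : w ∈ disc) (y : Y) :
    HasSum (fun n => inner ℂ (e n) y * w ^ n) (inner ℂ (kerSum e w) y) := by
  have h := ((summable_kerSum he hw).hasSum).mapL (innerSL ℂ y)
  have h2 := h.mapL (Complex.conjCLE : ℂ →L[ℝ] ℂ)
  simp only [innerSL_apply_apply, inner_smul_right, ContinuousLinearEquiv.coe_coe,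
    Complex.conjCLE_apply, map_mul, inner_conj_symm, map_pow, Complex.conj_conj] at h2
  simpa [kerSum, mul_comm] using h2

theorem discSummable_inner {e : ℕ → Y} {C : ℝ} (he : ∀ n, ‖e n‖ ≤ C * (n + 1)) (y : Y) :
    DiscSummable fun n => inner ℂ (e n) y := by
  refine discSummable_of_le (C := C * ‖y‖) fun n => ?_
  calc ‖inner ℂ (e n) y‖ ≤ ‖e n‖ * ‖y‖ := norm_inner_le_norm _ _
    _ ≤ (C * (n + 1)) * ‖y‖ := by gcongr; exact he n
    _ = _ := by ring

theorem differentiableOn_inner_kerSum [CompleteSpace Y] {e : ℕ → Y} {C : ℝ} (he : ∀ n, ‖e n‖ ≤ C * (n + 1)) (y : Y) :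
    DifferentiableOn ℂ (fun w => inner ℂ (kerSum e w) y) disc :=
  (discSummable_inner he y).differentiableOn.congr fun _ hw =>
    (hasSum_inner_kerSum he hw y).tsum_eq.symm

/-- A vector orthogonal to every kernel has a vanishing power series `∑ ⟨eₙ, y⟩ wⁿ`, hence is
orthogonal to every `eₙ`. For `dvec` this exchanges polynomials and kernels. -/
theorem closure_span_kerSum [CompleteSpace Y] {e : ℕ → Y} {C : ℝ} (he : ∀ n, ‖e n‖ ≤ C * (n + 1)) :
    (Submodule.span ℂ (kerSum e '' disc)).topologicalClosure =
      (Submodule.span ℂ (range e)).topologicalClosure := by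
  apply le_antisymm
  · refine Submodule.topologicalClosure_minimal _ ?_ (Submodule.isClosed_topologicalClosure _)
    rw [Submodule.span_le]
    rintro _ ⟨w, hw, rfl⟩
    refine (Submodule.isClosed_topologicalClosure _).mem_of_tendsto
      (summable_kerSum he hw).hasSum (Filter.Eventually.of_forall fun s => ?_)
    exact Submodule.sum_mem _ fun n _ => Submodule.smul_mem _ _
      (Submodule.le_topologicalClosure _ (Submodule.subset_span ⟨n, rfl⟩))
  · rw [← Submodule.orthogonal_orthogonal_eq_closure, ← Submodule.orthogonal_orthogonal_eq_closure]
    refine Submodule.orthogonal_le ?_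
    intro y hy
    rw [Submodule.mem_orthogonal] at hy ⊢
    have h0 : ∀ n, inner ℂ (e n) y = 0 := (discSummable_inner he y).eq_zero fun w hw => by
      rw [(hasSum_inner_kerSum he hw y).tsum_eq]
      exact hy _ (Submodule.subset_span ⟨w, hw, rfl⟩)
    intro u hu
    induction hu using Submodule.span_induction with
    | mem x hx => obtain ⟨n, rfl⟩ := hx; exact h0 n
    | zero => simp
    | add x y _ _ hx hy => simp [inner_add_left, hx, hy]
    | smul a x _ hx => simp [inner_smul_left, hx]

end KernelSum

/-! ### The Hardy space on the circle -/

/-- Normalized arc length on the circle. -/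
abbrev arc : Measure UnitAddCircle := AddCircle.haarAddCircle

theorem inner_fourierLp (n : ℤ) (f : LTwo) :
    inner ℂ (fourierLp 2 n : LTwo) f = fourierCoeff (f : UnitAddCircle → ℂ) n := by
  rw [← fourierBasis_repr, HilbertBasis.repr_apply_apply, coe_fourierBasis]

/-- The monomial `zⁿ` as an element of `H²`. -/
def mono (n : ℕ) : hardyTwo :=
  ⟨fourierLp 2 (n : ℤ), fun k hk => by
    rw [← inner_fourierLp, orthonormal_iff_ite.1 orthonormal_fourier]
    rw [if_neg (by omega)]⟩

theorem hinner_smul_right (c : ℂ) (f g : hardyTwo) : inner ℂ f (c • g) = c * inner ℂ f g :=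
  inner_smul_right (𝕜 := ℂ) (E := hardyTwo) _ _ _

theorem hinner_smul_left (c : ℂ) (f g : hardyTwo) :
    inner ℂ (c • f) g = conj c * inner ℂ f g :=
  inner_smul_left (𝕜 := ℂ) (E := hardyTwo) _ _ _

theorem hinner_sub_right (f g h : hardyTwo) : inner ℂ f (g - h) = inner ℂ f g - inner ℂ f h :=
  inner_sub_right (𝕜 := ℂ) (E := hardyTwo) _ _ _

theorem hnorm_smul (c : ℂ) (f : hardyTwo) : ‖c • f‖ = ‖c‖ * ‖f‖ :=
  norm_smul (β := hardyTwo) _ _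

theorem norm_toCircle (t : UnitAddCircle) : ‖(t.toCircle : ℂ)‖ = 1 := Circle.norm_coe _

theorem mul_toCircle_mem_disc {r : ℝ} (hr : r ∈ Ico (0 : ℝ) 1) (t : UnitAddCircle) :
    (r : ℂ) * (t.toCircle : ℂ) ∈ disc := by
  rw [mem_disc, norm_mul, norm_toCircle, mul_one, Complex.norm_real, Real.norm_of_nonneg hr.1]
  exact hr.2

theorem norm_mono (n : ℕ) : ‖mono n‖ = 1 := orthonormal_fourier.1 _

theorem norm_mono_le (n : ℕ) : ‖mono n‖ ≤ 1 * ((n : ℝ) + 1) := by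
  rw [norm_mono]; linarith [(Nat.cast_nonneg n : (0 : ℝ) ≤ n)]

theorem inner_mono (n : ℕ) (f : hardyTwo) :
    inner ℂ (mono n) f = fourierCoeff ((f : LTwo) : UnitAddCircle → ℂ) n :=
  inner_fourierLp _ _

theorem inner_mono_mono (m n : ℕ) : inner ℂ (mono m) (mono n) = if m = n then (1 : ℂ) else 0 := by
  have := orthonormal_iff_ite.1 (orthonormal_fourier (T := 1)) (m : ℤ) n
  simp only [Nat.cast_inj] at this
  exact this

/-- The Cauchy kernel `k_w(z) = 1 / (1 - w̄ z)`. -/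
def cauchyKer (w : ℂ) : hardyTwo := kerSum mono w

theorem inner_cauchyKer {w : ℂ} (hw : w ∈ disc) (f : hardyTwo) :
    inner ℂ (cauchyKer w) f = ext ((f : LTwo) : UnitAddCircle → ℂ) w := by
  rw [cauchyKer, ← (hasSum_inner_kerSum norm_mono_le hw f).tsum_eq]
  simp only [inner_mono]
  rfl

/-- The holomorphic function on the disc attached to an element of `H²`. -/
def hext (f : hardyTwo) : ℂ → ℂ := ext ((f : LTwo) : UnitAddCircle → ℂ)

theorem hext_eq_inner {w : ℂ} (hw : w ∈ disc) (f : hardyTwo) :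
    hext f w = inner ℂ (cauchyKer w) f := (inner_cauchyKer hw f).symm

theorem hasSum_hext (f : hardyTwo) {z : ℂ} (hz : z ∈ disc) :
    HasSum (fun n => inner ℂ (mono n) f * z ^ n) (hext f z) := by
  rw [hext_eq_inner hz]
  exact hasSum_inner_kerSum norm_mono_le hz f

theorem differentiableOn_hext (f : hardyTwo) : DifferentiableOn ℂ (hext f) disc :=
  (differentiableOn_inner_kerSum norm_mono_le f).congr fun _ hw => hext_eq_inner hw f

theorem hext_add (f g : hardyTwo) {z : ℂ} (hz : z ∈ disc) :
    hext (f + g) z = hext f z + hext g z := by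
  simp [hext_eq_inner hz]

theorem hext_sub (f g : hardyTwo) {z : ℂ} (hz : z ∈ disc) :
    hext (f - g) z = hext f z - hext g z := by
  simp [hext_eq_inner hz]

theorem hext_smul (c : ℂ) (f : hardyTwo) {z : ℂ} (hz : z ∈ disc) :
    hext (c • f) z = c * hext f z := by
  simp [hext_eq_inner hz]

theorem hext_mono (n : ℕ) {z : ℂ} (hz : z ∈ disc) : hext (mono n) z = z ^ n := by
  rw [← (hasSum_hext (mono n) hz).tsum_eq]
  simp only [inner_mono_mono, ite_mul, one_mul, zero_mul]
  rw [tsum_ite_eq]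

theorem zero_mem_disc : (0 : ℂ) ∈ disc := mem_disc.2 (by simp)

theorem hext_zero_eq (f : hardyTwo) : hext f 0 = inner ℂ (mono 0) f := by
  rw [← (hasSum_hext f zero_mem_disc).tsum_eq, tsum_eq_single 0]
  · simp
  · intro n hn; simp [hn]

/-- An element of `H²` is determined by its Taylor coefficients. -/
theorem hardyTwo_ext_coeff {f g : hardyTwo} (h : ∀ n, inner ℂ (mono n) f = inner ℂ (mono n) g) :
    f = g := by
  apply Subtype.ext
  apply fourierBasis.repr.injective
  ext n
  rw [fourierBasis_repr, fourierBasis_repr]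
  rcases lt_or_ge n 0 with hn | hn
  · rw [f.2 n hn, g.2 n hn]
  · lift n to ℕ using hn
    simpa only [inner_mono] using h n

theorem hext_injective {f g : hardyTwo} (h : EqOn (hext f) (hext g) disc) : f = g := by
  refine hardyTwo_ext_coeff fun n => ?_
  refine congrFun ((discSummable_inner norm_mono_le f).congr_coeff
    (discSummable_inner norm_mono_le g) fun z hz => ?_) n
  rw [(hasSum_hext f hz).tsum_eq, (hasSum_hext g hz).tsum_eq]
  exact h hz

theorem closure_span_mono : (Submodule.span ℂ (range mono)).topologicalClosure = ⊤ := by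
  rw [Submodule.topologicalClosure_eq_top_iff, Submodule.eq_bot_iff]
  intro f hf
  refine hardyTwo_ext_coeff fun n => ?_
  rw [inner_zero_right]
  exact (Submodule.mem_orthogonal _ _).1 hf _ (Submodule.subset_span ⟨n, rfl⟩)

theorem hext_cauchyKer {v w : ℂ} (hv : v ∈ disc) (hw : w ∈ disc) :
    hext (cauchyKer w) v = (1 - conj w * v)⁻¹ := by
  rw [← (hasSum_hext _ hv).tsum_eq]
  have h : ∀ n, inner ℂ (mono n) (cauchyKer w) = (conj w) ^ n := by
    intro n
    rw [← inner_conj_symm (𝕜 := ℂ) (mono n) (cauchyKer w), ← hext_eq_inner hw, hext_mono n hw,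
      map_pow]
  simp only [h, ← mul_pow]
  refine tsum_geometric_of_norm_lt_one ?_
  rw [norm_mul, RCLike.norm_conj]
  exact mul_lt_one_of_nonneg_of_lt_one_left (norm_nonneg _) (mem_disc.1 hw) (mem_disc.1 hv).le

/-! ### Dilations and the Hardy norm -/

theorem orthonormal_mono : Orthonormal ℂ mono :=
  orthonormal_iff_ite.2 fun m n => inner_mono_mono m n

/-- The monomials as a Hilbert basis of `H²`. -/
def monoBasis : HilbertBasis ℕ ℂ hardyTwo :=
  HilbertBasis.mk orthonormal_mono closure_span_mono.ge

theorem monoBasis_apply (n : ℕ) : monoBasis n = mono n := by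
  simp [monoBasis]

theorem hasSum_norm_sq (f : hardyTwo) :
    HasSum (fun n => ‖inner ℂ (mono n) f‖ ^ 2) (‖f‖ ^ 2) := by
  have h := monoBasis.hasSum_inner_mul_inner f f
  have h2 := h.mapL Complex.reCLM
  simp only [monoBasis_apply, Complex.reCLM_apply] at h2
  convert h2 using 1
  · ext n
    rw [← inner_conj_symm (𝕜 := ℂ) f (mono n), ← Complex.normSq_eq_conj_mul_self,
      Complex.ofReal_re, Complex.normSq_eq_norm_sq]
  · exact (inner_self_eq_norm_sq (𝕜 := ℂ) f).symm

/-- An element of `H²` with prescribed square summable coefficients. -/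
theorem exists_hardyTwo {c : ℕ → ℂ} (hc : Summable fun n => ‖c n‖ ^ 2) :
    ∃ f : hardyTwo, ∀ n, inner ℂ (mono n) f = c n := by
  have hm : Memℓp c 2 := memℓp_gen (by simpa using hc)
  refine ⟨monoBasis.repr.symm ⟨c, hm⟩, fun n => ?_⟩
  rw [← monoBasis_apply, ← HilbertBasis.repr_apply_apply]
  simp

/-- The restriction of a power series to the circle of radius `r`, as an element of `H²`. -/
def dilate (c : ℕ → ℂ) (r : ℝ) : hardyTwo := ∑' n : ℕ, (c n * (r : ℂ) ^ n) • mono n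

theorem summable_dilate {c : ℕ → ℂ} (hc : DiscSummable c) {r : ℝ} (hr : r ∈ Ico (0 : ℝ) 1) :
    Summable fun n : ℕ => (c n * (r : ℂ) ^ n) • mono n := by
  refine Summable.of_norm ((hc r hr.1 hr.2).congr fun n => ?_)
  rw [hnorm_smul, norm_mono, mul_one, norm_mul, norm_pow, Complex.norm_real,
    Real.norm_of_nonneg hr.1]

theorem inner_mono_dilate {c : ℕ → ℂ} (hc : DiscSummable c) {r : ℝ} (hr : r ∈ Ico (0 : ℝ) 1)
    (n : ℕ) : inner ℂ (mono n) (dilate c r) = c n * (r : ℂ) ^ n := by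
  have h := (summable_dilate hc hr).hasSum.mapL (innerSL ℂ (mono n))
  simp only [innerSL_apply_apply, hinner_smul_right, inner_mono_mono, mul_ite, mul_one,
    mul_zero] at h
  rw [dilate, ← h.tsum_eq]
  simp only [eq_comm (a := n)]
  rw [tsum_ite_eq]

/-- The same series converges uniformly on the circle. Comparing its image in `L²` with the Hilbert
space sum identifies the abstract class with the pointwise power series. -/
theorem coeFn_dilate {c : ℕ → ℂ} (hc : DiscSummable c) {r : ℝ} (hr : r ∈ Ico (0 : ℝ) 1) :
    ((dilate c r : LTwo) : UnitAddCircle → ℂ) =ᵐ[arc]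
      fun t => ∑' n : ℕ, c n * ((r : ℂ) * (t.toCircle : ℂ)) ^ n := by
  have hs : Summable fun n : ℕ => (c n * (r : ℂ) ^ n) • (fourier (n : ℤ) : C(UnitAddCircle, ℂ)) := by
    refine Summable.of_norm ((hc r hr.1 hr.2).congr fun n => ?_)
    simp [norm_smul, fourier_norm, abs_of_nonneg hr.1]
  have h1 := hs.hasSum.mapL (ContinuousMap.toLp (E := ℂ) 2 arc ℂ)
  have h2 := (summable_dilate hc hr).hasSum.mapL hardyTwo.subtypeL
  simp only [map_smul] at h1 h2
  have h3 := h2.unique h1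
  change (dilate c r : LTwo) = _ at h3
  rw [h3]
  refine (ContinuousMap.coeFn_toLp arc _).trans (Eventually.of_forall fun t => ?_)
  have h4 := hs.hasSum.mapL (ContinuousMap.evalCLM ℂ t)
  refine h4.unique ?_
  refine (hc.summable_norm (mul_toCircle_mem_disc hr t)).of_norm.hasSum.congr_fun fun n => ?_
  have h6 : (fourier (n : ℤ) t : ℂ) = (t.toCircle : ℂ) ^ n := by
    rw [fourier_apply, natCast_zsmul, AddCircle.toCircle_nsmul]; rfl
  rw [mul_pow, ← h6, ← mul_assoc]
  rfl

theorem LTwo_enorm_sq (f : LTwo) : ‖f‖ₑ ^ 2 = ∫⁻ t, ‖f t‖ₑ ^ 2 ∂arc := by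
  rw [Lp.enorm_def, eLpNorm_eq_lintegral_rpow_enorm_toReal (by norm_num) (by norm_num)]
  simp only [ENNReal.toReal_ofNat, ENNReal.rpow_two]
  rw [← ENNReal.rpow_natCast, ← ENNReal.rpow_mul]
  norm_num

theorem lintegral_circle_eq {c : ℕ → ℂ} (hc : DiscSummable c) {f : ℂ → ℂ}
    (hf : ∀ z ∈ disc, HasSum (fun n => c n * z ^ n) (f z)) {r : ℝ} (hr : r ∈ Ico (0 : ℝ) 1) :
    ∫⁻ t : UnitAddCircle, ‖f ((r : ℂ) * (t.toCircle : ℂ))‖ₑ ^ 2 ∂arc = 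
      ∑' n, ‖c n‖ₑ ^ 2 * ENNReal.ofReal (r ^ n) ^ 2 := by
  have h1 : ∫⁻ t : UnitAddCircle, ‖f ((r : ℂ) * (t.toCircle : ℂ))‖ₑ ^ 2 ∂arc =
      ‖(dilate c r : LTwo)‖ₑ ^ 2 := by
    rw [LTwo_enorm_sq]
    refine lintegral_congr_ae ?_
    filter_upwards [coeFn_dilate hc hr] with t ht
    rw [ht, (hf _ (mul_toCircle_mem_disc hr t)).tsum_eq]
  rw [h1]
  have h2 := hasSum_norm_sq (dilate c r)
  simp only [inner_mono_dilate hc hr] at h2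
  have h3 : ‖(dilate c r : LTwo)‖ₑ ^ 2 = ENNReal.ofReal (‖dilate c r‖ ^ 2) := by
    rw [ENNReal.ofReal_pow (norm_nonneg _), ofReal_norm]; rfl
  rw [h3, ← h2.tsum_eq, ENNReal.ofReal_tsum_of_nonneg (fun n => by positivity) h2.summable]
  refine tsum_congr fun n => ?_
  rw [norm_mul, mul_pow, ENNReal.ofReal_mul (by positivity), ENNReal.ofReal_pow (norm_nonneg _),
    ENNReal.ofReal_pow (norm_nonneg _), ofReal_norm, norm_pow, Complex.norm_real,
    Real.norm_of_nonneg hr.1]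

/-- Parseval on each circle bounds the means by the coefficient sum. Conversely, finite partial sums
are recovered by letting the radius tend to 1. -/
theorem hardyNormSq_eq_tsum {c : ℕ → ℂ} (hc : DiscSummable c) {f : ℂ → ℂ}
    (hf : ∀ z ∈ disc, HasSum (fun n => c n * z ^ n) (f z)) :
    hardyNormSq f = ∑' n, ‖c n‖ₑ ^ 2 := by
  rw [hardyNormSq]
  apply le_antisymm
  · refine iSup₂_le fun r hr => ?_
    rw [lintegral_circle_eq hc hf hr]
    refine ENNReal.tsum_le_tsum fun n => ?_
    refine mul_le_of_le_one_right' (pow_le_one' ?_ 2)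
    exact ENNReal.ofReal_le_one.2 (pow_le_one₀ hr.1 hr.2.le)
  · rw [ENNReal.tsum_eq_iSup_sum]
    refine iSup_le fun s => ?_
    have hlim : Tendsto (fun r : ℝ => ∑ n ∈ s, ‖c n‖ₑ ^ 2 * ENNReal.ofReal (r ^ n) ^ 2) (𝓝[<] 1)
        (𝓝 (∑ n ∈ s, ‖c n‖ₑ ^ 2)) := by
      have : ∑ n ∈ s, ‖c n‖ₑ ^ 2 = ∑ n ∈ s, ‖c n‖ₑ ^ 2 * ENNReal.ofReal ((1 : ℝ) ^ n) ^ 2 := by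
        simp
      rw [this]
      refine tendsto_finsetSum _ fun n _ => ?_
      refine ENNReal.Tendsto.const_mul ?_ (Or.inr (by finiteness))
      refine ENNReal.Tendsto.pow (ENNReal.tendsto_ofReal ?_)
      exact ((continuous_pow n).tendsto 1).mono_left nhdsWithin_le_nhds
    refine le_of_tendsto hlim ?_
    have h0 : ∀ᶠ r : ℝ in 𝓝[<] 1, 0 ≤ r :=
      (eventually_ge_nhds (by norm_num : (0 : ℝ) < 1)).filter_mono nhdsWithin_le_nhds
    filter_upwards [h0, self_mem_nhdsWithin] with r hr0 hr1
    have hr : r ∈ Ico (0 : ℝ) 1 := ⟨hr0, hr1⟩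
    refine le_trans ?_ (le_iSup₂ (f := fun r (_ : r ∈ Ico (0 : ℝ) 1) => ∫⁻ t : UnitAddCircle,
      ‖f ((r : ℂ) * (t.toCircle : ℂ))‖ₑ ^ 2 ∂AddCircle.haarAddCircle) r hr)
    rw [lintegral_circle_eq hc hf hr]
    exact ENNReal.sum_le_tsum s

theorem hardyNormSq_congr {f g : ℂ → ℂ} (h : EqOn f g disc) : hardyNormSq f = hardyNormSq g := by
  refine iSup_congr fun r => iSup_congr fun hr => lintegral_congr fun t => ?_
  rw [h (mul_toCircle_mem_disc hr t)]

theorem hardyNormSq_hext (f : hardyTwo) : hardyNormSq (hext f) = ‖f‖ₑ ^ 2 := by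
  rw [hardyNormSq_eq_tsum (discSummable_inner norm_mono_le f) fun z hz => hasSum_hext f hz]
  have h := hasSum_norm_sq f
  have h3 : ‖f‖ₑ ^ 2 = ENNReal.ofReal (‖f‖ ^ 2) := by
    rw [ENNReal.ofReal_pow (norm_nonneg _), ofReal_norm]
  rw [h3, ← h.tsum_eq, ENNReal.ofReal_tsum_of_nonneg (fun n => by positivity) h.summable]
  refine tsum_congr fun n => ?_
  rw [ENNReal.ofReal_pow (norm_nonneg _), ofReal_norm]

theorem exists_hext_eq {f : ℂ → ℂ} (hf : f ∈ hardySpace) :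
    ∃ h : hardyTwo, EqOn f (hext h) disc := by
  obtain ⟨c, hc, hs⟩ := exists_discSummable hf.1
  have h1 := hf.2
  rw [hardyNormSq_eq_tsum hc hs] at h1
  have h2 : Summable fun n => ‖c n‖ ^ 2 := by
    have := ENNReal.summable_toReal h1.ne
    simpa using this
  obtain ⟨h, hh⟩ := exists_hardyTwo h2
  refine ⟨h, fun z hz => ?_⟩
  have := hasSum_hext h hz
  simp only [hh] at this
  exact (hs z hz).unique this

theorem hext_mem_hardySpace (h : hardyTwo) : hext h ∈ hardySpace :=
  ⟨differentiableOn_hext h, by rw [hardyNormSq_hext]; finiteness⟩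

/-- Dilations of an `H²` function converge to it in `L²`. -/
theorem tendsto_dilate (f : hardyTwo) {r : ℕ → ℝ} (hr : ∀ k, r k ∈ Ico (0 : ℝ) 1)
    (hlim : Tendsto r atTop (𝓝 1)) :
    Tendsto (fun k => dilate (fun n => inner ℂ (mono n) f) (r k)) atTop (𝓝 f) := by
  have hc := discSummable_inner norm_mono_le f
  rw [tendsto_iff_norm_sub_tendsto_zero]
  have h2 : ∀ k, ‖dilate (fun n => inner ℂ (mono n) f) (r k) - f‖ ^ 2 =
      ∑' n, ‖inner ℂ (mono n) f‖ ^ 2 * (1 - r k ^ n) ^ 2 := by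
    intro k
    rw [← (hasSum_norm_sq _).tsum_eq]
    refine tsum_congr fun n => ?_
    rw [inner_sub_right, inner_mono_dilate hc (hr k)]
    have : inner ℂ (mono n) f * ((r k : ℝ) : ℂ) ^ n - inner ℂ (mono n) f =
      inner ℂ (mono n) f * (((r k ^ n - 1 : ℝ)) : ℂ) := by push_cast; ring
    rw [this, norm_mul, mul_pow, Complex.norm_real, Real.norm_eq_abs, sq_abs]
    ring
  have h3 : Tendsto (fun k => ∑' n, ‖inner ℂ (mono n) f‖ ^ 2 * (1 - r k ^ n) ^ 2) atTop
      (𝓝 (∑' n : ℕ, (0 : ℝ))) := by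
    refine tendsto_tsum_of_dominated_convergence (hasSum_norm_sq f).summable (fun n => ?_) ?_
    · have : Tendsto (fun k => ‖inner ℂ (mono n) f‖ ^ 2 * (1 - r k ^ n) ^ 2) atTop
        (𝓝 (‖inner ℂ (mono n) f‖ ^ 2 * (1 - 1 ^ n) ^ 2)) :=
        (((hlim.pow n).const_sub 1).pow 2).const_mul _
      simpa using this
    · refine Eventually.of_forall fun k n => ?_
      rw [Real.norm_of_nonneg (by positivity)]
      refine mul_le_of_le_one_right (by positivity) ?_
      have h4 : r k ^ n ≤ 1 := pow_le_one₀ (hr k).1 (hr k).2.le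
      have h5 : 0 ≤ r k ^ n := pow_nonneg (hr k).1 n
      exact pow_le_one₀ (by linarith) (by linarith)
  rw [tsum_zero] at h3
  have h4 := h3.sqrt
  simp only [Real.sqrt_zero] at h4
  refine h4.congr fun k => ?_
  rw [← h2, Real.sqrt_sq (norm_nonneg _)]

/-- Convergence in `L²` along a subsequence implies convergence almost everywhere. -/
theorem exists_subseq_tendsto_hext (f : hardyTwo) {r : ℕ → ℝ} (hr : ∀ k, r k ∈ Ico (0 : ℝ) 1)
    (hlim : Tendsto r atTop (𝓝 1)) :
    ∃ ns : ℕ → ℕ, StrictMono ns ∧ ∀ᵐ t ∂arc,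
      Tendsto (fun k => hext f ((r (ns k) : ℂ) * (t.toCircle : ℂ))) atTop
        (𝓝 ((f : LTwo) t)) := by
  have hc := discSummable_inner norm_mono_le f
  have h1 : Tendsto (fun k => (dilate (fun n => inner ℂ (mono n) f) (r k) : LTwo)) atTop
      (𝓝 (f : LTwo)) := (continuous_subtype_val.tendsto f).comp (tendsto_dilate f hr hlim)
  obtain ⟨ns, hns, hae⟩ := (tendstoInMeasure_of_tendsto_Lp h1).exists_seq_tendsto_ae
  refine ⟨ns, hns, ?_⟩
  have h2 : ∀ᵐ t ∂arc, ∀ k, ((dilate (fun n => inner ℂ (mono n) f) (r k) : LTwo) :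
      UnitAddCircle → ℂ) t = _ := ae_all_iff.2 fun k => coeFn_dilate hc (hr k)
  filter_upwards [hae, h2] with t ht h2
  refine ht.congr fun k => ?_
  rw [h2, (hasSum_hext f (mul_toCircle_mem_disc (hr _) t)).tsum_eq]

/-- A sequence of radii increasing to `1`. -/
def radius (k : ℕ) : ℝ := 1 - 1 / ((k : ℝ) + 1)

theorem radius_mem (k : ℕ) : radius k ∈ Ico (0 : ℝ) 1 := by
  have h : (1 : ℝ) / ((k : ℝ) + 1) ≤ 1 := by
    rw [div_le_one (by positivity)]; linarith [(Nat.cast_nonneg k : (0 : ℝ) ≤ k)]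
  have h2 : (0 : ℝ) < 1 / ((k : ℝ) + 1) := by positivity
  exact ⟨by rw [radius]; linarith, by rw [radius]; linarith⟩

theorem tendsto_radius : Tendsto radius atTop (𝓝 1) := by
  have := (tendsto_one_div_add_atTop_nhds_zero_nat (𝕜 := ℝ)).const_sub 1
  rwa [sub_zero] at this

/-! ### Multiplication and Toeplitz operators -/

theorem coeFn_mulOp (ψ : LInf) (f : LTwo) : (mulOp ψ f : UnitAddCircle → ℂ) =ᵐ[arc]
    fun t => ψ t * f t :=
  (ContinuousLinearMap.mul ℂ ℂ).coeFn_holder (r := 2) ψ f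

theorem norm_mulOp_le (ψ : LInf) (f : LTwo) : ‖mulOp ψ f‖ ≤ ‖ψ‖ * ‖f‖ := by
  have h := (ContinuousLinearMap.mul ℂ ℂ).norm_holder_apply_apply_le (r := 2) ψ f
  refine h.trans ?_
  have h2 : ‖ContinuousLinearMap.mul ℂ ℂ‖ ≤ 1 := ContinuousLinearMap.opNorm_mul_le ℂ ℂ
  gcongr
  exact mul_le_of_le_one_left (norm_nonneg _) h2

theorem ae_norm_le (ψ : LInf) : ∀ᵐ t ∂arc, ‖ψ t‖ ≤ ‖ψ‖ := by
  filter_upwards [ae_le_eLpNormEssSup (f := ψ) (μ := arc)] with t ht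
  rw [Lp.norm_def, eLpNorm_exponent_top, ← ENNReal.ofReal_le_iff_le_toReal]
  · rwa [ofReal_norm]
  · rw [← eLpNorm_exponent_top]; exact Lp.eLpNorm_ne_top ψ

/-- A bounded measurable function as an element of `L^∞`. -/
theorem exists_LInf {f : UnitAddCircle → ℂ} (hf : AEStronglyMeasurable f arc) {C : ℝ} (hC : 0 ≤ C)
    (h : ∀ᵐ t ∂arc, ‖f t‖ ≤ C) : ∃ ψ : LInf, ψ =ᵐ[arc] f ∧ ‖ψ‖ ≤ C := by
  have hm : MemLp f ∞ arc := memLp_top_of_bound hf C h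
  refine ⟨hm.toLp f, hm.coeFn_toLp, ?_⟩
  rw [Lp.norm_toLp]
  refine ENNReal.toReal_le_of_le_ofReal hC ?_
  rw [eLpNorm_exponent_top]
  exact eLpNormEssSup_le_of_ae_bound h

theorem inner_LTwo (f g : LTwo) : inner ℂ f g = ∫ t, conj (f t) * g t ∂arc := by
  rw [L2.inner_def]
  simp only [RCLike.inner_apply, mul_comm]

theorem inner_mulOp_left (ψ : LInf) (f g : LTwo) :
    inner ℂ (mulOp (star ψ) f) g = inner ℂ f (mulOp ψ g) := by
  rw [inner_LTwo, inner_LTwo]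
  refine integral_congr_ae ?_
  filter_upwards [coeFn_mulOp (star ψ) f, coeFn_mulOp ψ g, Lp.coeFn_star ψ] with t h1 h2 h3
  rw [h1, h2, h3]
  simp only [Pi.star_apply, RCLike.star_def, map_mul, Complex.conj_conj]
  ring

theorem mulOp_comm (ψ χ : LInf) (f : LTwo) : mulOp ψ (mulOp χ f) = mulOp χ (mulOp ψ f) := by
  refine Lp.ext ?_
  filter_upwards [coeFn_mulOp ψ (mulOp χ f), coeFn_mulOp χ (mulOp ψ f), coeFn_mulOp χ f,
    coeFn_mulOp ψ f] with t h1 h2 h3 h4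
  rw [h1, h2, h3, h4]; ring

/-! ### Bounded analytic symbols and their action on Cauchy kernels. -/

/-- Bounded symbols with vanishing negative Fourier coefficients. -/
def AnalyticSymbol (b : LInf) : Prop :=
  ∀ n : ℤ, n < 0 → fourierCoeff (b : UnitAddCircle → ℂ) n = 0

/-- A bounded function viewed in `L²`. -/
def toTwo (b : LInf) : LTwo := mulOp b (fourierLp 2 0)

theorem coeFn_toTwo (b : LInf) : (toTwo b : UnitAddCircle → ℂ) =ᵐ[arc] b := by
  filter_upwards [coeFn_mulOp b (fourierLp 2 0), coeFn_fourierLp (T := 1) 2 0] with t h1 h2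
  rw [toTwo, h1, h2, fourier_zero, mul_one]

theorem norm_toTwo_le (b : LInf) : ‖toTwo b‖ ≤ ‖b‖ := by
  refine (norm_mulOp_le b _).trans ?_
  have h : ‖(fourierLp 2 0 : LTwo)‖ = 1 := orthonormal_fourier.1 _
  rw [h, mul_one]

theorem fourierCoeff_toTwo (b : LInf) (n : ℤ) :
    fourierCoeff (toTwo b : UnitAddCircle → ℂ) n = fourierCoeff (b : UnitAddCircle → ℂ) n :=
  congrFun (fourierCoeff_congr_ae (coeFn_toTwo b)) n

/-- A bounded analytic symbol as an element of `H²`. -/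
def AnalyticSymbol.toHardy {b : LInf} (hb : AnalyticSymbol b) : hardyTwo :=
  ⟨toTwo b, fun n hn => by rw [fourierCoeff_toTwo]; exact hb n hn⟩

theorem AnalyticSymbol.hext_toHardy {b : LInf} (hb : AnalyticSymbol b) :
    hext hb.toHardy = ext b := by
  ext z
  simp only [hext, ext]
  refine tsum_congr fun n => ?_
  rw [show ((hb.toHardy : LTwo)) = toTwo b from rfl, fourierCoeff_toTwo]

theorem AnalyticSymbol.differentiableOn {b : LInf} (hb : AnalyticSymbol b) :
    DifferentiableOn ℂ (ext b) disc := hb.hext_toHardy ▸ differentiableOn_hext _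

theorem fourierCoeff_mulOp_fourier (b : LInf) (n k : ℤ) :
    fourierCoeff (mulOp b (fourierLp 2 k) : UnitAddCircle → ℂ) n =
      fourierCoeff (b : UnitAddCircle → ℂ) (n - k) := by
  simp only [fourierCoeff]
  refine integral_congr_ae ?_
  filter_upwards [coeFn_mulOp b (fourierLp 2 k), coeFn_fourierLp (T := 1) 2 k] with t h1 h2
  rw [h1, h2, show -(n - k) = -n + k by ring, fourier_add]
  simp only [smul_eq_mul]
  ring

theorem AnalyticSymbol.mulOp_mem {b : LInf} (hb : AnalyticSymbol b) (f : hardyTwo) :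
    mulOp b f ∈ hardyTwo := by
  have hle : (Submodule.span ℂ (range mono)).topologicalClosure ≤
      hardyTwo.comap ((mulOp b ∘L hardyTwo.subtypeL : hardyTwo →L[ℂ] LTwo) :
        hardyTwo →ₗ[ℂ] LTwo) := by
    refine Submodule.topologicalClosure_minimal _ ?_ ?_
    · rw [Submodule.span_le]
      rintro _ ⟨k, rfl⟩ n hn
      change fourierCoeff (mulOp b (fourierLp 2 (k : ℤ)) : UnitAddCircle → ℂ) n = 0
      rw [fourierCoeff_mulOp_fourier]
      exact hb _ (by omega)
    · exact isClosed_hardyTwo.preimage (mulOp b ∘L hardyTwo.subtypeL).continuous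
  rw [closure_span_mono] at hle
  exact hle (Submodule.mem_top (x := f))

theorem AnalyticSymbol.toeplitz_coe {b : LInf} (hb : AnalyticSymbol b) (f : hardyTwo) :
    (toeplitz b f : LTwo) = mulOp b f := by
  have h : toeplitz b f = hardyTwo.orthogonalProjectionOnto (mulOp b f) := rfl
  rw [h]
  exact congrArg Subtype.val
    (hardyTwo.orthogonalProjectionOnto_mem_subspace_eq_self ⟨mulOp b f, hb.mulOp_mem f⟩)

/-- Both sides are continuous linear functionals of `f`, so monomials suffice; there multiplication
by `z^k` only shifts the Fourier coefficients of the symbol. -/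
theorem AnalyticSymbol.hext_toeplitz {b : LInf} (hb : AnalyticSymbol b) (f : hardyTwo) {w : ℂ}
    (hw : w ∈ disc) : hext (toeplitz b f) w = ext b w * hext f w := by
  have key : (innerSL ℂ (cauchyKer w)) ∘L (toeplitz b) = ext b w • innerSL ℂ (cauchyKer w) := by
    refine ContinuousLinearMap.ext_on (s := range mono) ?_ ?_
    · rw [Submodule.dense_iff_topologicalClosure_eq_top]; exact closure_span_mono
    · rintro _ ⟨k, rfl⟩
      change inner ℂ (cauchyKer w) (toeplitz b (mono k)) = ext b w * inner ℂ (cauchyKer w) (mono k)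
      rw [← hext_eq_inner hw, ← hext_eq_inner hw, hext_mono k hw,
        ← (hasSum_hext _ hw).tsum_eq, ← hb.hext_toHardy, ← (hasSum_hext _ hw).tsum_eq,
        ← tsum_mul_right]
      have h1 : ∀ n, inner ℂ (mono n) (toeplitz b (mono k)) =
          fourierCoeff (b : UnitAddCircle → ℂ) ((n : ℤ) - k) := fun n => by
        rw [inner_mono, hb.toeplitz_coe, ← fourierCoeff_mulOp_fourier]; rfl
      have h2 : ∀ n, inner ℂ (mono n) hb.toHardy = fourierCoeff (b : UnitAddCircle → ℂ) n :=
        fun n => by rw [inner_mono, ← fourierCoeff_toTwo]; rfl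
      have hs : Summable fun n : ℕ => fourierCoeff (b : UnitAddCircle → ℂ) ((n : ℤ) - k) * w ^ n := by
        have := (hasSum_hext (toeplitz b (mono k)) hw).summable
        simpa only [h1] using this
      simp only [h1, h2]
      rw [← hs.sum_add_tsum_nat_add k, Finset.sum_eq_zero, zero_add]
      · refine tsum_congr fun n => ?_
        push_cast
        rw [add_sub_cancel_right, pow_add, mul_assoc]
      · intro n hn
        rw [hb _ (by have := Finset.mem_range.1 hn; omega), zero_mul]
  have := congrArg (fun T : hardyTwo →L[ℂ] ℂ => T f) key
  rw [hext_eq_inner hw, hext_eq_inner hw]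
  exact this

theorem inner_toeplitz_star (b : LInf) (f g : hardyTwo) :
    inner ℂ (toeplitz (star b) f) g = inner ℂ f (toeplitz b g) := by
  have h1 : inner ℂ (toeplitz (star b) f) g = inner ℂ (mulOp (star b) f) (g : LTwo) :=
    hardyTwo.inner_orthogonalProjectionOnto_eq_of_mem_right g _
  have h2 : inner ℂ f (toeplitz b g) = inner ℂ (f : LTwo) (mulOp b g) :=
    hardyTwo.inner_orthogonalProjectionOnto_eq_of_mem_left f _
  rw [h1, h2, inner_mulOp_left]

theorem toeplitz_star (b : LInf) :
    toeplitz (star b) = ContinuousLinearMap.adjoint (toeplitz b) :=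
  (ContinuousLinearMap.eq_adjoint_iff _ _).2 (inner_toeplitz_star b)

theorem norm_toeplitz_apply_le (b : LInf) (f : hardyTwo) : ‖toeplitz b f‖ ≤ ‖b‖ * ‖f‖ := by
  have h : ‖toeplitz b f‖ ≤ ‖mulOp b (f : LTwo)‖ :=
    hardyTwo.norm_orthogonalProjectionOnto_apply_le (mulOp b f)
  exact h.trans (norm_mulOp_le b f)

theorem hardy_ext_inner_left {f g : hardyTwo} (h : ∀ q : hardyTwo, inner ℂ f q = inner ℂ g q) :
    f = g := ext_inner_right (𝕜 := ℂ) (E := hardyTwo) h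

/-- Cauchy kernels are eigenvectors of coanalytic Toeplitz operators, because they reproduce values
and `T_b` multiplies values by `b(w)`. This puts the kernels into `pairGraph`. -/
theorem AnalyticSymbol.toeplitz_star_cauchyKer {b : LInf} (hb : AnalyticSymbol b) {w : ℂ}
    (hw : w ∈ disc) : toeplitz (star b) (cauchyKer w) = conj (ext b w) • cauchyKer w := by
  refine hardy_ext_inner_left fun q => ?_
  rw [inner_toeplitz_star, hinner_smul_left, ← hext_eq_inner hw, ← hext_eq_inner hw,
    hb.hext_toeplitz q hw, Complex.conj_conj]

theorem cauchyKer_ne_zero {w : ℂ} (hw : w ∈ disc) : cauchyKer w ≠ 0 := by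
  intro h
  have h1 := hext_eq_inner hw (mono 0)
  rw [h, hext_mono 0 hw, inner_zero_left] at h1
  simp at h1

/-- An eigenvalue of `T_{b̄}` is at most its norm, which gives the maximum principle for bounded
symbols. -/
theorem norm_ext_le {b : LInf} (hb : AnalyticSymbol b) {w : ℂ} (hw : w ∈ disc) :
    ‖ext b w‖ ≤ ‖b‖ := by
  have h := norm_toeplitz_apply_le (star b) (cauchyKer w)
  have h2 : ‖star b‖ ≤ ‖b‖ := by
    refine Lp.norm_le_norm_of_ae_le ?_
    filter_upwards [Lp.coeFn_star b] with t ht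
    rw [ht, Pi.star_apply, norm_star]
  replace h := h.trans (mul_le_mul_of_nonneg_right h2 (norm_nonneg _))
  rw [hb.toeplitz_star_cauchyKer hw, hnorm_smul, RCLike.norm_conj] at h
  exact le_of_mul_le_mul_right h (norm_pos_iff.2 (cauchyKer_ne_zero hw))

/-! ### Products and boundary values of bounded analytic functions. -/

/-- The product of two bounded functions. -/
theorem exists_mul (b c : LInf) : ∃ d : LInf, (d =ᵐ[arc] fun t => b t * c t) := by
  have hm : AEStronglyMeasurable (fun t => b t * c t) arc :=
    (Lp.aestronglyMeasurable b).mul (Lp.aestronglyMeasurable c)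
  obtain ⟨d, hd, -⟩ := exists_LInf (C := ‖b‖ * ‖c‖) hm (by positivity) (by
    filter_upwards [ae_norm_le b, ae_norm_le c] with t h1 h2
    rw [norm_mul]; gcongr)
  exact ⟨d, hd⟩

theorem toTwo_of_mul {b c d : LInf} (hd : d =ᵐ[arc] fun t => b t * c t) :
    toTwo d = mulOp b (toTwo c) := by
  refine Lp.ext ?_
  filter_upwards [coeFn_toTwo d, coeFn_mulOp b (toTwo c), coeFn_toTwo c, hd] with t h1 h2 h3 h4
  rw [h1, h2, h3, h4]

theorem AnalyticSymbol.of_mul {b c d : LInf} (hb : AnalyticSymbol b) (hc : AnalyticSymbol c)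
    (hd : d =ᵐ[arc] fun t => b t * c t) : AnalyticSymbol d := by
  intro n hn
  rw [← fourierCoeff_toTwo, toTwo_of_mul hd]
  exact hb.mulOp_mem hc.toHardy n hn

theorem ext_of_mul {b c d : LInf} (hb : AnalyticSymbol b) (hc : AnalyticSymbol c)
    (hd : d =ᵐ[arc] fun t => b t * c t) {z : ℂ} (hz : z ∈ disc) :
    ext d z = ext b z * ext c z := by
  rw [← (hb.of_mul hc hd).hext_toHardy, ← hc.hext_toHardy, ← hb.hext_toeplitz _ hz]
  congr 1
  apply Subtype.ext
  rw [hb.toeplitz_coe]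
  exact toTwo_of_mul hd

theorem AnalyticSymbol.eq_of_ext {b c : LInf} (hb : AnalyticSymbol b) (hc : AnalyticSymbol c)
    (h : EqOn (ext b) (ext c) disc) : b = c := by
  have h1 : hb.toHardy = hc.toHardy :=
    hext_injective (by rw [hb.hext_toHardy, hc.hext_toHardy]; exact h)
  refine Lp.ext ?_
  refine (coeFn_toTwo b).symm.trans (Filter.EventuallyEq.trans ?_ (coeFn_toTwo c))
  rw [show toTwo b = toTwo c from congrArg Subtype.val h1]

/-- A bounded holomorphic function has boundary values in `L^∞`. -/
theorem exists_boundary {F : ℂ → ℂ} (hF : DifferentiableOn ℂ F disc) {M : ℝ} (hM : 0 ≤ M)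
    (hb : ∀ z ∈ disc, ‖F z‖ ≤ M) :
    ∃ f : LInf, AnalyticSymbol f ∧ EqOn (ext f) F disc ∧ ‖f‖ ≤ M := by
  have hmem : F ∈ hardySpace := by
    refine ⟨hF, lt_of_le_of_lt (b := ENNReal.ofReal M ^ 2) ?_ (by finiteness)⟩
    refine iSup₂_le fun r hr => ?_
    calc _ ≤ ∫⁻ t : UnitAddCircle, ENNReal.ofReal M ^ 2 ∂AddCircle.haarAddCircle := by
          refine lintegral_mono fun t => ?_
          gcongr
          rw [← ofReal_norm]
          exact ENNReal.ofReal_le_ofReal (hb _ (mul_toCircle_mem_disc hr t))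
      _ = _ := by simp
  obtain ⟨h, hh⟩ := exists_hext_eq hmem
  -- Almost everywhere the boundary function is a limit of values of `F` along a sequence of radii,
  -- so it inherits the bound `M`.
  obtain ⟨ns, -, hae⟩ := exists_subseq_tendsto_hext h radius_mem tendsto_radius
  obtain ⟨f, hf, hfM⟩ := exists_LInf (Lp.aestronglyMeasurable (h : LTwo)) hM (by
    filter_upwards [hae] with t ht
    refine le_of_tendsto ht.norm (Eventually.of_forall fun k => ?_)
    have hm := mul_toCircle_mem_disc (radius_mem (ns k)) t
    rw [← hh hm]
    exact hb _ hm)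
  have hcoef := fourierCoeff_congr_ae hf
  refine ⟨f, fun n hn => ?_, fun z hz => ?_, hfM⟩
  · rw [hcoef]; exact h.2 n hn
  · rw [hh hz, hext, ext, ext, hcoef]

/-! ### Herglotz and Poisson integrals -/

/-- The Herglotz kernel `(ζ + z) / (ζ - z)` with `ζ = exp (2 π i t)`. -/
def herglotzKer (t : UnitAddCircle) (z : ℂ) : ℂ := ((t.toCircle : ℂ) + z) / ((t.toCircle : ℂ) - z)

/-- The Herglotz integral of a complex function on the circle. -/
def herglotzC (f : UnitAddCircle → ℂ) (z : ℂ) : ℂ := ∫ t, herglotzKer t z * f t ∂arc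

/-- The Herglotz integral of a real function on the circle. -/
def herglotz (u : UnitAddCircle → ℝ) (z : ℂ) : ℂ := herglotzC (fun t => (u t : ℂ)) z

theorem continuous_toCircle : Continuous fun t : UnitAddCircle => (t.toCircle : ℂ) :=
  continuous_subtype_val.comp AddCircle.continuous_toCircle

theorem toCircle_sub_ne_zero (t : UnitAddCircle) {z : ℂ} (hz : z ∈ disc) :
    (t.toCircle : ℂ) - z ≠ 0 := by
  intro h
  have h1 := norm_toCircle t
  rw [sub_eq_zero.1 h] at h1
  exact (mem_disc.1 hz).ne h1

theorem fourier_neg_natCast (t : UnitAddCircle) (k : ℕ) :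
    (fourier (-(k : ℤ)) t : ℂ) = (conj (t.toCircle : ℂ)) ^ k := by
  rw [fourier_neg, fourier_apply, natCast_zsmul, AddCircle.toCircle_nsmul, ← map_pow]
  rfl

theorem conj_toCircle_mul (t : UnitAddCircle) : conj (t.toCircle : ℂ) * (t.toCircle : ℂ) = 1 := by
  rw [← Complex.normSq_eq_conj_mul_self, Complex.normSq_eq_norm_sq, norm_toCircle]; simp

/-- The coefficients `1, 2, 2, …` of `(1 + x) / (1 - x)`. -/
def herglotzCoeff (k : ℕ) : ℂ := if k = 0 then 1 else 2

theorem norm_herglotzCoeff_le (k : ℕ) : ‖herglotzCoeff k‖ ≤ 2 := by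
  rw [herglotzCoeff]; split_ifs <;> simp

theorem hasSum_herglotzKer (t : UnitAddCircle) {z : ℂ} (hz : z ∈ disc) :
    HasSum (fun k : ℕ => herglotzCoeff k * fourier (-(k : ℤ)) t * z ^ k) (herglotzKer t z) := by
  set x := conj (t.toCircle : ℂ) * z with hx
  have hx1 : ‖x‖ < 1 := by
    rw [hx, norm_mul, RCLike.norm_conj, norm_toCircle, one_mul]; exact mem_disc.1 hz
  -- The kernel is `(1 + x)/(1 - x) = 2/(1 - x) - 1` with `x = ζ̄ z`, hence the coefficients 1, 2,
  -- 2, ….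
  have h1 := ((hasSum_geometric_of_norm_lt_one hx1).mul_left 2).sub (hasSum_ite_eq (0 : ℕ) (1 : ℂ))
  have hz' : z = (t.toCircle : ℂ) * x := by
    rw [hx, ← mul_assoc, mul_comm (t.toCircle : ℂ), conj_toCircle_mul, one_mul]
  have hne : (1 : ℂ) - x ≠ 0 := by
    intro h
    rw [← sub_eq_zero.1 h] at hx1; simp at hx1
  have ht : (t.toCircle : ℂ) ≠ 0 := by
    intro h; have := norm_toCircle t; rw [h] at this; simp at this
  have h2 : herglotzKer t z = 2 * (1 - x)⁻¹ - 1 := by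
    have h3 : herglotzKer t z = (1 + x) / (1 - x) := by
      rw [herglotzKer, hz', div_eq_div_iff _ hne]
      · ring
      · rw [← hz']; exact toCircle_sub_ne_zero t hz
    rw [h3]
    field_simp
    ring
  rw [h2]
  refine h1.congr_fun fun k => ?_
  rw [fourier_neg_natCast, mul_assoc, ← mul_pow, herglotzCoeff]
  split_ifs with hk
  · subst hk; simp; norm_num
  · simp [hx]

theorem continuous_herglotzKer {z : ℂ} (hz : z ∈ disc) : Continuous fun t => herglotzKer t z :=
  (continuous_toCircle.add continuous_const).div (continuous_toCircle.sub continuous_const)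
    fun t => toCircle_sub_ne_zero t hz

theorem integrable_herglotzKer_mul {f : UnitAddCircle → ℂ} (hf : Integrable f arc) {z : ℂ}
    (hz : z ∈ disc) : Integrable (fun t => herglotzKer t z * f t) arc := by
  have hc := continuous_herglotzKer hz
  obtain ⟨C, hC⟩ := isCompact_univ.exists_bound_of_continuousOn hc.continuousOn
  exact hf.bdd_mul (c := C) hc.aestronglyMeasurable (Eventually.of_forall fun t => hC t trivial)

theorem integrable_fourier_mul {f : UnitAddCircle → ℂ} (hf : Integrable f arc) (n : ℤ) :
    Integrable (fun t => fourier n t * f t) arc := by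
  refine hf.bdd_mul (c := 1) (fourier n).continuous.aestronglyMeasurable
    (Eventually.of_forall fun t => ?_)
  rw [fourier_apply]; exact (Circle.norm_coe _).le

theorem hasSum_herglotzC {f : UnitAddCircle → ℂ} (hf : Integrable f arc) {z : ℂ}
    (hz : z ∈ disc) :
    HasSum (fun k : ℕ => herglotzCoeff k * fourierCoeff f k * z ^ k) (herglotzC f z) := by
  have hn : ∀ (k : ℕ) (t : UnitAddCircle), ‖herglotzCoeff k * fourier (-(k : ℤ)) t * z ^ k * f t‖ =
      ‖herglotzCoeff k‖ * ‖z‖ ^ k * ‖f t‖ := fun k t => by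
    rw [fourier_neg_natCast]
    simp only [norm_mul, norm_pow, RCLike.norm_conj, norm_toCircle, one_pow, mul_one]
  have h := hasSum_integral_of_summable_integral_norm (μ := arc)
    (F := fun (k : ℕ) (t : UnitAddCircle) => herglotzCoeff k * fourier (-(k : ℤ)) t * z ^ k * f t)
    (fun k => ?_) ?_
  · have h2 : herglotzC f z = ∫ t, ∑' k : ℕ, herglotzCoeff k * fourier (-(k : ℤ)) t * z ^ k * f t
        ∂arc := by
      refine integral_congr_ae (Eventually.of_forall fun t => ?_)
      simp only
      rw [tsum_mul_right, (hasSum_herglotzKer t hz).tsum_eq]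
    rw [h2]
    refine h.congr_fun fun k => ?_
    rw [fourierCoeff, ← integral_const_mul, ← integral_mul_const]
    refine integral_congr_ae (Eventually.of_forall fun t => ?_)
    simp only [smul_eq_mul]
    ring
  · have := (integrable_fourier_mul hf (-(k : ℤ))).const_mul (herglotzCoeff k * z ^ k)
    refine this.congr (Eventually.of_forall fun t => ?_)
    simp only
    ring
  · simp only [hn]
    simp only [integral_const_mul]
    refine Summable.mul_right _ ?_
    refine Summable.of_nonneg_of_le (fun k => by positivity) (fun k => ?_)
      ((summable_geometric_of_lt_one (norm_nonneg z) (mem_disc.1 hz)).mul_left 2)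
    gcongr
    exact norm_herglotzCoeff_le k

theorem norm_fourierCoeff_le (f : UnitAddCircle → ℂ) (n : ℤ) :
    ‖fourierCoeff f n‖ ≤ ∫ t, ‖f t‖ ∂arc := by
  refine (norm_integral_le_integral_norm _).trans (le_of_eq ?_)
  refine integral_congr_ae (Eventually.of_forall fun t => ?_)
  simp only [smul_eq_mul, norm_mul, fourier_apply]
  rw [Circle.norm_coe, one_mul]

theorem differentiableOn_herglotzC {f : UnitAddCircle → ℂ} (hf : Integrable f arc) :
    DifferentiableOn ℂ (herglotzC f) disc := by
  have hc : DiscSummable fun k : ℕ => herglotzCoeff k * fourierCoeff f k := by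
    refine discSummable_of_le (C := 2 * ∫ t, ‖f t‖ ∂arc) fun n => ?_
    have h0 : 0 ≤ ∫ t, ‖f t‖ ∂arc := integral_nonneg fun _ => norm_nonneg _
    rw [norm_mul]
    calc _ ≤ 2 * ∫ t, ‖f t‖ ∂arc := by
          gcongr
          · exact norm_herglotzCoeff_le n
          · exact norm_fourierCoeff_le f n
      _ ≤ _ := le_mul_of_one_le_right (by positivity) (by linarith [(Nat.cast_nonneg n : (0 : ℝ) ≤ n)])
  exact hc.differentiableOn.congr fun z hz => (hasSum_herglotzC hf hz).tsum_eq.symm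

theorem differentiableOn_herglotz {u : UnitAddCircle → ℝ} (hu : Integrable u arc) :
    DifferentiableOn ℂ (herglotz u) disc := differentiableOn_herglotzC hu.ofReal

theorem herglotz_add {u v : UnitAddCircle → ℝ} (hu : Integrable u arc) (hv : Integrable v arc)
    {z : ℂ} (hz : z ∈ disc) :
    herglotz (fun t => u t + v t) z = herglotz u z + herglotz v z := by
  refine Eq.trans ?_ (integral_add (integrable_herglotzKer_mul hu.ofReal hz)
      (integrable_herglotzKer_mul hv.ofReal hz))
  refine integral_congr_ae (Eventually.of_forall fun t => ?_)
  simp only [Complex.ofReal_add]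
  ring

theorem herglotz_neg (u : UnitAddCircle → ℝ) (z : ℂ) :
    herglotz (fun t => -u t) z = -herglotz u z := by
  rw [herglotz, herglotz, herglotzC, herglotzC, ← integral_neg]
  refine integral_congr_ae (Eventually.of_forall fun t => ?_)
  simp

theorem herglotz_congr {u v : UnitAddCircle → ℝ} (h : u =ᵐ[arc] v) (z : ℂ) :
    herglotz u z = herglotz v z := by
  refine integral_congr_ae ?_
  filter_upwards [h] with t ht
  rw [ht]

theorem herglotz_zero_right (u : UnitAddCircle → ℝ) : herglotz u 0 = ((∫ t, u t ∂arc : ℝ) : ℂ) := by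
  rw [herglotz, herglotzC, ← integral_complex_ofReal]
  refine integral_congr_ae (Eventually.of_forall fun t => ?_)
  have h := toCircle_sub_ne_zero t zero_mem_disc
  rw [sub_zero] at h
  simp only [herglotzKer, add_zero, sub_zero]
  rw [div_self h, one_mul]

theorem herglotzC_one {z : ℂ} (hz : z ∈ disc) : herglotzC (fun _ => 1) z = 1 := by
  have h := hasSum_herglotzC (integrable_const (1 : ℂ)) hz
  have h1 : ∀ k : ℕ, fourierCoeff (fun _ : UnitAddCircle => (1 : ℂ)) k =
      if k = 0 then 1 else 0 := by
    intro k
    have h2 : (fun _ : UnitAddCircle => (1 : ℂ)) = fourier 0 := by ext t; simp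
    rw [h2, fourierCoeff_fourier]
    simp [Pi.single_apply]
  simp only [h1] at h
  rw [← h.tsum_eq, tsum_eq_single 0 (fun k hk => by simp [hk])]
  simp [herglotzCoeff]

/-! ### Poisson integrals. -/

/-- The Poisson kernel. -/
def poissonKer (t : UnitAddCircle) (z : ℂ) : ℝ := (herglotzKer t z).re

theorem poissonKer_eq (t : UnitAddCircle) {z : ℂ} (hz : z ∈ disc) :
    poissonKer t z = (1 - ‖z‖ ^ 2) / ‖(t.toCircle : ℂ) - z‖ ^ 2 := by
  have hne := toCircle_sub_ne_zero t hz
  have h1 : Complex.normSq (t.toCircle : ℂ) = 1 := by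
    rw [Complex.normSq_eq_norm_sq, norm_toCircle, one_pow]
  rw [poissonKer, herglotzKer, Complex.div_re, ← Complex.normSq_eq_norm_sq,
    ← Complex.normSq_eq_norm_sq, ← add_div]
  congr 1
  rw [Complex.normSq_apply] at h1
  simp only [Complex.normSq_apply, Complex.add_re, Complex.sub_re, Complex.add_im, Complex.sub_im]
  linear_combination h1

theorem poissonKer_nonneg (t : UnitAddCircle) {z : ℂ} (hz : z ∈ disc) : 0 ≤ poissonKer t z := by
  rw [poissonKer_eq t hz]
  have := mem_disc.1 hz
  have : ‖z‖ ^ 2 ≤ 1 := pow_le_one₀ (norm_nonneg _) this.le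
  exact div_nonneg (by linarith) (by positivity)

theorem continuous_poissonKer {z : ℂ} (hz : z ∈ disc) : Continuous fun t => poissonKer t z :=
  Complex.continuous_re.comp (continuous_herglotzKer hz)

theorem herglotz_re {u : UnitAddCircle → ℝ} (hu : Integrable u arc) {z : ℂ} (hz : z ∈ disc) :
    (herglotz u z).re = ∫ t, poissonKer t z * u t ∂arc := by
  have h := integral_re (integrable_herglotzKer_mul hu.ofReal hz)
  rw [herglotz, herglotzC]
  refine h.symm.trans (integral_congr_ae (Eventually.of_forall fun t => ?_))
  simp [poissonKer]

theorem integrable_poissonKer_mul {u : UnitAddCircle → ℝ} (hu : Integrable u arc) {z : ℂ}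
    (hz : z ∈ disc) : Integrable (fun t => poissonKer t z * u t) arc := by
  refine (integrable_herglotzKer_mul hu.ofReal hz).re.congr (Eventually.of_forall fun t => ?_)
  simp [poissonKer]

theorem herglotz_re_mono {u v : UnitAddCircle → ℝ} (hu : Integrable u arc) (hv : Integrable v arc)
    (h : ∀ᵐ t ∂arc, u t ≤ v t) {z : ℂ} (hz : z ∈ disc) :
    (herglotz u z).re ≤ (herglotz v z).re := by
  rw [herglotz_re hu hz, herglotz_re hv hz]
  refine integral_mono_ae (integrable_poissonKer_mul hu hz) (integrable_poissonKer_mul hv hz) ?_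
  filter_upwards [h] with t ht
  exact mul_le_mul_of_nonneg_left ht (poissonKer_nonneg t hz)

theorem herglotz_const (c : ℝ) {z : ℂ} (hz : z ∈ disc) : herglotz (fun _ => c) z = c := by
  have : herglotz (fun _ => c) z = herglotzC (fun _ => 1) z * c := by
    rw [herglotz, herglotzC, herglotzC, ← integral_mul_const]
    simp
  rw [this, herglotzC_one hz, one_mul]

theorem herglotz_re_le {u : UnitAddCircle → ℝ} (hu : Integrable u arc) {C : ℝ}
    (h : ∀ᵐ t ∂arc, u t ≤ C) {z : ℂ} (hz : z ∈ disc) : (herglotz u z).re ≤ C := by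
  have := herglotz_re_mono hu (integrable_const C) h hz
  rwa [herglotz_const C hz, Complex.ofReal_re] at this

/-- The Poisson integral of a complex function, on the circle of radius `r`. -/
def poissonC (r : ℝ) (f : UnitAddCircle → ℂ) (s : UnitAddCircle) : ℂ :=
  ∫ t, (poissonKer t ((r : ℂ) * (s.toCircle : ℂ)) : ℂ) * f t ∂arc

/-- For unimodular `ζ, η` one has `|ζ - rη| = |η - rζ|`. With Tonelli, this lets the unit mass of
the kernel be used in the other variable and makes Poisson integration an `L¹` contraction. -/
theorem poissonKer_symm {r : ℝ} (hr : r ∈ Ico (0 : ℝ) 1) (s t : UnitAddCircle) :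
    poissonKer t ((r : ℂ) * (s.toCircle : ℂ)) = poissonKer s ((r : ℂ) * (t.toCircle : ℂ)) := by
  rw [poissonKer_eq t (mul_toCircle_mem_disc hr s), poissonKer_eq s (mul_toCircle_mem_disc hr t)]
  congr 1
  · simp only [norm_mul, norm_toCircle]
  · have h1 : ∀ t : UnitAddCircle, (t.toCircle : ℂ).re ^ 2 + (t.toCircle : ℂ).im ^ 2 = 1 := by
      intro t
      have : Complex.normSq (t.toCircle : ℂ) = 1 := by
        rw [Complex.normSq_eq_norm_sq, norm_toCircle, one_pow]
      rw [Complex.normSq_apply] at this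
      linarith
    rw [← Complex.normSq_eq_norm_sq, ← Complex.normSq_eq_norm_sq, Complex.normSq_apply,
      Complex.normSq_apply]
    simp only [Complex.sub_re, Complex.sub_im, Complex.re_ofReal_mul, Complex.im_ofReal_mul]
    linear_combination (1 - r ^ 2) * h1 t - (1 - r ^ 2) * h1 s

theorem lintegral_poissonKer {z : ℂ} (hz : z ∈ disc) :
    ∫⁻ t, ENNReal.ofReal (poissonKer t z) ∂arc = 1 := by
  have h := herglotz_re (u := fun _ => 1) (integrable_const 1) hz
  rw [herglotz_const 1 hz] at h
  simp only [mul_one, Complex.ofReal_re] at h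
  have hi := integrable_poissonKer_mul (u := fun _ => 1) (integrable_const 1) hz
  simp only [mul_one] at hi
  rw [← ofReal_integral_eq_lintegral_ofReal hi
    (Eventually.of_forall fun t => poissonKer_nonneg t hz), ← h, ENNReal.ofReal_one]

theorem integrable_poissonKer_mulC {f : UnitAddCircle → ℂ} (hf : Integrable f arc) {z : ℂ}
    (hz : z ∈ disc) : Integrable (fun t => (poissonKer t z : ℂ) * f t) arc := by
  have hc := continuous_poissonKer hz
  obtain ⟨C, hC⟩ := isCompact_univ.exists_bound_of_continuousOn hc.continuousOn
  exact hf.bdd_mul (c := C) (Complex.continuous_ofReal.comp hc).aestronglyMeasurable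
    (Eventually.of_forall fun t => by simpa using hC t trivial)

theorem continuous_poissonKer_uncurry {r : ℝ} (hr : r ∈ Ico (0 : ℝ) 1) :
    Continuous fun p : UnitAddCircle × UnitAddCircle =>
      poissonKer p.2 ((r : ℂ) * (p.1.toCircle : ℂ)) := by
  refine Complex.continuous_re.comp (Continuous.div ?_ ?_ fun p =>
    toCircle_sub_ne_zero p.2 (mul_toCircle_mem_disc hr p.1))
  · exact (continuous_toCircle.comp continuous_snd).add
      (continuous_const.mul (continuous_toCircle.comp continuous_fst))
  · exact (continuous_toCircle.comp continuous_snd).sub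
      (continuous_const.mul (continuous_toCircle.comp continuous_fst))

theorem lintegral_poissonC_le {f : UnitAddCircle → ℂ} (hf : Integrable f arc) {r : ℝ}
    (hr : r ∈ Ico (0 : ℝ) 1) : ∫⁻ s, ‖poissonC r f s‖ₑ ∂arc ≤ ∫⁻ t, ‖f t‖ₑ ∂arc := by
  calc ∫⁻ s, ‖poissonC r f s‖ₑ ∂arc
      ≤ ∫⁻ s, ∫⁻ t, ENNReal.ofReal (poissonKer t ((r : ℂ) * (s.toCircle : ℂ))) * ‖f t‖ₑ ∂arc ∂arc := by
        refine lintegral_mono fun s => (enorm_integral_le_lintegral_enorm _).trans ?_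
        refine lintegral_mono fun t => ?_
        rw [enorm_mul, ← ofReal_norm, Complex.norm_real,
          Real.norm_of_nonneg (poissonKer_nonneg t (mul_toCircle_mem_disc hr s))]
    _ = ∫⁻ t, ∫⁻ s, ENNReal.ofReal (poissonKer t ((r : ℂ) * (s.toCircle : ℂ))) * ‖f t‖ₑ ∂arc ∂arc := by
        refine lintegral_lintegral_swap ?_
        have h1 : AEMeasurable (fun p : UnitAddCircle × UnitAddCircle =>
            ENNReal.ofReal (poissonKer p.2 ((r : ℂ) * (p.1.toCircle : ℂ)))) (arc.prod arc) :=
          (continuous_poissonKer_uncurry hr).measurable.ennreal_ofReal.aemeasurable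
        have h2 : AEMeasurable (fun p : UnitAddCircle × UnitAddCircle => ‖f p.2‖ₑ)
            (arc.prod arc) := hf.aestronglyMeasurable.comp_snd.enorm
        exact h1.mul h2
    _ = ∫⁻ t, ‖f t‖ₑ ∂arc := by
        refine lintegral_congr fun t => ?_
        have hm : Measurable fun s : UnitAddCircle =>
            ENNReal.ofReal (poissonKer t ((r : ℂ) * (s.toCircle : ℂ))) :=
          ((continuous_poissonKer_uncurry hr).comp
            (continuous_id.prodMk continuous_const)).measurable.ennreal_ofReal
        rw [lintegral_mul_const _ hm]
        simp only [poissonKer_symm hr _ t]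
        rw [lintegral_poissonKer (mul_toCircle_mem_disc hr t), one_mul]

/-! ### Convergence of Poisson integrals in `L¹` -/

theorem poissonC_congr {f g : UnitAddCircle → ℂ} (h : f =ᵐ[arc] g) (r : ℝ) :
    poissonC r f = poissonC r g := by
  ext s
  refine integral_congr_ae ?_
  filter_upwards [h] with t ht
  rw [ht]

theorem poissonC_add {f g : UnitAddCircle → ℂ} (hf : Integrable f arc) (hg : Integrable g arc)
    {r : ℝ} (hr : r ∈ Ico (0 : ℝ) 1) (s : UnitAddCircle) :
    poissonC r (fun t => f t + g t) s = poissonC r f s + poissonC r g s := by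
  refine Eq.trans ?_ (integral_add (integrable_poissonKer_mulC hf (mul_toCircle_mem_disc hr s))
    (integrable_poissonKer_mulC hg (mul_toCircle_mem_disc hr s)))
  refine integral_congr_ae (Eventually.of_forall fun t => ?_)
  simp only
  ring

theorem poissonC_const_mul (c : ℂ) (f : UnitAddCircle → ℂ) (r : ℝ) (s : UnitAddCircle) :
    poissonC r (fun t => c * f t) s = c * poissonC r f s := by
  rw [poissonC, poissonC, ← integral_const_mul]
  refine integral_congr_ae (Eventually.of_forall fun t => ?_)
  simp only
  ring

theorem poissonC_ofReal {u : UnitAddCircle → ℝ} (hu : Integrable u arc) {r : ℝ}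
    (hr : r ∈ Ico (0 : ℝ) 1) (s : UnitAddCircle) :
    poissonC r (fun t => (u t : ℂ)) s = ((herglotz u ((r : ℂ) * (s.toCircle : ℂ))).re : ℂ) := by
  rw [herglotz_re hu (mul_toCircle_mem_disc hr s), ← integral_complex_ofReal]
  refine integral_congr_ae (Eventually.of_forall fun t => ?_)
  simp

/-- The Poisson kernel is half the sum of the Herglotz kernel and its conjugate. For a nonconstant
character one of the two Herglotz integrals vanishes, which leaves the factor `r^|n|`. -/
theorem poissonC_eq {f : UnitAddCircle → ℂ} (hf : Integrable f arc)
    (hf' : Integrable (fun t => conj (f t)) arc) {r : ℝ}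
    (hr : r ∈ Ico (0 : ℝ) 1) (s : UnitAddCircle) :
    poissonC r f s = (herglotzC f ((r : ℂ) * (s.toCircle : ℂ)) +
      conj (herglotzC (fun t => conj (f t)) ((r : ℂ) * (s.toCircle : ℂ)))) / 2 := by
  have hz := mul_toCircle_mem_disc hr s
  have h1 : conj (herglotzC (fun t => conj (f t)) ((r : ℂ) * (s.toCircle : ℂ))) =
      ∫ t, conj (herglotzKer t ((r : ℂ) * (s.toCircle : ℂ))) * f t ∂arc := by
    rw [herglotzC, ← integral_conj]
    refine integral_congr_ae (Eventually.of_forall fun t => ?_)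
    simp
  have h2 : Integrable (fun t => conj (herglotzKer t ((r : ℂ) * (s.toCircle : ℂ))) * f t) arc := by
    have := (Complex.conjCLE : ℂ →L[ℝ] ℂ).integrable_comp (integrable_herglotzKer_mul hf' hz)
    refine this.congr (Eventually.of_forall fun t => ?_)
    simp
  have h3 := integral_add (integrable_herglotzKer_mul hf hz) h2
  rw [h1, eq_div_iff two_ne_zero]
  refine Eq.trans ?_ h3
  rw [poissonC, ← integral_mul_const]
  refine integral_congr_ae (Eventually.of_forall fun t => ?_)
  simp only
  rw [← add_mul, Complex.add_conj, poissonKer]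
  push_cast
  ring

theorem integrable_fourier (n : ℤ) : Integrable (fun t : UnitAddCircle => (fourier n t : ℂ)) arc :=
  (fourier n).continuous.integrable_of_hasCompactSupport (HasCompactSupport.of_compactSpace _)

theorem herglotzC_fourier_natCast (n : ℕ) {z : ℂ} (hz : z ∈ disc) :
    herglotzC (fourier (n : ℤ)) z = herglotzCoeff n * z ^ n := by
  rw [← (hasSum_herglotzC (integrable_fourier n) hz).tsum_eq, tsum_eq_single n]
  · rw [fourierCoeff_fourier]; simp
  · intro k hk
    rw [fourierCoeff_fourier, Pi.single_eq_of_ne (by exact_mod_cast hk)]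
    simp

theorem herglotzC_fourier_neg {n : ℤ} (hn : n < 0) {z : ℂ} (hz : z ∈ disc) :
    herglotzC (fourier n) z = 0 := by
  rw [← (hasSum_herglotzC (integrable_fourier n) hz).tsum_eq, ← tsum_zero (β := ℕ)]
  refine tsum_congr fun k => ?_
  rw [fourierCoeff_fourier, Pi.single_eq_of_ne (by omega)]
  simp

theorem conj_fourier (n : ℤ) : (fun t : UnitAddCircle => conj (fourier n t : ℂ)) = fourier (-n) := by
  ext t
  rw [fourier_neg]

theorem toCircle_pow (t : UnitAddCircle) (n : ℕ) :
    (t.toCircle : ℂ) ^ n = (fourier (n : ℤ) t : ℂ) := by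
  rw [fourier_apply, natCast_zsmul, AddCircle.toCircle_nsmul]; rfl

theorem poissonC_fourier (n : ℤ) {r : ℝ} (hr : r ∈ Ico (0 : ℝ) 1) (s : UnitAddCircle) :
    poissonC r (fourier n) s = ((r ^ n.natAbs : ℝ) : ℂ) * fourier n s := by
  have hz := mul_toCircle_mem_disc hr s
  rw [poissonC_eq (integrable_fourier n) (by rw [conj_fourier]; exact integrable_fourier _) hr,
    conj_fourier]
  obtain ⟨k, rfl | rfl⟩ := n.eq_nat_or_neg
  · rw [herglotzC_fourier_natCast k hz]
    rcases Nat.eq_zero_or_pos k with rfl | hk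
    · have := herglotzC_fourier_natCast 0 hz
      simp only [Nat.cast_zero] at this
      simp [this, herglotzCoeff]
    · rw [herglotzC_fourier_neg (by omega) hz, mul_pow, toCircle_pow, herglotzCoeff,
        if_neg hk.ne']
      simp
  · rw [neg_neg, herglotzC_fourier_natCast k hz]
    rcases Nat.eq_zero_or_pos k with rfl | hk
    · simp [herglotzC_one hz, herglotzCoeff]
    · rw [herglotzC_fourier_neg (by omega) hz, mul_pow, toCircle_pow, herglotzCoeff,
        if_neg hk.ne', fourier_neg, zero_add, map_mul, map_mul, map_ofNat, Int.natAbs_neg,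
        Int.natAbs_natCast, map_pow, Complex.conj_ofReal, Complex.ofReal_pow]
      ring

theorem tendsto_lintegral_poissonC_fourier (n : ℤ) {r : ℕ → ℝ} (hr : ∀ k, r k ∈ Ico (0 : ℝ) 1)
    (hlim : Tendsto r atTop (𝓝 1)) :
    Tendsto (fun k => ∫⁻ s, ‖poissonC (r k) (fourier n) s - fourier n s‖ₑ ∂arc) atTop (𝓝 0) := by
  have h1 : ∀ k, ∫⁻ s, ‖poissonC (r k) (fourier n) s - fourier n s‖ₑ ∂arc =
      ENNReal.ofReal |r k ^ n.natAbs - 1| := fun k => by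
    have h2 : ∀ s : UnitAddCircle, ‖poissonC (r k) (fourier n) s - fourier n s‖ₑ =
        ENNReal.ofReal |r k ^ n.natAbs - 1| := fun s => by
      rw [poissonC_fourier n (hr k) s, ← sub_one_mul, ← ofReal_norm, norm_mul]
      have h3 : ‖(fourier n s : ℂ)‖ = 1 := by rw [fourier_apply]; exact Circle.norm_coe _
      rw [h3, mul_one, ← Complex.ofReal_one, ← Complex.ofReal_sub, Complex.norm_real,
        Real.norm_eq_abs]
    simp only [h2]
    simp
  simp only [h1]
  have h4 : Tendsto (fun k => |r k ^ n.natAbs - 1|) atTop (𝓝 0) := by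
    have := ((hlim.pow n.natAbs).sub_const 1).abs
    simpa using this
  have := ENNReal.tendsto_ofReal h4
  simpa using this

/-- The set of integrable functions whose Poisson integrals converge back in `L¹`. -/
def PoissonConverges (r : ℕ → ℝ) (f : UnitAddCircle → ℂ) : Prop :=
  Tendsto (fun k => ∫⁻ s, ‖poissonC (r k) f s - f s‖ₑ ∂arc) atTop (𝓝 0)

theorem PoissonConverges.congr {r : ℕ → ℝ} {f g : UnitAddCircle → ℂ} (h : PoissonConverges r f)
    (hfg : f =ᵐ[arc] g) : PoissonConverges r g := by
  refine Tendsto.congr (fun k => ?_) h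
  rw [poissonC_congr hfg]
  refine lintegral_congr_ae ?_
  filter_upwards [hfg] with t ht
  rw [ht]

theorem aestronglyMeasurable_poissonC {f : UnitAddCircle → ℂ} (hf : Integrable f arc) {r : ℝ}
    (hr : r ∈ Ico (0 : ℝ) 1) : AEStronglyMeasurable (poissonC r f) arc := by
  have h1 : AEStronglyMeasurable (fun p : UnitAddCircle × UnitAddCircle =>
      ((poissonKer p.2 ((r : ℂ) * (p.1.toCircle : ℂ)) : ℂ))) (arc.prod arc) :=
    (Complex.continuous_ofReal.comp (continuous_poissonKer_uncurry hr)).aestronglyMeasurable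
  exact (h1.mul hf.aestronglyMeasurable.comp_snd).integral_prod_right'

theorem PoissonConverges.add {r : ℕ → ℝ} (hr : ∀ k, r k ∈ Ico (0 : ℝ) 1)
    {f g : UnitAddCircle → ℂ} (hf : Integrable f arc) (hg : Integrable g arc)
    (h1 : PoissonConverges r f) (h2 : PoissonConverges r g) :
    PoissonConverges r (fun t => f t + g t) := by
  refine tendsto_of_tendsto_of_tendsto_of_le_of_le tendsto_const_nhds
    (by simpa using Filter.Tendsto.add h1 h2) (fun _ => zero_le) fun k => ?_
  have hm : AEMeasurable (fun s => ‖poissonC (r k) f s - f s‖ₑ) arc :=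
    ((aestronglyMeasurable_poissonC hf (hr k)).sub hf.aestronglyMeasurable).enorm
  rw [← lintegral_add_left' hm]
  refine lintegral_mono fun s => ?_
  simp only
  rw [poissonC_add hf hg (hr k), add_sub_add_comm]
  exact enorm_add_le _ _

theorem PoissonConverges.const_mul {r : ℕ → ℝ} {f : UnitAddCircle → ℂ} (c : ℂ)
    (h1 : PoissonConverges r f) : PoissonConverges r (fun t => c * f t) := by
  have := ENNReal.Tendsto.const_mul h1 (Or.inr (enorm_ne_top (x := c)))
  rw [mul_zero] at this
  refine this.congr fun k => ?_
  rw [← lintegral_const_mul' _ _ enorm_ne_top]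
  refine lintegral_congr fun s => ?_
  rw [poissonC_const_mul, ← mul_sub, enorm_mul]

theorem poissonConverges_of_mem_span {r : ℕ → ℝ} (hr : ∀ k, r k ∈ Ico (0 : ℝ) 1)
    (hlim : Tendsto r atTop (𝓝 1)) {f : Lp ℂ 1 arc}
    (hf : f ∈ Submodule.span ℂ (range (fourierLp (T := 1) 1))) : PoissonConverges r f := by
  induction hf using Submodule.span_induction with
  | mem x hx =>
    obtain ⟨n, rfl⟩ := hx
    exact PoissonConverges.congr (tendsto_lintegral_poissonC_fourier n hr hlim)
      (coeFn_fourierLp 1 n).symm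
  | zero =>
    have h0 : PoissonConverges r (fun _ => 0) := by simp [PoissonConverges, poissonC]
    exact h0.congr (Lp.coeFn_zero ℂ 1 arc).symm
  | add x y _ _ hx hy =>
    exact (PoissonConverges.add hr (L1.integrable_coeFn x) (L1.integrable_coeFn y) hx hy).congr
      (Lp.coeFn_add x y).symm
  | smul a x _ hx => exact (hx.const_mul a).congr (Lp.coeFn_smul a x).symm

/-- Poisson integrals of an integrable function converge to it in `L¹`. -/
theorem poissonConverges {r : ℕ → ℝ} (hr : ∀ k, r k ∈ Ico (0 : ℝ) 1)
    (hlim : Tendsto r atTop (𝓝 1)) {f : UnitAddCircle → ℂ} (hf : Integrable f arc) :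
    PoissonConverges r f := by
  rw [PoissonConverges, ENNReal.tendsto_nhds_zero]
  intro ε hε
  have hmem : hf.toL1 f ∈ (Submodule.span ℂ (range (fourierLp (T := 1) 1))).topologicalClosure := by
    rw [span_fourierLp_closure_eq_top (by norm_num)]; trivial
  have hε3 : 0 < ε / 3 := ENNReal.div_pos hε.ne' (by norm_num)
  -- A trigonometric polynomial within `ε/3` in `L¹`: its own Poisson integrals converge, and the
  -- contraction property controls those of `f - g`.
  obtain ⟨g, hg, hfg⟩ := EMetric.mem_closure_iff.1 hmem (ε / 3) hε3
  have hd : ∫⁻ t, ‖f t - g t‖ₑ ∂arc < ε / 3 := by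
    rw [edist_eq_enorm_sub, Lp.enorm_def, eLpNorm_one_eq_lintegral_enorm] at hfg
    refine lt_of_eq_of_lt (lintegral_congr_ae ?_) hfg
    filter_upwards [Lp.coeFn_sub (hf.toL1 f) g, hf.coeFn_toL1] with t h1 h2
    rw [h1, Pi.sub_apply, h2]
  have hgi := L1.integrable_coeFn g
  have hfgi : Integrable (fun t => f t - g t) arc := hf.sub hgi
  filter_upwards [ENNReal.tendsto_nhds_zero.1 (poissonConverges_of_mem_span hr hlim hg) (ε / 3) hε3]
    with k hk
  have hP : ∀ s, poissonC (r k) f s =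
      poissonC (r k) (fun t => f t - g t) s + poissonC (r k) g s := fun s => by
    rw [← poissonC_add hfgi hgi (hr k)]
    simp
  calc ∫⁻ s, ‖poissonC (r k) f s - f s‖ₑ ∂arc
      ≤ ∫⁻ s, (‖poissonC (r k) (fun t => f t - g t) s‖ₑ +
          (‖poissonC (r k) g s - g s‖ₑ + ‖f s - g s‖ₑ)) ∂arc := by
        refine lintegral_mono fun s => ?_
        rw [hP s, show poissonC (r k) (fun t => f t - g t) s + poissonC (r k) g s - f s =
          poissonC (r k) (fun t => f t - g t) s + ((poissonC (r k) g s - g s) - (f s - g s)) by ring]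
        exact (enorm_add_le _ _).trans (by gcongr; exact enorm_sub_le)
    _ = ∫⁻ s, ‖poissonC (r k) (fun t => f t - g t) s‖ₑ ∂arc +
          (∫⁻ s, ‖poissonC (r k) g s - g s‖ₑ ∂arc + ∫⁻ s, ‖f s - g s‖ₑ ∂arc) := by
        rw [lintegral_add_left' (aestronglyMeasurable_poissonC hfgi (hr k)).enorm,
          lintegral_add_right' _ hfgi.aestronglyMeasurable.enorm]
    _ ≤ ε / 3 + (ε / 3 + ε / 3) := by
        gcongr
        exact (lintegral_poissonC_le hfgi (hr k)).trans hd.le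
    _ = ε := by rw [← add_assoc, ENNReal.add_thirds]

/-! ### Outer functions -/

/-- The outer function with boundary modulus `exp u`. -/
def outerFn (u : UnitAddCircle → ℝ) (z : ℂ) : ℂ := Complex.exp (herglotz u z)

theorem norm_outerFn (u : UnitAddCircle → ℝ) (z : ℂ) :
    ‖outerFn u z‖ = Real.exp (herglotz u z).re := Complex.norm_exp _

theorem outerFn_ne_zero (u : UnitAddCircle → ℝ) (z : ℂ) : outerFn u z ≠ 0 := Complex.exp_ne_zero _

theorem differentiableOn_outerFn {u : UnitAddCircle → ℝ} (hu : Integrable u arc) :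
    DifferentiableOn ℂ (outerFn u) disc := (differentiableOn_herglotz hu).cexp

theorem outerFn_add {u v : UnitAddCircle → ℝ} (hu : Integrable u arc) (hv : Integrable v arc)
    {z : ℂ} (hz : z ∈ disc) : outerFn (fun t => u t + v t) z = outerFn u z * outerFn v z := by
  rw [outerFn, herglotz_add hu hv hz, Complex.exp_add]; rfl

theorem outerFn_neg (u : UnitAddCircle → ℝ) (z : ℂ) :
    outerFn (fun t => -u t) z = (outerFn u z)⁻¹ := by
  rw [outerFn, herglotz_neg, Complex.exp_neg]; rfl

theorem outerFn_zero (u : UnitAddCircle → ℝ) :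
    outerFn u 0 = (Real.exp (∫ t, u t ∂arc) : ℂ) := by
  rw [outerFn, herglotz_zero_right, Complex.ofReal_exp]

theorem norm_outerFn_le {u : UnitAddCircle → ℝ} (hu : Integrable u arc) {C : ℝ}
    (h : ∀ᵐ t ∂arc, u t ≤ C) {z : ℂ} (hz : z ∈ disc) : ‖outerFn u z‖ ≤ Real.exp C := by
  rw [norm_outerFn]
  exact Real.exp_le_exp.2 (herglotz_re_le hu h hz)

theorem isOuter_iff {f : ℂ → ℂ} : IsOuter f ↔ ∃ (c : ℂ) (u : UnitAddCircle → ℝ), ‖c‖ = 1 ∧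
    Integrable u arc ∧ ∀ z ∈ disc, f z = c * outerFn u z := Iff.rfl

/-- The boundary modulus of an outer function in `H²`. -/
theorem norm_boundary_of_outer {h : hardyTwo} {c : ℂ} (hc : ‖c‖ = 1) {u : UnitAddCircle → ℝ}
    (hu : Integrable u arc) (hh : ∀ z ∈ disc, hext h z = c * outerFn u z) :
    ∀ᵐ t ∂arc, ‖(h : LTwo) t‖ = Real.exp (u t) := by
  have h1 := poissonConverges radius_mem tendsto_radius (f := fun t => (u t : ℂ)) hu.ofReal
  have h2 : TendstoInMeasure arc (fun k => poissonC (radius k) (fun t => (u t : ℂ))) atTop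
      (fun t => (u t : ℂ)) := by
    refine tendstoInMeasure_of_tendsto_eLpNorm (p := 1) one_ne_zero
      (fun k => aestronglyMeasurable_poissonC hu.ofReal (radius_mem k))
      hu.ofReal.aestronglyMeasurable ?_
    simp only [eLpNorm_one_eq_lintegral_enorm]
    exact h1
  obtain ⟨ns, hns, hae⟩ := h2.exists_seq_tendsto_ae
  -- The second subsequence is taken inside the first, so that `log |h|` and `h` converge almost
  -- everywhere along the same radii.
  obtain ⟨ms, hms, hae2⟩ := exists_subseq_tendsto_hext h (fun k => radius_mem (ns k))
    (tendsto_radius.comp hns.tendsto_atTop)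
  filter_upwards [hae, hae2] with t ht1 ht2
  have h3 := ht2.norm
  have h4 := (Complex.continuous_re.tendsto _).comp (ht1.comp hms.tendsto_atTop)
  have h5 := (Real.continuous_exp.tendsto _).comp h4
  refine tendsto_nhds_unique (h3.congr fun k => ?_) h5
  have hm := radius_mem (ns (ms k))
  simp only [Function.comp]
  rw [hh _ (mul_toCircle_mem_disc hm t), norm_mul, hc, one_mul, norm_outerFn,
    poissonC_ofReal hu hm, Complex.ofReal_re]

theorem norm_boundary_of_outer_symbol {b : LInf} (hb : AnalyticSymbol b) {c : ℂ} (hc : ‖c‖ = 1)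
    {u : UnitAddCircle → ℝ} (hu : Integrable u arc)
    (hh : ∀ z ∈ disc, ext b z = c * outerFn u z) :
    ∀ᵐ t ∂arc, ‖b t‖ = Real.exp (u t) := by
  have h := norm_boundary_of_outer (h := hb.toHardy) hc hu (by rwa [hb.hext_toHardy])
  filter_upwards [h, coeFn_toTwo b] with t h1 h2
  rw [← h1, ← h2]; rfl

/-- Bounded outer functions as bounded symbols. -/
theorem exists_outer_symbol {u : UnitAddCircle → ℝ} (hu : Integrable u arc) {C : ℝ}
    (h : ∀ᵐ t ∂arc, u t ≤ C) :
    ∃ b : LInf, AnalyticSymbol b ∧ EqOn (ext b) (outerFn u) disc ∧ ‖b‖ ≤ Real.exp C ∧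
      ∀ᵐ t ∂arc, ‖b t‖ = Real.exp (u t) := by
  obtain ⟨b, hb, hbe, hbn⟩ := exists_boundary (differentiableOn_outerFn hu) (Real.exp_pos C).le
    fun z hz => norm_outerFn_le hu h hz
  exact ⟨b, hb, hbe, hbn, norm_boundary_of_outer_symbol hb (c := 1) norm_one hu
    fun z hz => by rw [hbe hz, one_mul]⟩

theorem LInf_norm_le {b : LInf} {C : ℝ} (hC : 0 ≤ C) (h : ∀ᵐ t ∂arc, ‖b t‖ ≤ C) : ‖b‖ ≤ C := by
  obtain ⟨d, hd, hn⟩ := exists_LInf (Lp.aestronglyMeasurable b) hC h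
  rwa [Lp.ext hd] at hn

/-- A vector of the unit ball whose value at the origin is close to 1 is itself close to the
constant 1. -/
theorem norm_sub_mono_zero_sq (x : hardyTwo) :
    ‖x - mono 0‖ ^ 2 = ‖x‖ ^ 2 + 1 - 2 * (hext x 0).re := by
  have h := norm_sub_sq (𝕜 := ℂ) (E := hardyTwo) x (mono 0)
  rw [h, norm_mono, hext_zero_eq, ← inner_conj_symm (𝕜 := ℂ) x (mono 0)]
  simp only [RCLike.re_to_complex, Complex.conj_re]
  ring

/-- Cutting `-u` off at height `n` replaces the possibly unbounded reciprocal of an outer function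
by bounded approximate inverses. -/
theorem integrable_min_neg {u : UnitAddCircle → ℝ} (hu : Integrable u arc) (n : ℕ) :
    Integrable (fun t => min (-u t) (n : ℝ)) arc := by
  refine hu.norm.mono' (hu.aestronglyMeasurable.neg.inf aestronglyMeasurable_const)
    (Eventually.of_forall fun t => ?_)
  have hn : (0 : ℝ) ≤ n := Nat.cast_nonneg n
  rw [Real.norm_eq_abs, Real.norm_eq_abs, abs_le]
  constructor
  · exact le_min (by linarith [le_abs_self (u t)]) (by linarith [abs_nonneg (u t)])
  · exact (min_le_left _ _).trans (neg_le_abs _)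

/-- Outer functions are cyclic. -/
theorem exists_mulOp_near_one {a : LInf} (ha : AnalyticSymbol a) (ho : IsOuter (ext a)) {ε : ℝ}
    (hε : 0 < ε) : ∃ p : LInf, AnalyticSymbol p ∧ ‖mulOp p (toTwo a) - fourierLp 2 0‖ < ε := by
  obtain ⟨c, u, hc, hu, hau⟩ := isOuter_iff.1 ho
  have hcc : conj c * c = 1 := by
    rw [← Complex.normSq_eq_conj_mul_self, Complex.normSq_eq_norm_sq, hc]; simp
  -- The integrand is the log-modulus of the product with the approximate inverse. It vanishes once
  -- `n ≥ -u t`, and `2 |u|` dominates it.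
  have hlim : Tendsto (fun n : ℕ => ∫ t, (u t + min (-u t) (n : ℝ)) ∂arc) atTop
      (𝓝 (∫ _, (0 : ℝ) ∂arc)) := by
    refine tendsto_integral_of_dominated_convergence (fun t => 2 * |u t|)
      (fun n => (hu.add (integrable_min_neg hu n)).aestronglyMeasurable)
      (hu.abs.const_mul 2) (fun n => Eventually.of_forall fun t => ?_)
      (Eventually.of_forall fun t => ?_)
    · have hn : (0 : ℝ) ≤ n := Nat.cast_nonneg n
      rw [Real.norm_eq_abs, abs_le]
      constructor
      · have : -|u t| ≤ min (-u t) (n : ℝ) :=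
          le_min (by linarith [le_abs_self (u t)]) (by linarith [abs_nonneg (u t)])
        linarith [neg_abs_le (u t)]
      · linarith [min_le_left (-u t) (n : ℝ), abs_nonneg (u t)]
    · refine tendsto_const_nhds.congr' ?_
      obtain ⟨N, hN⟩ := exists_nat_ge (-u t)
      filter_upwards [eventually_ge_atTop N] with n hn
      rw [min_eq_left (hN.trans (by exact_mod_cast hn))]
      ring
  rw [integral_zero] at hlim
  have hlim2 : Tendsto (fun n : ℕ => 2 - 2 * Real.exp (∫ t, (u t + min (-u t) (n : ℝ)) ∂arc)) atTop
      (𝓝 0) := by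
    have := (((Real.continuous_exp.tendsto 0).comp hlim).const_mul 2).const_sub 2
    simpa using this
  obtain ⟨n, hn⟩ := ((tendsto_order.1 hlim2).2 (ε ^ 2) (by positivity)).exists
  set v : UnitAddCircle → ℝ := fun t => min (-u t) (n : ℝ) with hv
  have hvi : Integrable v arc := integrable_min_neg hu n
  -- The factor `conj c` cancels the unimodular constant of `a`, so that the value at the origin of
  -- `p a` is positive and tends to 1.
  obtain ⟨p, hp, hpe, -⟩ := exists_boundary (F := fun z => conj c * outerFn v z)
    ((differentiableOn_const _).mul (differentiableOn_outerFn hvi)) (Real.exp_pos n).le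
    fun z hz => by
      rw [norm_mul, RCLike.norm_conj, hc, one_mul]
      exact norm_outerFn_le hvi (Eventually.of_forall fun t => min_le_right _ _) hz
  obtain ⟨d, hd⟩ := exists_mul p a
  have hda := hp.of_mul ha hd
  have hde : EqOn (ext d) (outerFn fun t => u t + v t) disc := fun z hz => by
    rw [ext_of_mul hp ha hd hz, hpe hz, hau z hz, outerFn_add hu hvi hz]
    linear_combination (outerFn u z * outerFn v z) * hcc
  -- The product is rebuilt as an outer function with nonpositive log-modulus in order to read off
  -- that its norm is at most 1.
  obtain ⟨d', hd'a, hd'e, hd'n, -⟩ := exists_outer_symbol (hu.add hvi) (C := 0)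
    (Eventually.of_forall fun t => by
      have := min_le_left (-u t) (n : ℝ)
      simp only [Pi.add_apply, hv]; linarith)
  have hdd : d = d' := hda.eq_of_ext hd'a fun z hz => by rw [hde hz, hd'e hz]; rfl
  refine ⟨p, hp, ?_⟩
  rw [← toTwo_of_mul hd]
  have h1 := norm_sub_mono_zero_sq hda.toHardy
  have h2 : ‖hda.toHardy‖ ≤ 1 := (norm_toTwo_le d).trans (by simpa [hdd] using hd'n)
  rw [hda.hext_toHardy, hde zero_mem_disc, outerFn_zero, Complex.ofReal_re] at h1
  have h3 : ‖hda.toHardy‖ ^ 2 ≤ 1 := pow_le_one₀ (norm_nonneg _) h2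
  have h4 : ‖hda.toHardy - mono 0‖ < ε := lt_of_pow_lt_pow_left₀ 2 hε.le (by rw [h1]; linarith)
  exact h4

/-! ### Integrability of logarithms: the arguments of Jensen and Szegő. -/

/-- Integrability of `log ρ` from lower bounds for the integrals of `log (ρ + ε)`. -/
theorem integrable_log_of_forall_le {ρ : UnitAddCircle → ℝ} (hm : Measurable ρ)
    (h0 : ∀ᵐ t ∂arc, 0 ≤ ρ t) (h1 : ∀ᵐ t ∂arc, ρ t ≤ 1) {C : ℝ}
    (hC : ∀ n : ℕ, C ≤ ∫ t, Real.log (ρ t + 1 / ((n : ℝ) + 1)) ∂arc) :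
    (∀ᵐ t ∂arc, 0 < ρ t) ∧ Integrable (fun t => Real.log (ρ t)) arc := by
  have hmn : ∀ n : ℕ, Measurable fun t => Real.log (ρ t + 1 / ((n : ℝ) + 1)) :=
    fun n => Real.measurable_log.comp (hm.add_const _)
  have hpos : ∀ n : ℕ, (0 : ℝ) < 1 / ((n : ℝ) + 1) := fun n => by positivity
  have hle1 : ∀ n : ℕ, (1 : ℝ) / ((n : ℝ) + 1) ≤ 1 := fun n => by
    rw [div_le_one (by positivity)]; linarith [(Nat.cast_nonneg n : (0 : ℝ) ≤ n)]
  have hup : ∀ n : ℕ, ∀ᵐ t ∂arc, Real.log (ρ t + 1 / ((n : ℝ) + 1)) ≤ Real.log 2 := fun n => by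
    filter_upwards [h0, h1] with t ht0 ht1
    exact Real.log_le_log (by linarith [hpos n]) (by linarith [hle1 n])
  have hint : ∀ n : ℕ, Integrable (fun t => Real.log (ρ t + 1 / ((n : ℝ) + 1))) arc := fun n => by
    refine (integrable_const (max (Real.log 2) (-Real.log (1 / ((n : ℝ) + 1))))).mono'
      (hmn n).aestronglyMeasurable ?_
    filter_upwards [h0, hup n] with t ht0 ht2
    rw [Real.norm_eq_abs, abs_le]
    constructor
    · have : Real.log (1 / ((n : ℝ) + 1)) ≤ Real.log (ρ t + 1 / ((n : ℝ) + 1)) :=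
        Real.log_le_log (hpos n) (by linarith)
      linarith [le_max_right (Real.log 2) (-Real.log (1 / ((n : ℝ) + 1)))]
    · exact ht2.trans (le_max_left _ _)
  have hbound : ∀ n : ℕ, ∫⁻ t, ENNReal.ofReal (Real.log 2 - Real.log (ρ t + 1 / ((n : ℝ) + 1))) ∂arc
      ≤ ENNReal.ofReal (Real.log 2 - C) := fun n => by
    have hi : Integrable (fun t => Real.log 2 - Real.log (ρ t + 1 / ((n : ℝ) + 1))) arc :=
      (integrable_const _).sub (hint n)
    rw [← ofReal_integral_eq_lintegral_ofReal hi (by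
      filter_upwards [hup n] with t ht
      simpa using ht)]
    refine ENNReal.ofReal_le_ofReal ?_
    rw [integral_sub (integrable_const _) (hint n), integral_const, probReal_univ, one_smul]
    exact sub_le_sub_left (hC n) _
  have hmeas : ∀ n : ℕ, Measurable fun t =>
      ENNReal.ofReal (Real.log 2 - Real.log (ρ t + 1 / ((n : ℝ) + 1))) :=
    fun n => ((hmn n).const_sub _).ennreal_ofReal
  -- Since `ρ + 1/(n+1) ≤ 2`, the functions `log 2 - log(ρ + 1/(n+1))` are nonnegative almost
  -- everywhere with bounded integrals, so Fatou's lemma applies.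
  have hliminf := liminf_le_liminf (f := atTop) (Eventually.of_forall hbound)
  rw [liminf_const] at hliminf
  have hfatou := (lintegral_liminf_le (μ := arc) hmeas).trans hliminf
  have hfin := ae_lt_top (Measurable.liminf hmeas)
    (ne_top_of_le_ne_top ENNReal.ofReal_ne_top hfatou)
  have hinv : Tendsto (fun n : ℕ => (1 : ℝ) / ((n : ℝ) + 1)) atTop (𝓝 0) :=
    tendsto_one_div_add_atTop_nhds_zero_nat
  have hρ : ∀ᵐ t ∂arc, 0 < ρ t := by
    filter_upwards [h0, hfin] with t ht0 ht
    rcases ht0.lt_or_eq with h | h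
    · exact h
    exfalso
    -- At a zero of `ρ` the integrands tend to infinity, against the almost everywhere finiteness of
    -- their lower limit.
    have h2 : Tendsto (fun n : ℕ => Real.log (ρ t + 1 / ((n : ℝ) + 1))) atTop atBot := by
      rw [← h]
      simp only [zero_add]
      exact Real.tendsto_log_nhdsGT_zero.comp
        (tendsto_nhdsWithin_iff.2 ⟨hinv, Eventually.of_forall fun n => hpos n⟩)
    have h3 := ENNReal.tendsto_ofReal_atTop.comp
      (tendsto_atTop_add_const_left _ (Real.log 2) (tendsto_neg_atBot_atTop.comp h2))
    have h4 := h3.liminf_eq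
    simp only [Function.comp_def, ← sub_eq_add_neg] at h4
    exact ht.ne h4
  refine ⟨hρ, ?_⟩
  have hlim : ∀ᵐ t ∂arc, liminf (fun n : ℕ => ENNReal.ofReal (Real.log 2 -
      Real.log (ρ t + 1 / ((n : ℝ) + 1)))) atTop = ENNReal.ofReal (Real.log 2 - Real.log (ρ t)) := by
    filter_upwards [hρ] with t ht
    refine Tendsto.liminf_eq (ENNReal.tendsto_ofReal (Tendsto.const_sub _ ?_))
    have := (hinv.const_add (ρ t))
    rw [add_zero] at this
    exact (Real.continuousAt_log ht.ne').tendsto.comp this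
  rw [lintegral_congr_ae hlim] at hfatou
  have hi : Integrable (fun t => Real.log 2 - Real.log (ρ t)) arc := by
    refine ⟨((Real.measurable_log.comp hm).const_sub _).aestronglyMeasurable, ?_⟩
    rw [hasFiniteIntegral_iff_ofReal]
    · exact lt_of_le_of_lt hfatou ENNReal.ofReal_lt_top
    · filter_upwards [hρ, h1] with t ht ht1
      have : Real.log (ρ t) ≤ Real.log 2 := Real.log_le_log ht (by linarith)
      simpa using this
  refine ((integrable_const (Real.log 2)).sub hi).congr (Eventually.of_forall fun t => ?_)
  simp

theorem exp_half_log {x : ℝ} (hx : 0 < x) : Real.exp (Real.log x / 2) ^ 2 = x := by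
  rw [← Real.exp_nat_mul]
  push_cast
  rw [mul_div_cancel₀ _ two_ne_zero, Real.exp_log hx]

theorem exp_neg_half_log {x : ℝ} (hx : 0 < x) : Real.exp (-(Real.log x / 2)) ^ 2 = x⁻¹ := by
  rw [Real.exp_neg, inv_pow, exp_half_log hx]

/-- Logarithms of functions with values in `[ε, 1 + ε]` are integrable. -/
theorem integrable_log_add {ρ : UnitAddCircle → ℝ} (hm : AEMeasurable ρ arc)
    (h0 : ∀ᵐ t ∂arc, 0 ≤ ρ t) (h1 : ∀ᵐ t ∂arc, ρ t ≤ 1) {ε : ℝ} (hε : 0 < ε) :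
    Integrable (fun t => Real.log (ρ t + ε)) arc := by
  refine (integrable_const (max (Real.log (1 + ε)) (-Real.log ε))).mono'
    (Real.measurable_log.comp_aemeasurable (hm.add_const _)).aestronglyMeasurable ?_
  filter_upwards [h0, h1] with t ht0 ht1
  rw [Real.norm_eq_abs, abs_le]
  constructor
  · have : Real.log ε ≤ Real.log (ρ t + ε) := Real.log_le_log hε (by linarith)
    linarith [le_max_right (Real.log (1 + ε)) (-Real.log ε)]
  · exact (Real.log_le_log (by linarith) (by linarith)).trans (le_max_left _ _)

/-- The outer function with boundary modulus `(ρ + ε)^{-1/2}`. -/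
theorem exists_outer_inv_sqrt {ρ : UnitAddCircle → ℝ} (hm : AEMeasurable ρ arc)
    (h0 : ∀ᵐ t ∂arc, 0 ≤ ρ t) (h1 : ∀ᵐ t ∂arc, ρ t ≤ 1) {ε : ℝ} (hε : 0 < ε) :
    ∃ p : LInf, AnalyticSymbol p ∧
      (∀ z ∈ disc, ext p z = outerFn (fun t => -(Real.log (ρ t + ε) / 2)) z) ∧
      ∀ᵐ t ∂arc, ‖p t‖ ^ 2 = (ρ t + ε)⁻¹ := by
  have hi := ((integrable_log_add hm h0 h1 hε).div_const 2).neg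
  obtain ⟨p, hp, hpe, -, hpn⟩ := exists_outer_symbol hi (C := -(Real.log ε / 2)) (by
    filter_upwards [h0] with t ht0
    have : Real.log ε ≤ Real.log (ρ t + ε) := Real.log_le_log hε (by linarith)
    simp only [Pi.neg_apply]
    linarith)
  refine ⟨p, hp, hpe, ?_⟩
  filter_upwards [hpn, h0] with t ht ht0
  rw [ht]
  exact exp_neg_half_log (by linarith)

/-- A bounded analytic function with nonzero value at the origin has integrable `log |b|`, and is
dominated by the outer function with the same boundary modulus. -/
theorem integrable_log_norm {b : LInf} (hb : AnalyticSymbol b) (hb1 : ‖b‖ ≤ 1)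
    (hb0 : ext b 0 ≠ 0) :
    (∀ᵐ t ∂arc, 0 < ‖b t‖) ∧ Integrable (fun t => Real.log ‖b t‖) arc ∧
      ∀ z ∈ disc, ‖ext b z‖ ≤ ‖outerFn (fun t => Real.log ‖b t‖) z‖ := by
  set ρ : UnitAddCircle → ℝ := fun t => ‖b t‖ ^ 2 with hρ
  have hm' : Measurable ρ := (Lp.stronglyMeasurable b).measurable.norm.pow_const 2
  have hm : AEMeasurable ρ arc := hm'.aemeasurable
  have h0 : ∀ᵐ t ∂arc, 0 ≤ ρ t := Eventually.of_forall fun t => by positivity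
  have h1 : ∀ᵐ t ∂arc, ρ t ≤ 1 := by
    filter_upwards [ae_norm_le b] with t ht
    exact pow_le_one₀ (norm_nonneg _) (ht.trans hb1)
  have hpos : ∀ n : ℕ, (0 : ℝ) < 1 / ((n : ℝ) + 1) := fun n => by positivity
  have hle1 : ∀ n : ℕ, (1 : ℝ) / ((n : ℝ) + 1) ≤ 1 := fun n => by
    rw [div_le_one (by positivity)]; linarith [(Nat.cast_nonneg n : (0 : ℝ) ≤ n)]
  have hw : ∀ n : ℕ, Integrable (fun t => Real.log (ρ t + 1 / ((n : ℝ) + 1)) / 2) arc :=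
    fun n => (integrable_log_add hm h0 h1 (hpos n)).div_const 2
  have key : ∀ n : ℕ, ∀ z ∈ disc, ‖ext b z‖ ≤
      Real.exp (herglotz (fun t => Real.log (ρ t + 1 / ((n : ℝ) + 1)) / 2) z).re := by
    intro n z hz
    -- Multiplying `b` by the outer function of modulus `(|b|² + ε)^{-1/2}` gives a boundary modulus
    -- at most 1, hence modulus at most 1 in the disc.
    obtain ⟨p, hp, hpe, hpn⟩ := exists_outer_inv_sqrt hm h0 h1 (hpos n)
    obtain ⟨d, hd⟩ := exists_mul p b
    have hdn : ‖d‖ ≤ 1 := LInf_norm_le zero_le_one (by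
      filter_upwards [hd, hpn] with t ht1 ht2
      refine (sq_le_one_iff₀ (norm_nonneg _)).1 ?_
      have : 0 ≤ ρ t := by positivity
      rw [ht1, norm_mul, mul_pow, ht2, inv_mul_le_one₀ (by linarith [hpos n])]
      linarith [hpos n])
    have h2 := (norm_ext_le (hp.of_mul hb hd) hz).trans hdn
    rw [ext_of_mul hp hb hd hz, hpe z hz, outerFn_neg, norm_mul, norm_inv, norm_outerFn,
      inv_mul_le_one₀ (Real.exp_pos _)] at h2
    exact h2
  -- Jensen's inequality: the previous bound at the origin, where the Herglotz integral is the mean.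
  have hC : ∀ n : ℕ, 2 * Real.log ‖ext b 0‖ ≤ ∫ t, Real.log (ρ t + 1 / ((n : ℝ) + 1)) ∂arc := by
    intro n
    have h2 := Real.log_le_log (norm_pos_iff.2 hb0) (key n 0 zero_mem_disc)
    rw [Real.log_exp, herglotz_zero_right, Complex.ofReal_re, integral_div] at h2
    linarith
  obtain ⟨hρ0, hρi⟩ := integrable_log_of_forall_le hm' h0 h1 hC
  have hlog : ∀ t, Real.log (ρ t) = 2 * Real.log ‖b t‖ := fun t => by
    simp [hρ, Real.log_pow]
  have hb0' : ∀ᵐ t ∂arc, 0 < ‖b t‖ := by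
    filter_upwards [hρ0] with t ht
    exact norm_pos_iff.2 fun h => by simp [hρ, h] at ht
  have hi : Integrable (fun t => Real.log ‖b t‖) arc := by
    refine (hρi.div_const 2).congr (Eventually.of_forall fun t => ?_)
    simp only [hlog]; ring
  refine ⟨hb0', hi, fun z hz => ?_⟩
  rw [norm_outerFn]
  have hlim : Tendsto (fun n : ℕ =>
      (herglotz (fun t => Real.log (ρ t + 1 / ((n : ℝ) + 1)) / 2) z).re) atTop
      (𝓝 (herglotz (fun t => Real.log ‖b t‖) z).re) := by
    rw [herglotz_re hi hz]
    simp only [herglotz_re (hw _) hz]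
    refine tendsto_integral_of_dominated_convergence
      (fun t => poissonKer t z * (Real.log 2 + |Real.log ‖b t‖|))
      (fun n => (integrable_poissonKer_mul (hw n) hz).aestronglyMeasurable)
      (integrable_poissonKer_mul ((integrable_const _).add hi.abs) hz) (fun n => ?_) ?_
    · filter_upwards [hρ0, h1] with t ht0 ht1
      rw [norm_mul, Real.norm_of_nonneg (poissonKer_nonneg t hz)]
      refine mul_le_mul_of_nonneg_left ?_ (poissonKer_nonneg t hz)
      have h2 : Real.log (ρ t) ≤ Real.log (ρ t + 1 / ((n : ℝ) + 1)) :=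
        Real.log_le_log ht0 (by linarith [hpos n])
      have h3 : Real.log (ρ t + 1 / ((n : ℝ) + 1)) ≤ Real.log 2 :=
        Real.log_le_log (by linarith [hpos n]) (by linarith [hle1 n])
      rw [hlog] at h2
      have h4 : 0 < Real.log 2 := Real.log_pos (by norm_num)
      rw [Real.norm_eq_abs, abs_le]
      constructor
      · linarith [neg_abs_le (Real.log ‖b t‖)]
      · linarith [abs_nonneg (Real.log ‖b t‖)]
    · filter_upwards [hρ0] with t ht0
      refine Tendsto.const_mul _ ?_
      have h2 : Tendsto (fun n : ℕ => ρ t + 1 / ((n : ℝ) + 1)) atTop (𝓝 (ρ t)) := by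
        have := (tendsto_one_div_add_atTop_nhds_zero_nat (𝕜 := ℝ)).const_add (ρ t)
        rwa [add_zero] at this
      have h3 := ((Real.continuousAt_log ht0.ne').tendsto.comp h2).div_const 2
      rw [hlog, mul_div_cancel_left₀ _ two_ne_zero] at h3
      exact h3
  exact ge_of_tendsto' ((Real.continuous_exp.tendsto _).comp hlim) fun n => key n z hz

theorem LTwo_norm_sq (f : LTwo) : ‖f‖ ^ 2 = ∫ t, ‖f t‖ ^ 2 ∂arc := by
  have h := inner_self_eq_norm_sq (𝕜 := ℂ) f
  rw [← h, inner_LTwo, ← RCLike.ofReal_re (K := ℂ) (∫ t, ‖f t‖ ^ 2 ∂arc), ← integral_ofReal]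
  congr 1
  refine integral_congr_ae (Eventually.of_forall fun t => ?_)
  simp only
  rw [mul_comm, Complex.mul_conj, Complex.normSq_eq_norm_sq]
  rfl

theorem integrable_norm_sq (f : LTwo) : Integrable (fun t => ‖f t‖ ^ 2) arc :=
  (Lp.memLp f).integrable_norm_pow two_ne_zero

/-- A lower bound of Szegő type forces `log (1 - |b|²)` to be integrable. -/
theorem integrable_log_of_szego {b : LInf} (hb : AnalyticSymbol b) (hb1 : ‖b‖ ≤ 1) {κ : ℝ}
    (hκ : 0 < κ) (h : ∀ f : hardyTwo, κ * ‖hext f 0‖ ^ 2 ≤ ‖f‖ ^ 2 - ‖toeplitz b f‖ ^ 2) :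
    (∀ᵐ t ∂arc, 0 < 1 - ‖b t‖ ^ 2) ∧ Integrable (fun t => Real.log (1 - ‖b t‖ ^ 2)) arc := by
  set ρ : UnitAddCircle → ℝ := fun t => 1 - ‖b t‖ ^ 2 with hρ
  have hm : Measurable ρ := ((Lp.stronglyMeasurable b).measurable.norm.pow_const 2).const_sub 1
  have h0 : ∀ᵐ t ∂arc, 0 ≤ ρ t := by
    filter_upwards [ae_norm_le b] with t ht
    have : ‖b t‖ ^ 2 ≤ 1 := pow_le_one₀ (norm_nonneg _) (ht.trans hb1)
    simp only [hρ]; linarith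
  have h1 : ∀ᵐ t ∂arc, ρ t ≤ 1 := Eventually.of_forall fun t => by
    have : 0 ≤ ‖b t‖ ^ 2 := by positivity
    simp only [hρ]; linarith
  refine integrable_log_of_forall_le hm h0 h1 (C := Real.log κ) fun n => ?_
  have hpos : (0 : ℝ) < 1 / ((n : ℝ) + 1) := by positivity
  -- Szegő's test function: `|p|² ρ = ρ/(ρ + ε) ≤ 1` bounds the right side by 1, while `|p(0)|² =
  -- exp(-∫ log(ρ + ε))`.
  obtain ⟨p, hp, hpe, hpn⟩ := exists_outer_inv_sqrt hm.aemeasurable h0 h1 hpos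
  have h2 := h hp.toHardy
  have h3 : ‖hp.toHardy‖ ^ 2 - ‖toeplitz b hp.toHardy‖ ^ 2 ≤ 1 := by
    have e1 : ‖hp.toHardy‖ ^ 2 = ∫ t, ‖toTwo p t‖ ^ 2 ∂arc := LTwo_norm_sq (toTwo p)
    have e2 : ‖toeplitz b hp.toHardy‖ ^ 2 = ∫ t, ‖mulOp b (toTwo p) t‖ ^ 2 ∂arc := by
      rw [← LTwo_norm_sq]
      exact congrArg (fun x : LTwo => ‖x‖ ^ 2) (hb.toeplitz_coe hp.toHardy)
    rw [e1, e2, ← integral_sub (integrable_norm_sq _) (integrable_norm_sq _)]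
    calc _ ≤ ∫ _ : UnitAddCircle, (1 : ℝ) ∂arc := by
          refine integral_mono_ae ((integrable_norm_sq _).sub (integrable_norm_sq _))
            (integrable_const 1) ?_
          filter_upwards [coeFn_toTwo p, coeFn_mulOp b (toTwo p), hpn, h0] with t ht1 ht2 ht3 ht4
          rw [ht2, ht1, norm_mul, mul_pow, ht3]
          have h5 : (0 : ℝ) < ρ t + 1 / ((n : ℝ) + 1) := by linarith
          have h6 : ‖b t‖ ^ 2 = 1 - ρ t := by simp [hρ]
          rw [h6, ← one_sub_mul, sub_sub_cancel, ← div_eq_mul_inv, div_le_one h5]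
          linarith
      _ = 1 := by simp
  have h4 := h2.trans h3
  rw [hp.hext_toHardy, hpe 0 zero_mem_disc, norm_outerFn, herglotz_zero_right, Complex.ofReal_re,
    integral_neg, integral_div, ← Real.exp_nat_mul] at h4
  have h5 := Real.log_le_log (by positivity) h4
  rw [Real.log_mul hκ.ne' (Real.exp_pos _).ne', Real.log_exp, Real.log_one] at h5
  push_cast at h5
  linarith

/-! ### Outer companions of `b`, and inner-outer factorization. -/

theorem exists_isPair {b : LInf} (hpos : ∀ᵐ t ∂arc, 0 < 1 - ‖b t‖ ^ 2)
    (hi : Integrable (fun t => Real.log (1 - ‖b t‖ ^ 2)) arc) : ∃ a : LInf, IsPair b a := by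
  have hu := hi.div_const 2
  obtain ⟨a, ha, hae, -, han⟩ := exists_outer_symbol hu (C := 0) (by
    filter_upwards [hpos] with t ht
    have : Real.log (1 - ‖b t‖ ^ 2) ≤ 0 := Real.log_nonpos ht.le (by
      have : 0 ≤ ‖b t‖ ^ 2 := by positivity
      linarith)
    linarith)
  refine ⟨a, ha, isOuter_iff.2 ⟨1, _, norm_one, hu, fun z hz => by rw [hae hz, one_mul]⟩, ?_, ?_⟩
  · exact ⟨_, Real.exp_pos _, by rw [hae zero_mem_disc, outerFn_zero]⟩
  · filter_upwards [han, hpos] with t h1 h2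
    rw [h1, exp_half_log h2]
    ring

/-- The relation `|a|² + |b|² = 1` fixes the boundary modulus, hence the outer function up to a
unimodular constant, and positivity at the origin makes that constant 1. -/
theorem IsPair.unique {b a a' : LInf} (h : IsPair b a) (h' : IsPair b a') : a = a' := by
  obtain ⟨c, u, hc, hu, he⟩ := isOuter_iff.1 h.outer
  obtain ⟨c', u', hc', hu', he'⟩ := isOuter_iff.1 h'.outer
  have huu : u =ᵐ[arc] u' := by
    filter_upwards [norm_boundary_of_outer_symbol h.analytic hc hu he,
      norm_boundary_of_outer_symbol h'.analytic hc' hu' he', h.sq_add_sq, h'.sq_add_sq]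
      with t h1 h2 h3 h4
    have h5 : ‖a t‖ ^ 2 = ‖a' t‖ ^ 2 := by linarith
    rw [sq_eq_sq₀ (norm_nonneg _) (norm_nonneg _), h1, h2] at h5
    exact Real.exp_injective h5
  have hone : ∀ {c : ℂ} {u : UnitAddCircle → ℝ} {a : LInf}, ‖c‖ = 1 →
      (∀ z ∈ disc, ext a z = c * outerFn u z) → (∃ r : ℝ, 0 < r ∧ ext a 0 = (r : ℂ)) → c = 1 := by
    intro c u a hc he ⟨r, hr, h0⟩
    rw [he 0 zero_mem_disc, outerFn_zero] at h0
    have h1 := congrArg norm h0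
    rw [norm_mul, hc, one_mul, Complex.norm_real, Complex.norm_real,
      Real.norm_of_nonneg (Real.exp_pos _).le, Real.norm_of_nonneg hr.le] at h1
    rw [h1] at h0
    exact mul_right_cancel₀ (Complex.ofReal_ne_zero.2 hr.ne') (h0.trans (one_mul _).symm)
  refine AnalyticSymbol.eq_of_ext h.analytic h'.analytic fun z hz => ?_
  rw [he z hz, he' z hz, hone hc he h.pos, hone hc' he' h'.pos, outerFn, outerFn,
    herglotz_congr huu]

theorem IsPair.ext_ne_zero {b a : LInf} (h : IsPair b a) {z : ℂ} (hz : z ∈ disc) :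
    ext a z ≠ 0 := by
  obtain ⟨c, u, hc, hu, he⟩ := isOuter_iff.1 h.outer
  rw [he z hz]
  refine mul_ne_zero (fun h0 => ?_) (outerFn_ne_zero _ _)
  rw [h0, norm_zero] at hc
  exact zero_ne_one hc

/-- Inner-outer factorization of a bounded function not vanishing at the origin. -/
theorem exists_inner_outer {b : LInf} (hb : AnalyticSymbol b) (hb1 : ‖b‖ ≤ 1)
    (hb0 : ext b 0 ≠ 0) : ∃ (i f : LInf) (u : UnitAddCircle → ℝ), AnalyticSymbol i ∧
      AnalyticSymbol f ∧ Integrable u arc ∧ (∀ z ∈ disc, ext f z = outerFn u z) ∧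
      (∀ᵐ t ∂arc, ‖i t‖ = 1) ∧ b =ᵐ[arc] fun t => i t * f t := by
  obtain ⟨hpos, hu, hle⟩ := integrable_log_norm hb hb1 hb0
  set u : UnitAddCircle → ℝ := fun t => Real.log ‖b t‖ with hudef
  obtain ⟨f, hf, hfe, -, hfn⟩ := exists_outer_symbol hu (C := 0) (by
    filter_upwards [hpos, ae_norm_le b] with t h1 h2
    exact Real.log_nonpos h1.le (h2.trans hb1))
  -- The inner factor is `b` divided by its outer factor; the quotient is bounded by 1 since the
  -- outer function dominates `b` in the disc.
  obtain ⟨i, hi, hie, -⟩ := exists_boundary (F := fun z => ext b z * outerFn (fun t => -u t) z)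
    (hb.differentiableOn.mul (differentiableOn_outerFn hu.neg)) zero_le_one fun z hz => by
      rw [outerFn_neg, norm_mul, norm_inv, ← div_eq_mul_inv,
        div_le_one (norm_pos_iff.2 (outerFn_ne_zero _ _))]
      exact hle z hz
  obtain ⟨d, hd⟩ := exists_mul i f
  have hbd : b = d := hb.eq_of_ext (hi.of_mul hf hd) fun z hz => by
    rw [ext_of_mul hi hf hd hz, hie hz, hfe hz]
    simp only
    rw [outerFn_neg, mul_assoc, inv_mul_cancel₀ (outerFn_ne_zero _ _), mul_one]
  refine ⟨i, f, u, hi, hf, hu, hfe, ?_, hbd ▸ hd⟩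
  filter_upwards [hfn, hpos, hbd ▸ hd] with t h1 h2 h3
  have h4 : ‖f t‖ = ‖b t‖ := by rw [h1, hudef, Real.exp_log h2]
  have h5 : ‖b t‖ = ‖i t‖ * ‖f t‖ := by rw [← norm_mul, ← h3]
  rw [h4] at h5
  exact (mul_right_cancel₀ h2.ne' ((one_mul _).trans h5)).symm

/-! ### Isometries between closed spans with equal Gram matrices -/

section Gram

variable {ι X Y Z : Type*} [NormedAddCommGroup X] [InnerProductSpace ℂ X]
  [NormedAddCommGroup Y] [InnerProductSpace ℂ Y] [NormedAddCommGroup Z]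
  [NormedSpace ℂ Z]

theorem inner_linearCombination_eq {κ : ι → X} {ε : ι → Y}
    (h : ∀ i j, inner ℂ (κ i) (κ j) = inner ℂ (ε i) (ε j)) (c d : ι →₀ ℂ) :
    inner ℂ (Finsupp.linearCombination ℂ κ c) (Finsupp.linearCombination ℂ κ d) =
      inner ℂ (Finsupp.linearCombination ℂ ε c) (Finsupp.linearCombination ℂ ε d) := by
  simp only [Finsupp.linearCombination_apply, Finsupp.sum_inner, Finsupp.inner_sum,
    inner_smul_left, inner_smul_right, h]

theorem norm_linearCombination_eq {κ : ι → X} {ε : ι → Y}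
    (h : ∀ i j, inner ℂ (κ i) (κ j) = inner ℂ (ε i) (ε j)) (c : ι →₀ ℂ) :
    ‖Finsupp.linearCombination ℂ κ c‖ = ‖Finsupp.linearCombination ℂ ε c‖ := by
  rw [← sq_eq_sq₀ (norm_nonneg _) (norm_nonneg _), ← inner_self_eq_norm_sq (𝕜 := ℂ),
    ← inner_self_eq_norm_sq (𝕜 := ℂ), inner_linearCombination_eq h]

/-- Equal Gram matrices make `∑ cᵢ κᵢ ↦ ∑ cᵢ εᵢ` norm preserving, so it carries Cauchy sequences to
Cauchy sequences and reaches the closed span. The maps `P` and `Q` will be first-coordinate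
projections or the defect root: the isometry keeps track of the underlying function. -/
theorem exists_mem_closure_of_gram [CompleteSpace Y] {κ : ι → X} {ε : ι → Y}
    (h : ∀ i j, inner ℂ (κ i) (κ j) = inner ℂ (ε i) (ε j)) (P : X →L[ℂ] Z) (Q : Y →L[ℂ] Z)
    (hPQ : ∀ i, P (κ i) = Q (ε i)) {x : X}
    (hx : x ∈ (Submodule.span ℂ (range κ)).topologicalClosure) :
    ∃ y ∈ (Submodule.span ℂ (range ε)).topologicalClosure, P x = Q y ∧ ‖x‖ = ‖y‖ := by
  obtain ⟨s, hs, hlim⟩ := mem_closure_iff_seq_limit.1 hx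
  have hs' : ∀ n, ∃ c : ι →₀ ℂ, Finsupp.linearCombination ℂ κ c = s n := fun n => by
    have : s n ∈ Submodule.span ℂ (range κ) := hs n
    exact Finsupp.mem_span_range_iff_exists_finsupp.1 this
  choose c hc using hs'
  set t : ℕ → Y := fun n => Finsupp.linearCombination ℂ ε (c n) with ht
  have hcauchy : CauchySeq t := by
    have h1 := hlim.cauchySeq
    rw [Metric.cauchySeq_iff'] at h1 ⊢
    intro r hr
    obtain ⟨N, hN⟩ := h1 r hr
    refine ⟨N, fun n hn => ?_⟩
    have h2 := hN n hn
    rw [dist_eq_norm, ← hc, ← hc, ← map_sub, norm_linearCombination_eq h] at h2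
    rwa [dist_eq_norm, ht, ← map_sub]
  obtain ⟨y, hy⟩ := cauchySeq_tendsto_of_complete hcauchy
  refine ⟨y, mem_closure_of_tendsto hy (Eventually.of_forall fun n => ?_), ?_, ?_⟩
  · exact (Finsupp.mem_span_range_iff_exists_finsupp (R := ℂ)).2 ⟨c n, rfl⟩
  · refine tendsto_nhds_unique ((P.continuous.tendsto x).comp hlim)
      (((Q.continuous.tendsto y).comp hy).congr fun n => ?_)
    simp only [Function.comp, ht, ← hc, Finsupp.linearCombination_apply, Finsupp.sum,
      map_sum, map_smul, hPQ]
  · refine tendsto_nhds_unique hlim.norm (hy.norm.congr fun n => ?_)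
    rw [← hc, norm_linearCombination_eq h]

end Gram

/-! ### The range of a defect operator -/

section Defect

variable {H : Type*} [NormedAddCommGroup H] [InnerProductSpace ℂ H] [CompleteSpace H]

/-- Data describing the range space of `(1 - T T*)^{1/2}` for a column isometry `(T, R)`. -/
structure DefectData (T R S : H →L[ℂ] H) : Prop where
  isometry : ∀ f g, inner ℂ (T f) (T g) + inner ℂ (R f) (R g) = inner ℂ f g
  injective : ∀ g, ContinuousLinearMap.adjoint R g = 0 → g = 0
  selfAdjoint : ∀ f g, inner ℂ (S f) g = inner ℂ f (S g)
  sq : ∀ f, S (S f) = f - T (ContinuousLinearMap.adjoint T f)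

/-- The graph space `{(f, g) : T* f = R* g}`. -/
def graphSpace (T R : H →L[ℂ] H) : Submodule ℂ (WithLp 2 (H × H)) where
  carrier := {x | ContinuousLinearMap.adjoint T x.fst = ContinuousLinearMap.adjoint R x.snd}
  zero_mem' := by simp
  add_mem' := by
    intro x y hx hy
    simp only [mem_ofPred_eq] at hx hy ⊢
    simp [hx, hy]
  smul_mem' := by
    intro c x hx
    simp only [mem_ofPred_eq] at hx ⊢
    simp [hx]

theorem mem_graphSpace {T R : H →L[ℂ] H} {x : WithLp 2 (H × H)} : x ∈ graphSpace T R ↔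
    ContinuousLinearMap.adjoint T x.fst = ContinuousLinearMap.adjoint R x.snd := Iff.rfl

theorem isClosed_graphSpace (T R : H →L[ℂ] H) : IsClosed (graphSpace T R : Set (WithLp 2 (H × H))) :=
  isClosed_eq ((ContinuousLinearMap.adjoint T).continuous.comp (WithLp.prod_continuous_ofLp 2 H H).fst)
    ((ContinuousLinearMap.adjoint R).continuous.comp (WithLp.prod_continuous_ofLp 2 H H).snd)

/-- The projection of `(h, 0)` to the graph space. -/
def graphProj (T R S : H →L[ℂ] H) (h : H) : WithLp 2 (H × H) :=
  WithLp.toLp 2 (S (S h), R (ContinuousLinearMap.adjoint T h))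

variable {T R S : H →L[ℂ] H}

theorem DefectData.adjoint_comp (hd : DefectData T R S) (f : H) :
    ContinuousLinearMap.adjoint T (T f) + ContinuousLinearMap.adjoint R (R f) = f := by
  refine ext_inner_right ℂ fun g => ?_
  rw [inner_add_left, ContinuousLinearMap.adjoint_inner_left, ContinuousLinearMap.adjoint_inner_left,
    hd.isometry]

theorem DefectData.graphProj_mem (hd : DefectData T R S) (h : H) :
    graphProj T R S h ∈ graphSpace T R := by
  rw [mem_graphSpace]
  change ContinuousLinearMap.adjoint T (S (S h)) =
    ContinuousLinearMap.adjoint R (R (ContinuousLinearMap.adjoint T h))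
  rw [hd.sq, map_sub]
  have := hd.adjoint_comp (ContinuousLinearMap.adjoint T h)
  exact (eq_sub_of_add_eq' this).symm

/-- Moving adjoints leaves the error `⟨T* h, R* g - T* f⟩`, which the graph relation kills. -/
theorem DefectData.inner_graphProj (hd : DefectData T R S) (h : H) {x : WithLp 2 (H × H)}
    (hx : x ∈ graphSpace T R) : inner ℂ (graphProj T R S h) x = inner ℂ h x.fst := by
  have h1 : inner ℂ (graphProj T R S h) x = inner ℂ (S (S h)) x.fst +
      inner ℂ (R (ContinuousLinearMap.adjoint T h)) x.snd := WithLp.prod_inner_apply _ _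
  rw [h1, hd.sq, inner_sub_left, ← ContinuousLinearMap.adjoint_inner_right T,
    ← ContinuousLinearMap.adjoint_inner_right R, ← mem_graphSpace.1 hx]
  ring

/-- A graph vector orthogonal to all these projections has first coordinate 0; then `R*` kills the
second, which vanishes by injectivity of `R*`. -/
theorem DefectData.closure_span_graphProj (hd : DefectData T R S) :
    (Submodule.span ℂ (range (graphProj T R S))).topologicalClosure = graphSpace T R := by
  apply le_antisymm
  · refine Submodule.topologicalClosure_minimal _ ?_ (isClosed_graphSpace T R)
    rw [Submodule.span_le]
    rintro _ ⟨h, rfl⟩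
    exact hd.graphProj_mem h
  · intro x hx
    set V := (Submodule.span ℂ (range (graphProj T R S))).topologicalClosure with hV
    have hVle : V ≤ graphSpace T R := by
      refine Submodule.topologicalClosure_minimal _ ?_ (isClosed_graphSpace T R)
      rw [Submodule.span_le]
      rintro _ ⟨h, rfl⟩
      exact hd.graphProj_mem h
    have : CompleteSpace V := (Submodule.isClosed_topologicalClosure _).completeSpace_coe
    obtain ⟨y, hy, z, hz, rfl⟩ := V.exists_add_mem_mem_orthogonal x
    have hzg : z ∈ graphSpace T R := by
      have := Submodule.sub_mem _ hx (hVle hy)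
      rwa [add_sub_cancel_left] at this
    have h1 : z.fst = 0 := by
      refine ext_inner_left ℂ fun h => ?_
      rw [inner_zero_right, ← hd.inner_graphProj h hzg]
      exact hz _ (Submodule.le_topologicalClosure _ (Submodule.subset_span ⟨h, rfl⟩))
    have h2 : z.snd = 0 := by
      refine hd.injective _ ?_
      rw [← mem_graphSpace.1 hzg, h1, map_zero]
    have h3 : z = 0 := by
      refine WithLp.ofLp_injective 2 (Prod.ext h1 h2)
    rw [h3, add_zero]
    exact hy

/-- Both inner products equal `⟨h, S² k⟩`, as `S² k` is the first coordinate of the projection of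
`(k, 0)`. -/
theorem DefectData.gram (hd : DefectData T R S) (h k : H) :
    inner ℂ (S h) (S k) = inner ℂ (graphProj T R S h) (graphProj T R S k) := by
  rw [hd.inner_graphProj h (hd.graphProj_mem k), hd.selfAdjoint]
  rfl

theorem DefectData.closure_range (hd : DefectData T R S) :
    (Submodule.span ℂ (range fun h => S h)).topologicalClosure =
      (LinearMap.ker (S : H →ₗ[ℂ] H))ᗮ := by
  rw [← Submodule.orthogonal_orthogonal_eq_closure]
  congr 1
  ext x
  rw [Submodule.mem_orthogonal, LinearMap.mem_ker]
  constructor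
  · intro h
    refine ext_inner_left ℂ fun k => ?_
    rw [inner_zero_right]
    exact (hd.selfAdjoint k x).symm.trans (h _ (Submodule.subset_span ⟨k, rfl⟩))
  · intro h u hu
    induction hu using Submodule.span_induction with
    | mem y hy =>
      obtain ⟨k, rfl⟩ := hy
      exact (hd.selfAdjoint k x).trans (by rw [show S x = 0 from h, inner_zero_right])
    | zero => simp
    | add y z _ _ hy hz => rw [inner_add_left, hy, hz, add_zero]
    | smul a y _ hy => rw [inner_smul_left, hy, mul_zero]

/-- The first coordinate as a continuous linear map. -/
def fstL (X Y : Type*) [NormedAddCommGroup X] [InnerProductSpace ℂ X] [NormedAddCommGroup Y]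
    [InnerProductSpace ℂ Y] : WithLp 2 (X × Y) →L[ℂ] X :=
  ContinuousLinearMap.fst ℂ X Y ∘L (WithLp.prodContinuousLinearEquiv 2 ℂ X Y).toContinuousLinearMap

theorem fstL_apply {X Y : Type*} [NormedAddCommGroup X] [InnerProductSpace ℂ X]
    [NormedAddCommGroup Y] [InnerProductSpace ℂ Y] (x : WithLp 2 (X × Y)) :
    fstL X Y x = x.fst := rfl

/-- The isometry sending `S h` to the projection of `(h, 0)` turns `S` on `(ker S)ᗮ` into the first
coordinate. Together with `exists_range`, this identifies the range norm of `S` with the graph norm.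
-/
theorem DefectData.exists_graph (hd : DefectData T R S) {x : H}
    (hx : x ∈ (LinearMap.ker (S : H →ₗ[ℂ] H))ᗮ) :
    ∃ y ∈ graphSpace T R, y.fst = S x ∧ ‖y‖ = ‖x‖ := by
  rw [← hd.closure_range] at hx
  obtain ⟨y, hy, h1, h2⟩ := exists_mem_closure_of_gram (κ := fun h => S h)
    (ε := graphProj T R S) hd.gram S (fstL H H) (fun h => rfl) hx
  rw [hd.closure_span_graphProj] at hy
  exact ⟨y, hy, h1.symm, h2.symm⟩

theorem DefectData.exists_range (hd : DefectData T R S) {y : WithLp 2 (H × H)}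
    (hy : y ∈ graphSpace T R) :
    ∃ x ∈ (LinearMap.ker (S : H →ₗ[ℂ] H))ᗮ, S x = y.fst ∧ ‖x‖ = ‖y‖ := by
  rw [← hd.closure_span_graphProj] at hy
  obtain ⟨x, hx, h1, h2⟩ := exists_mem_closure_of_gram (ε := fun h => S h)
    (κ := graphProj T R S) (fun i j => (hd.gram i j).symm) (fstL H H) S (fun h => rfl) hy
  rw [hd.closure_range] at hx
  exact ⟨x, hx, h1.symm, h2.symm⟩

end Defect

/-! ### Sesquiholomorphic functions vanishing on the diagonal -/

theorem eqOn_zero_of_real {f : ℂ → ℂ} {r : ℝ} (hr : 0 < r) (hf : DifferentiableOn ℂ f (ball 0 r))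
    (h : ∀ x : ℝ, |x| < r → f x = 0) : EqOn f 0 (ball 0 r) := by
  refine (hf.analyticOnNhd isOpen_ball).eqOn_zero_of_preconnected_of_frequently_eq_zero
    (convex_ball 0 r).isPreconnected (mem_ball_self hr) ?_
  have hmap : Tendsto (fun x : ℝ => (x : ℂ)) (𝓝[≠] 0) (𝓝[≠] 0) := by
    refine tendsto_nhdsWithin_iff.2 ⟨?_, ?_⟩
    · exact (Complex.continuous_ofReal.tendsto' 0 0 (by simp)).mono_left nhdsWithin_le_nhds
    · filter_upwards [self_mem_nhdsWithin] with x hx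
      exact Complex.ofReal_ne_zero.2 hx
  refine hmap.frequently (Eventually.frequently ?_)
  have : ∀ᶠ x : ℝ in 𝓝 0, |x| < r := by
    have := (continuous_abs.tendsto (0 : ℝ))
    rw [abs_zero] at this
    exact this.eventually (gt_mem_nhds hr)
  filter_upwards [this.filter_mono nhdsWithin_le_nhds] with x hx
  exact h x hx

theorem eqOn_zero_disc_of_ball {f : ℂ → ℂ} (hf : DifferentiableOn ℂ f disc) {r : ℝ} (hr : 0 < r)
    (h : ∀ z ∈ ball (0 : ℂ) r, f z = 0) : EqOn f 0 disc := by
  refine (hf.analyticOnNhd isOpen_disc).eqOn_zero_of_preconnected_of_eventuallyEq_zero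
    (convex_ball 0 1).isPreconnected zero_mem_disc ?_
  filter_upwards [ball_mem_nhds (0 : ℂ) hr] with z hz
  exact h z hz

/-- In coordinates `v = x + iy`, `s = x - iy` the antidiagonal `s = v̄` is the set of real `(x, y)`.
The identity theorem in one variable at a time removes the reality conditions near the origin, and
then extends the vanishing to the bidisc. -/
theorem eq_zero_of_diagonal {G : ℂ × ℂ → ℂ} (hG : DifferentiableOn ℂ G (disc ×ˢ disc))
    (h : ∀ w ∈ disc, G (w, conj w) = 0) {v s : ℂ} (hv : v ∈ disc) (hs : s ∈ disc) :
    G (v, s) = 0 := by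
  have hmem : ∀ x y : ℂ, x ∈ ball (0 : ℂ) (1 / 2) → y ∈ ball (0 : ℂ) (1 / 2) →
      x + Complex.I * y ∈ disc ∧ x - Complex.I * y ∈ disc := by
    intro x y hx hy
    rw [mem_ball_zero_iff] at hx hy
    have h1 : ‖Complex.I * y‖ = ‖y‖ := by simp
    constructor <;> rw [mem_disc]
    · exact (norm_add_le _ _).trans_lt (by rw [h1]; linarith)
    · exact (norm_sub_le _ _).trans_lt (by rw [h1]; linarith)
  have hA : ∀ x : ℝ, |x| < 1 / 2 → ∀ y ∈ ball (0 : ℂ) (1 / 2),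
      G ((x : ℂ) + Complex.I * y, (x : ℂ) - Complex.I * y) = 0 := by
    intro x hx
    have hxm : (x : ℂ) ∈ ball (0 : ℂ) (1 / 2) := by simpa using hx
    refine eqOn_zero_of_real (by norm_num)
      (f := fun y => G ((x : ℂ) + Complex.I * y, (x : ℂ) - Complex.I * y)) ?_ fun y hy => ?_
    · refine hG.comp (f := fun y : ℂ => ((x : ℂ) + Complex.I * y, (x : ℂ) - Complex.I * y))
        (by fun_prop) fun y hy => ?_
      exact ⟨(hmem x y hxm hy).1, (hmem x y hxm hy).2⟩
    · have hym : (y : ℂ) ∈ ball (0 : ℂ) (1 / 2) := by simpa using hy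
      have h2 := h _ (hmem x y hxm hym).1
      have h3 : conj ((x : ℂ) + Complex.I * y) = (x : ℂ) - Complex.I * y := by
        simp [sub_eq_add_neg]
      rwa [h3] at h2
  have hB : ∀ y ∈ ball (0 : ℂ) (1 / 2), ∀ x ∈ ball (0 : ℂ) (1 / 2),
      G (x + Complex.I * y, x - Complex.I * y) = 0 := by
    intro y hy
    refine eqOn_zero_of_real (by norm_num)
      (f := fun x => G (x + Complex.I * y, x - Complex.I * y)) ?_ fun x hx => hA x hx y hy
    refine hG.comp (f := fun x : ℂ => (x + Complex.I * y, x - Complex.I * y))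
      (by fun_prop) fun x hx => ?_
    exact ⟨(hmem x y hx hy).1, (hmem x y hx hy).2⟩
  have hC : ∀ v ∈ ball (0 : ℂ) (1 / 2), ∀ s ∈ ball (0 : ℂ) (1 / 2), G (v, s) = 0 := by
    intro v hv s hs
    rw [mem_ball_zero_iff] at hv hs
    -- These values of `y` and `x` solve `x + iy = v`, `x - iy = s`.
    have h1 := hB ((v - s) / (2 * Complex.I)) (by
      rw [mem_ball_zero_iff, norm_div]
      have := norm_sub_le v s
      simp only [norm_mul, Complex.norm_I, Complex.norm_ofNat, mul_one]
      linarith) ((v + s) / 2) (by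
      rw [mem_ball_zero_iff, norm_div]
      have := norm_add_le v s
      simp only [Complex.norm_ofNat]
      linarith)
    have h2 : Complex.I * ((v - s) / (2 * Complex.I)) = (v - s) / 2 := by
      field_simp
    rw [h2] at h1
    convert h1 using 2
    ext <;> simp <;> ring
  have hhalf : ball (0 : ℂ) (1 / 2) ⊆ disc := ball_subset_ball (by norm_num)
  have hD : ∀ s ∈ ball (0 : ℂ) (1 / 2), ∀ v ∈ disc, G (v, s) = 0 := by
    intro s hs
    refine eqOn_zero_disc_of_ball (f := fun v => G (v, s)) ?_ (r := 1 / 2) (by norm_num)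
      fun v hv => hC v hv s hs
    exact hG.comp (f := fun v : ℂ => (v, s)) (by fun_prop) fun v hv => ⟨hv, hhalf hs⟩
  refine eqOn_zero_disc_of_ball (f := fun s => G (v, s)) ?_ (r := 1 / 2) (by norm_num)
    (fun s hs => hD s hs v hv) hs
  exact hG.comp (f := fun s : ℂ => (v, s)) (by fun_prop) fun s hs => ⟨hv, hs⟩

theorem conj_mem_disc {w : ℂ} (hw : w ∈ disc) : conj w ∈ disc := by
  rw [mem_disc, RCLike.norm_conj]; exact mem_disc.1 hw

theorem differentiableOn_tsum_pow_smul {V : Type*} [NormedAddCommGroup V] [NormedSpace ℂ V]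
    [CompleteSpace V] {e : ℕ → V} {C : ℝ} (he : ∀ n, ‖e n‖ ≤ C * (n + 1)) :
    DifferentiableOn ℂ (fun s : ℂ => ∑' n : ℕ, s ^ n • e n) disc := by
  intro s hs
  obtain ⟨r, hr1, hr2⟩ := exists_between (mem_disc.1 hs)
  have hr0 : 0 ≤ r := (norm_nonneg s).trans hr1.le
  have h : DiscSummable fun n => ((‖e n‖ : ℝ) : ℂ) :=
    discSummable_of_le (C := C) (by simpa using he)
  have h1 := Complex.differentiableOn_tsum_of_summable_norm (F := fun (n : ℕ) (s : ℂ) => s ^ n • e n)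
    (h r hr0 hr2) (fun n => by fun_prop) (isOpen_ball (x := (0 : ℂ)) (ε := r)) fun n z hz => by
      rw [mem_ball_zero_iff] at hz
      rw [norm_smul, norm_pow, mul_comm]
      simp only [Complex.norm_real, norm_norm]
      gcongr
  exact (h1.differentiableAt (isOpen_ball.mem_nhds (by simpa using hr1))).differentiableWithinAt

/-- A rank-one identity on the diagonal extends to the whole bidisc. -/
theorem gram_of_diagonal {Y : Type*} [NormedAddCommGroup Y] [InnerProductSpace ℂ Y]
    [CompleteSpace Y] {e : ℕ → Y} {C : ℝ} (he : ∀ n, ‖e n‖ ≤ C * (n + 1)) (y : Y)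
    (h : ∀ w ∈ disc, inner ℂ (kerSum e w) (kerSum e w) * (1 - w * conj w) =
      inner ℂ (kerSum e w) y * inner ℂ y (kerSum e w)) {v w : ℂ} (hv : v ∈ disc) (hw : w ∈ disc) :
    inner ℂ (kerSum e v) (kerSum e w) * (1 - v * conj w) =
      inner ℂ (kerSum e v) y * inner ℂ y (kerSum e w) := by
  -- `F` at `conj w` is the kernel at `w`, and `L v` is the functional given by the kernel at `v`.
  -- Both are holomorphic, so the identity becomes a holomorphic one on the bidisc.
  set F : ℂ → Y := fun s => ∑' n : ℕ, s ^ n • e n with hF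
  set L : ℂ → (Y →L[ℂ] ℂ) := fun v => ∑' n : ℕ, v ^ n • innerSL ℂ (e n) with hL
  have heL : ∀ n, ‖innerSL ℂ (e n)‖ ≤ C * (n + 1) := fun n => by
    rw [innerSL_apply_norm]; exact he n
  have hFd : DifferentiableOn ℂ F disc := differentiableOn_tsum_pow_smul he
  have hLd : DifferentiableOn ℂ L disc := differentiableOn_tsum_pow_smul heL
  have hFw : ∀ w, F (conj w) = kerSum e w := fun w => rfl
  have hLv : ∀ v ∈ disc, ∀ x, L v x = inner ℂ (kerSum e v) x := by
    intro v hv x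
    have hs : Summable fun n : ℕ => v ^ n • innerSL ℂ (e n) := by
      refine Summable.of_norm ?_
      have h : DiscSummable fun n => ((‖innerSL ℂ (e n)‖ : ℝ) : ℂ) :=
        discSummable_of_le (C := C) (by simpa using heL)
      refine (h.summable_norm hv).congr fun n => ?_
      rw [norm_smul, norm_mul, Complex.norm_real, norm_norm, mul_comm]
    have h1 := hs.hasSum.mapL (ContinuousLinearMap.apply ℂ ℂ x)
    refine h1.unique ?_
    refine (hasSum_inner_kerSum he hv x).congr_fun fun n => ?_
    simp [mul_comm]
  have hG : DifferentiableOn ℂ (fun p : ℂ × ℂ => L p.1 (F p.2) * (1 - p.1 * p.2) -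
      L p.1 y * inner ℂ y (F p.2)) (disc ×ˢ disc) := by
    have h1 : DifferentiableOn ℂ (fun p : ℂ × ℂ => L p.1) (disc ×ˢ disc) :=
      hLd.comp differentiableOn_fst fun p hp => hp.1
    have h2 : DifferentiableOn ℂ (fun p : ℂ × ℂ => F p.2) (disc ×ˢ disc) :=
      hFd.comp differentiableOn_snd fun p hp => hp.2
    have h3 : DifferentiableOn ℂ (fun p : ℂ × ℂ => inner ℂ y (F p.2)) (disc ×ˢ disc) :=
      (innerSL ℂ y).differentiable.comp_differentiableOn h2
    have h4 : DifferentiableOn ℂ (fun p : ℂ × ℂ => 1 - p.1 * p.2) (disc ×ˢ disc) := by fun_prop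
    exact ((h1.clm_apply h2).mul h4).sub ((h1.clm_apply (differentiableOn_const y)).mul h3)
  have h5 := eq_zero_of_diagonal hG (fun w hw => by
    simp only
    rw [hFw, hLv w hw, hLv w hw, h w hw, sub_self]) hv (conj_mem_disc hw)
  simp only at h5
  rw [hFw, hLv v hv, hLv v hv] at h5
  exact sub_eq_zero.1 h5

/-! ### The weighted area measure -/

/-- The measure `ω dA`. -/
def wm (ω : ℂ → ℝ) : Measure ℂ := areaD.withDensity fun z => ENNReal.ofReal (ω z)

/-- A weight on the disc: nonnegative with total mass one. -/
structure IsWeight (ω : ℂ → ℝ) : Prop where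
  nonneg : ∀ᵐ z ∂areaD, 0 ≤ ω z
  int : Integrable ω areaD
  one : ∫ z, ω z ∂areaD = 1

variable {ω : ℂ → ℝ}

theorem ae_areaD_mem_disc : ∀ᵐ z ∂areaD, z ∈ disc :=
  Measure.ae_smul_measure (ae_restrict_mem isOpen_disc.measurableSet) _

theorem ae_wm_mem_disc (ω : ℂ → ℝ) : ∀ᵐ z ∂wm ω, z ∈ disc :=
  (withDensity_absolutelyContinuous areaD _).ae_le ae_areaD_mem_disc

theorem IsWeight.isProbabilityMeasure (hω : IsWeight ω) : IsProbabilityMeasure (wm ω) := by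
  constructor
  rw [wm, withDensity_apply _ MeasurableSet.univ, Measure.restrict_univ,
    ← ofReal_integral_eq_lintegral_ofReal hω.int hω.nonneg, hω.one, ENNReal.ofReal_one]

theorem IsWeight.dirichletEnergy_eq (hω : IsWeight ω) (f : ℂ → ℂ) :
    dirichletEnergy ω f = ∫⁻ z, ‖deriv f z‖ₑ ^ 2 ∂wm ω := by
  rw [wm, lintegral_withDensity_eq_lintegral_mul₀ hω.int.aemeasurable.ennreal_ofReal
    ((measurable_deriv f).enorm.pow_const 2).aemeasurable, dirichletEnergy]
  refine lintegral_congr fun z => ?_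
  simp only [Pi.mul_apply]
  rw [mul_comm]

theorem IsWeight.integral_wm (hω : IsWeight ω) {V : Type*} [NormedAddCommGroup V] [NormedSpace ℝ V]
    (g : ℂ → V) : ∫ z, g z ∂wm ω = ∫ z, ω z • g z ∂areaD := by
  rw [wm, integral_withDensity_eq_integral_toReal_smul₀ hω.int.aemeasurable.ennreal_ofReal
    (Eventually.of_forall fun z => ENNReal.ofReal_lt_top)]
  refine integral_congr_ae ?_
  filter_upwards [hω.nonneg] with z hz
  rw [ENNReal.toReal_ofReal hz]

theorem dirichletEnergy_congr {f g : ℂ → ℂ} (h : EqOn f g disc) :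
    dirichletEnergy ω f = dirichletEnergy ω g := by
  refine lintegral_congr_ae ?_
  filter_upwards [ae_areaD_mem_disc] with z hz
  rw [(h.eventuallyEq_of_mem (isOpen_disc.mem_nhds hz)).deriv_eq]

theorem dirichletNormSq_congr {f g : ℂ → ℂ} (h : EqOn f g disc) :
    dirichletNormSq ω f = dirichletNormSq ω g := by
  rw [dirichletNormSq, dirichletNormSq, hardyNormSq_congr h, dirichletEnergy_congr h]

/-! ### The Dirichlet space as a space of pairs `(f, f')` -/

/-- `L²(ω dA)`. -/
abbrev WTwo (ω : ℂ → ℝ) : Type := Lp ℂ 2 (wm ω)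

theorem IsWeight.memLp_dmono (hω : IsWeight ω) (n : ℕ) :
    MemLp (fun z : ℂ => (n : ℂ) * z ^ (n - 1)) 2 (wm ω) := by
  have := hω.isProbabilityMeasure
  refine MemLp.of_bound (Continuous.aestronglyMeasurable (by fun_prop)) n ?_
  filter_upwards [ae_wm_mem_disc ω] with z hz
  rw [norm_mul, norm_pow, Complex.norm_natCast]
  exact mul_le_of_le_one_right (Nat.cast_nonneg n) (pow_le_one₀ (norm_nonneg _) (mem_disc.1 hz).le)

/-- The derivative of `zⁿ` in `L²(ω dA)`. -/
def dmono (hω : IsWeight ω) (n : ℕ) : WTwo ω := (hω.memLp_dmono n).toLp _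

theorem coeFn_dmono (hω : IsWeight ω) (n : ℕ) :
    dmono hω n =ᵐ[wm ω] fun z => (n : ℂ) * z ^ (n - 1) := (hω.memLp_dmono n).coeFn_toLp

theorem norm_dmono_le (hω : IsWeight ω) (n : ℕ) : ‖dmono hω n‖ ≤ n := by
  have := hω.isProbabilityMeasure
  have h := Lp.norm_le_of_ae_bound (f := dmono hω n) (C := n) (Nat.cast_nonneg n) (by
    filter_upwards [coeFn_dmono hω n, ae_wm_mem_disc ω] with z h1 hz
    rw [h1, norm_mul, norm_pow, Complex.norm_natCast]
    exact mul_le_of_le_one_right (Nat.cast_nonneg n)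
      (pow_le_one₀ (norm_nonneg _) (mem_disc.1 hz).le))
  have h1 : measureUnivNNReal (wm ω) = 1 := by simp [measureUnivNNReal]
  simpa [h1] using h

theorem norm_dmono_le' (hω : IsWeight ω) (n : ℕ) : ‖dmono hω n‖ ≤ 1 * ((n : ℝ) + 1) :=
  (norm_dmono_le hω n).trans (by linarith)

/-- The ambient Hilbert space of pairs. -/
abbrev DirPair (ω : ℂ → ℝ) : Type := WithLp 2 (hardyTwo × WTwo ω)

/-- The pair `(zⁿ, n zⁿ⁻¹)`. -/
def dvec (hω : IsWeight ω) (n : ℕ) : DirPair ω := WithLp.toLp 2 (mono n, dmono hω n)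

theorem dirPair_norm_sq (x : DirPair ω) : ‖x‖ ^ 2 = ‖x.fst‖ ^ 2 + ‖x.snd‖ ^ 2 :=
  WithLp.prod_norm_sq_eq_of_L2 x

theorem norm_dvec_le (hω : IsWeight ω) (n : ℕ) : ‖dvec hω n‖ ≤ 1 * ((n : ℝ) + 1) := by
  rw [one_mul]
  refine le_of_sq_le_sq ?_ (by positivity)
  rw [dirPair_norm_sq]
  have h1 : ‖(dvec hω n).fst‖ = 1 := norm_mono n
  have h2 : ‖(dvec hω n).snd‖ ≤ n := norm_dmono_le hω n
  have h3 : ‖(dvec hω n).snd‖ ^ 2 ≤ (n : ℝ) ^ 2 := by gcongr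
  rw [h1]
  nlinarith [(Nat.cast_nonneg n : (0 : ℝ) ≤ n)]

theorem norm_cauchyKer_le {w : ℂ} (hw : w ∈ disc) : ‖cauchyKer w‖ ≤ (1 - ‖w‖)⁻¹ := by
  have h := tsum_of_norm_bounded (f := fun n : ℕ => (conj w) ^ n • mono n)
    (hasSum_geometric_of_lt_one (norm_nonneg w) (mem_disc.1 hw)) fun n => by
      rw [hnorm_smul, norm_mono, norm_pow, RCLike.norm_conj, mul_one]
  exact h

/-- Cauchy's estimate on the circle of radius `(1 - |z|)/2` about `z`, whose points stay at distance
at least `(1 - |z|)/2` from the unit circle. -/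
theorem norm_deriv_hext_le (h : hardyTwo) {z : ℂ} (hz : z ∈ disc) :
    ‖deriv (hext h) z‖ ≤ ((1 - ‖z‖) / 2)⁻¹ * ‖h‖ / ((1 - ‖z‖) / 2) := by
  have hz' := mem_disc.1 hz
  have hr : 0 < (1 - ‖z‖) / 2 := by linarith
  have hsub : closedBall z ((1 - ‖z‖) / 2) ⊆ disc := fun ζ hζ => by
    rw [mem_disc]
    have h1 : ‖ζ - z‖ ≤ (1 - ‖z‖) / 2 := by simpa [dist_eq_norm] using hζ
    have h2 := norm_add_le (ζ - z) z
    rw [sub_add_cancel] at h2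
    linarith
  refine Complex.norm_deriv_le_of_forall_mem_sphere_norm_le hr
    ((differentiableOn_hext h).mono (closure_ball_subset_closedBall.trans hsub)).diffContOnCl
    fun ζ hζ => ?_
  have hζd := hsub (sphere_subset_closedBall hζ)
  rw [hext_eq_inner hζd]
  refine (norm_inner_le_norm (𝕜 := ℂ) (E := hardyTwo) _ _).trans ?_
  gcongr
  refine (norm_cauchyKer_le hζd).trans ?_
  gcongr
  have h1 : ‖ζ - z‖ = (1 - ‖z‖) / 2 := by simpa [dist_eq_norm] using hζ
  have h2 := norm_add_le (ζ - z) z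
  rw [sub_add_cancel] at h2
  linarith

theorem deriv_hext_add (f g : hardyTwo) {z : ℂ} (hz : z ∈ disc) :
    deriv (hext (f + g)) z = deriv (hext f) z + deriv (hext g) z := by
  have h : EqOn (hext (f + g)) (fun z => hext f z + hext g z) disc := fun z hz => hext_add f g hz
  rw [(h.eventuallyEq_of_mem (isOpen_disc.mem_nhds hz)).deriv_eq]
  exact deriv_fun_add ((differentiableOn_hext f).differentiableAt (isOpen_disc.mem_nhds hz))
    ((differentiableOn_hext g).differentiableAt (isOpen_disc.mem_nhds hz))

theorem deriv_hext_smul (c : ℂ) (f : hardyTwo) {z : ℂ} (hz : z ∈ disc) :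
    deriv (hext (c • f)) z = c * deriv (hext f) z := by
  have h : EqOn (hext (c • f)) (fun z => c * hext f z) disc := fun z hz => hext_smul c f hz
  rw [(h.eventuallyEq_of_mem (isOpen_disc.mem_nhds hz)).deriv_eq]
  exact deriv_const_mul _ ((differentiableOn_hext f).differentiableAt (isOpen_disc.mem_nhds hz))

theorem deriv_hext_sub (f g : hardyTwo) {z : ℂ} (hz : z ∈ disc) :
    deriv (hext (f - g)) z = deriv (hext f) z - deriv (hext g) z := by
  have h : EqOn (hext (f - g)) (fun z => hext f z - hext g z) disc := fun z hz => hext_sub f g hz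
  rw [(h.eventuallyEq_of_mem (isOpen_disc.mem_nhds hz)).deriv_eq]
  exact deriv_fun_sub ((differentiableOn_hext f).differentiableAt (isOpen_disc.mem_nhds hz))
    ((differentiableOn_hext g).differentiableAt (isOpen_disc.mem_nhds hz))

theorem tendsto_deriv_hext {h : ℕ → hardyTwo} {g : hardyTwo} (hlim : Tendsto h atTop (𝓝 g)) {z : ℂ}
    (hz : z ∈ disc) :
    Tendsto (fun k => deriv (hext (h k)) z) atTop (𝓝 (deriv (hext g) z)) := by
  rw [tendsto_iff_norm_sub_tendsto_zero] at hlim ⊢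
  have h1 := (hlim.const_mul ((1 - ‖z‖) / 2)⁻¹).div_const ((1 - ‖z‖) / 2)
  rw [mul_zero, zero_div] at h1
  refine squeeze_zero (fun _ => norm_nonneg _) (fun k => ?_) h1
  rw [← deriv_hext_sub _ _ hz]
  exact norm_deriv_hext_le _ hz

/-- The space of pairs `(f, f')`. -/
def dirGraph (ω : ℂ → ℝ) : Submodule ℂ (DirPair ω) where
  carrier := {x | x.snd =ᵐ[wm ω] fun z => deriv (hext x.fst) z}
  zero_mem' := by
    have h0 : EqOn (hext 0) (fun _ => 0) disc := fun z hz => by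
      rw [hext_eq_inner hz]; exact inner_zero_right (𝕜 := ℂ) (E := hardyTwo) _
    filter_upwards [Lp.coeFn_zero ℂ 2 (wm ω), ae_wm_mem_disc ω] with z h1 hz
    have h2 := (h0.eventuallyEq_of_mem (isOpen_disc.mem_nhds hz)).deriv_eq
    rw [deriv_const] at h2
    exact h1.trans h2.symm
  add_mem' := by
    intro x y hx hy
    simp only [mem_ofPred_eq] at hx hy ⊢
    filter_upwards [hx, hy, Lp.coeFn_add x.snd y.snd, ae_wm_mem_disc ω] with z h1 h2 h3 hz
    refine h3.trans ?_
    rw [Pi.add_apply, h1, h2]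
    exact (deriv_hext_add _ _ hz).symm
  smul_mem' := by
    intro c x hx
    simp only [mem_ofPred_eq] at hx ⊢
    filter_upwards [hx, Lp.coeFn_smul c x.snd, ae_wm_mem_disc ω] with z h1 h3 hz
    refine h3.trans ?_
    rw [Pi.smul_apply, h1]
    exact (deriv_hext_smul _ _ hz).symm

theorem mem_dirGraph {x : DirPair ω} :
    x ∈ dirGraph ω ↔ x.snd =ᵐ[wm ω] fun z => deriv (hext x.fst) z := Iff.rfl

/-- Derivatives at a point are continuous on `H²`, and `L²` convergence gives convergence almost
everywhere along a subsequence; so the relation `g = f'` survives limits. -/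
theorem isClosed_dirGraph (ω : ℂ → ℝ) : IsClosed (dirGraph ω : Set (DirPair ω)) := by
  refine IsSeqClosed.isClosed fun x y hx hlim => ?_
  have h1 : Tendsto (fun k => (x k).fst) atTop (𝓝 y.fst) :=
    ((WithLp.prod_continuous_ofLp 2 _ _).fst.tendsto y).comp hlim
  have h2 : Tendsto (fun k => (x k).snd) atTop (𝓝 y.snd) :=
    ((WithLp.prod_continuous_ofLp 2 _ _).snd.tendsto y).comp hlim
  obtain ⟨ns, hns, hae⟩ := (tendstoInMeasure_of_tendsto_Lp h2).exists_seq_tendsto_ae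
  have h3 : ∀ᵐ z ∂wm ω, ∀ k, (x k).snd z = deriv (hext (x k).fst) z := ae_all_iff.2 hx
  change y.snd =ᵐ[wm ω] fun z => deriv (hext y.fst) z
  filter_upwards [hae, h3, ae_wm_mem_disc ω] with z h4 h5 hz
  refine tendsto_nhds_unique h4 ((tendsto_deriv_hext (h1.comp hns.tendsto_atTop) hz).congr fun k => ?_)
  exact (h5 (ns k)).symm

theorem dvec_mem (hω : IsWeight ω) (n : ℕ) : dvec hω n ∈ dirGraph ω := by
  rw [mem_dirGraph]
  filter_upwards [coeFn_dmono hω n, ae_wm_mem_disc ω] with z h1 hz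
  refine h1.trans ?_
  have h : EqOn (hext (mono n)) (fun z => z ^ n) disc := fun z hz => hext_mono n hz
  change _ = deriv (hext (mono n)) z
  rw [(h.eventuallyEq_of_mem (isOpen_disc.mem_nhds hz)).deriv_eq]
  simp

theorem WTwo_enorm_sq (f : WTwo ω) : ‖f‖ₑ ^ 2 = ∫⁻ z, ‖f z‖ₑ ^ 2 ∂wm ω := by
  rw [Lp.enorm_def, eLpNorm_eq_lintegral_rpow_enorm_toReal (by norm_num) (by norm_num)]
  simp only [ENNReal.toReal_ofNat, ENNReal.rpow_two]
  rw [← ENNReal.rpow_natCast, ← ENNReal.rpow_mul]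
  norm_num

theorem enorm_sq_eq {V : Type*} [SeminormedAddCommGroup V] (x : V) :
    ‖x‖ₑ ^ 2 = ENNReal.ofReal (‖x‖ ^ 2) := by
  rw [ENNReal.ofReal_pow (norm_nonneg _), ofReal_norm]

theorem IsWeight.dirichletNormSq_eq (hω : IsWeight ω) {x : DirPair ω} (hx : x ∈ dirGraph ω) :
    dirichletNormSq ω (hext x.fst) = ‖x‖ₑ ^ 2 := by
  have h1 : dirichletEnergy ω (hext x.fst) = ‖x.snd‖ₑ ^ 2 := by
    rw [hω.dirichletEnergy_eq, WTwo_enorm_sq]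
    refine lintegral_congr_ae ?_
    filter_upwards [mem_dirGraph.1 hx] with z hz
    rw [hz]
  rw [dirichletNormSq, hardyNormSq_hext, h1, enorm_sq_eq x, dirPair_norm_sq,
    ENNReal.ofReal_add (by positivity) (by positivity), ← enorm_sq_eq, ← enorm_sq_eq]

theorem IsWeight.hext_mem_dirichletSpace (hω : IsWeight ω) {x : DirPair ω} (hx : x ∈ dirGraph ω) :
    hext x.fst ∈ dirichletSpace ω := by
  have h := hω.dirichletNormSq_eq hx
  rw [dirichletNormSq] at h
  refine ⟨differentiableOn_hext _, lt_of_le_of_lt le_add_self (h.trans_lt ?_)⟩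
  finiteness

theorem IsWeight.exists_dirGraph (hω : IsWeight ω) {h : hardyTwo}
    (hh : dirichletEnergy ω (hext h) < ∞) : ∃ x ∈ dirGraph ω, x.fst = h := by
  rw [hω.dirichletEnergy_eq] at hh
  have hm : MemLp (fun z => deriv (hext h) z) 2 (wm ω) := by
    refine ⟨(measurable_deriv _).aestronglyMeasurable, ?_⟩
    rw [eLpNorm_lt_top_iff_lintegral_rpow_enorm_lt_top (by norm_num) (by norm_num)]
    simpa using hh
  exact ⟨WithLp.toLp 2 (h, hm.toLp _), hm.coeFn_toLp, rfl⟩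

/-! ### Derivatives of the Cauchy kernels -/

theorem kerSum_dvec (hω : IsWeight ω) {w : ℂ} (hw : w ∈ disc) :
    kerSum (dvec hω) w = WithLp.toLp 2 (cauchyKer w, kerSum (dmono hω) w) := by
  have h1 := (summable_kerSum norm_mono_le hw).hasSum
  have h2 := (summable_kerSum (norm_dmono_le' hω) hw).hasSum
  have h3 := (h1.prodMk h2).mapL (WithLp.prodContinuousLinearEquiv 2 ℂ hardyTwo (WTwo ω)).symm.toContinuousLinearMap
  exact (h3.congr_fun fun n => rfl).tsum_eq

theorem kerSum_dvec_mem (hω : IsWeight ω) {w : ℂ} (hw : w ∈ disc) :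
    kerSum (dvec hω) w ∈ dirGraph ω := by
  have h1 := (summable_kerSum (norm_dvec_le hω) hw).hasSum
  refine (isClosed_dirGraph ω).mem_of_tendsto h1 (Eventually.of_forall fun s => ?_)
  exact Submodule.sum_mem _ fun n _ => Submodule.smul_mem _ _ (dvec_mem hω n)

theorem one_sub_ne_zero_of_disc {v w : ℂ} (hv : v ∈ disc) (hw : w ∈ disc) : 1 - v * w ≠ 0 := by
  intro h
  have h1 : ‖v * w‖ < 1 := by
    rw [norm_mul]
    exact mul_lt_one_of_nonneg_of_lt_one_left (norm_nonneg _) (mem_disc.1 hv) (mem_disc.1 hw).le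
  rw [← sub_eq_zero.1 h, norm_one] at h1
  exact lt_irrefl _ h1

theorem deriv_hext_cauchyKer {v w : ℂ} (hv : v ∈ disc) (hw : w ∈ disc) :
    deriv (hext (cauchyKer w)) v = conj w / (1 - conj w * v) ^ 2 := by
  have h : EqOn (hext (cauchyKer w)) (fun z => (1 - conj w * z)⁻¹) disc :=
    fun z hz => hext_cauchyKer hz hw
  rw [(h.eventuallyEq_of_mem (isOpen_disc.mem_nhds hv)).deriv_eq]
  have h1 : HasDerivAt (fun z => 1 - conj w * z) (-(conj w)) v := by
    simpa using ((hasDerivAt_id v).const_mul (conj w)).const_sub 1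
  simpa using (h1.fun_inv (one_sub_ne_zero_of_disc (conj_mem_disc hw) hv)).deriv

theorem coeFn_kerSum_dmono (hω : IsWeight ω) {w : ℂ} (hw : w ∈ disc) :
    (kerSum (dmono hω) w : WTwo ω) =ᵐ[wm ω] fun z => conj w / (1 - conj w * z) ^ 2 := by
  have h := mem_dirGraph.1 (kerSum_dvec_mem hω hw)
  rw [kerSum_dvec hω hw] at h
  filter_upwards [h, ae_wm_mem_disc ω] with z hz hzd
  exact hz.trans (deriv_hext_cauchyKer hzd hw)

/-- The Bergman projection enters here: `dmono hω 1` is the constant 1, the derivative of `z`, and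
the conjugate of `w̄/(1 - w̄z)²` is `w` times the Bergman kernel. -/
theorem inner_kerSum_dmono_one (hω : IsWeight ω) {w : ℂ} (hw : w ∈ disc) :
    inner ℂ (kerSum (dmono hω) w) (dmono hω 1) = w * bergman ω w := by
  rw [L2.inner_def, bergman, ← integral_const_mul]
  refine Eq.trans (integral_congr_ae (g := fun z => w / (1 - w * conj z) ^ 2) ?_) ?_
  · filter_upwards [coeFn_kerSum_dmono hω hw, coeFn_dmono hω 1] with z h1 h2
    rw [h1, h2]
    simp
  · rw [hω.integral_wm]
    refine integral_congr_ae (Eventually.of_forall fun z => ?_)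
    simp only [Complex.real_smul]
    rw [mul_comm (conj z) w]
    ring

/-- The Berezin transform enters here, through `|w̄/(1 - w̄z)²|² = |w|²/|1 - w̄z|⁴`. -/
theorem inner_kerSum_dmono_self (hω : IsWeight ω) {w : ℂ} (hw : w ∈ disc) :
    inner ℂ (kerSum (dmono hω) w) (kerSum (dmono hω) w) * ((1 - ‖w‖ ^ 2) ^ 2 : ℝ) =
      (‖w‖ ^ 2 * berezin ω w : ℝ) := by
  rw [L2.inner_def, berezin, ← integral_const_mul, ← integral_complex_ofReal, ← integral_mul_const]
  refine Eq.trans (integral_congr_ae (g := fun z =>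
    ((‖w‖ ^ 2 * ((1 - ‖w‖ ^ 2) ^ 2 / ‖1 - conj z * w‖ ^ 4) : ℝ) : ℂ)) ?_) ?_
  · filter_upwards [coeFn_kerSum_dmono hω hw] with z h1
    rw [h1, inner_self_eq_norm_sq_to_K]
    have h2 : ‖1 - conj w * z‖ = ‖1 - conj z * w‖ := by
      rw [← RCLike.norm_conj]
      congr 1
      simp [mul_comm]
    rw [norm_div, norm_pow, RCLike.norm_conj, h2]
    change ((‖w‖ / ‖1 - conj z * w‖ ^ 2 : ℝ) : ℂ) ^ 2 * _ = _
    push_cast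
    ring
  · rw [hω.integral_wm]
    refine integral_congr_ae (Eventually.of_forall fun z => ?_)
    simp only [Complex.real_smul]
    push_cast
    ring

theorem inner_dmono_one_one (hω : IsWeight ω) : inner ℂ (dmono hω 1) (dmono hω 1) = (1 : ℂ) := by
  have := hω.isProbabilityMeasure
  rw [L2.inner_def]
  refine Eq.trans (integral_congr_ae (g := fun _ => (1 : ℂ)) ?_) (by simp)
  filter_upwards [coeFn_dmono hω 1] with z h
  rw [h]
  simp

theorem IsWeight.bergman_zero (hω : IsWeight ω) : bergman ω 0 = 1 := by
  simp only [bergman, mul_zero, sub_zero, one_pow, div_one]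
  rw [integral_complex_ofReal, hω.one, Complex.ofReal_one]

theorem IsWeight.berezin_zero (hω : IsWeight ω) : berezin ω 0 = 1 := by
  simp [berezin, hω.one]

/-! ### Functions of zero energy -/

theorem IsWeight.hext_eq_const (hω : IsWeight ω) {h : hardyTwo}
    (hh : dirichletEnergy ω (hext h) = 0) {z : ℂ} (hz : z ∈ disc) : hext h z = hext h 0 := by
  have hp := hω.isProbabilityMeasure
  rw [hω.dirichletEnergy_eq, lintegral_eq_zero_iff ((measurable_deriv _).enorm.pow_const 2)] at hh
  have hd : EqOn (deriv (hext h)) 0 disc := by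
    rcases ((differentiableOn_hext h).deriv isOpen_disc |>.analyticOnNhd
      isOpen_disc).eqOn_zero_or_eventually_ne_zero_of_preconnected
      (convex_ball 0 1).isPreconnected with h1 | h1
    · exact h1
    · exfalso
      -- A derivative that is not identically zero vanishes only on a null set, whereas zero energy
      -- makes it vanish almost everywhere for the probability measure `ω dA`.
      have h2 : ∀ᵐ z ∂volume.restrict disc, deriv (hext h) z ≠ 0 :=
        ae_restrict_le_codiscreteWithin isOpen_disc.measurableSet h1
      have h3 : ∀ᵐ z ∂wm ω, deriv (hext h) z ≠ 0 :=
        (withDensity_absolutelyContinuous areaD _).ae_le (Measure.ae_smul_measure h2 _)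
      obtain ⟨z, h4, h5⟩ := (hh.and h3).exists
      simp at h4
      exact h5 h4
  refine isOpen_disc.is_const_of_deriv_eq_zero (convex_ball 0 1).isPreconnected
    (differentiableOn_hext h) hd hz zero_mem_disc

/-! ### Polynomials -/

/-- The pair `(p, p')` of a polynomial. -/
def polyVec (hω : IsWeight ω) (p : Polynomial ℂ) : DirPair ω :=
  ∑ n ∈ p.support, p.coeff n • dvec hω n

theorem polyVec_mem_span (hω : IsWeight ω) (p : Polynomial ℂ) :
    polyVec hω p ∈ Submodule.span ℂ (range (dvec hω)) :=
  Submodule.sum_mem _ fun n _ => Submodule.smul_mem _ _ (Submodule.subset_span ⟨n, rfl⟩)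

theorem span_dvec_le (hω : IsWeight ω) : Submodule.span ℂ (range (dvec hω)) ≤ dirGraph ω := by
  rw [Submodule.span_le]
  rintro _ ⟨n, rfl⟩
  exact dvec_mem hω n

theorem hext_sum_smul_dvec (hω : IsWeight ω) (s : Finset ℕ) (c : ℕ → ℂ) {z : ℂ} (hz : z ∈ disc) :
    hext (∑ n ∈ s, c n • dvec hω n).fst z = ∑ n ∈ s, c n * z ^ n := by
  have h : (∑ n ∈ s, c n • dvec hω n).fst = ∑ n ∈ s, c n • mono n := by
    rw [← fstL_apply, map_sum]
    rfl
  rw [h]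
  induction s using Finset.induction_on with
  | empty =>
    simp only [Finset.sum_empty]
    rw [hext_eq_inner hz]; exact inner_zero_right (𝕜 := ℂ) (E := hardyTwo) _
  | insert a s ha ih =>
    have ih' := ih (by rw [← fstL_apply, map_sum]; rfl)
    rw [Finset.sum_insert ha, Finset.sum_insert ha, hext_add _ _ hz, hext_smul _ _ hz,
      hext_mono _ hz, ih']

theorem hext_polyVec (hω : IsWeight ω) (p : Polynomial ℂ) {z : ℂ} (hz : z ∈ disc) :
    hext (polyVec hω p).fst z = p.eval z := by
  rw [polyVec, hext_sum_smul_dvec hω _ _ hz, Polynomial.eval_eq_sum, Polynomial.sum_def]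

theorem exists_polyVec (hω : IsWeight ω) {x : DirPair ω}
    (hx : x ∈ Submodule.span ℂ (range (dvec hω))) : ∃ p, polyVec hω p = x := by
  obtain ⟨c, rfl⟩ := Finsupp.mem_span_range_iff_exists_finsupp.1 hx
  refine ⟨⟨.ofCoeff c⟩, ?_⟩
  rfl

theorem IsWeight.dirichletNormSq_sub_poly (hω : IsWeight ω) {f : ℂ → ℂ} {x : DirPair ω}
    (hx : x ∈ dirGraph ω) (hf : EqOn f (hext x.fst) disc) (p : Polynomial ℂ) :
    dirichletNormSq ω (fun z => f z - p.eval z) = ‖x - polyVec hω p‖ₑ ^ 2 := by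
  rw [← hω.dirichletNormSq_eq (Submodule.sub_mem _ hx (span_dvec_le hω (polyVec_mem_span hω p)))]
  refine dirichletNormSq_congr fun z hz => ?_
  refine (congr_arg₂ (· - ·) (hf hz) (hext_polyVec hω p hz).symm).trans (hext_sub _ _ hz).symm

theorem dirGraph_le_of_polynomialsDense (hω : IsWeight ω) (h : PolynomialsDense ω) :
    dirGraph ω ≤ (Submodule.span ℂ (range (dvec hω))).topologicalClosure := by
  intro x hx
  refine Metric.mem_closure_iff.2 fun ε hε => ?_
  obtain ⟨p, hp⟩ := h _ (hω.hext_mem_dirichletSpace hx) (ENNReal.ofReal (ε ^ 2)) (by positivity)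
  rw [hω.dirichletNormSq_sub_poly hx (fun z _ => rfl), enorm_sq_eq,
    ENNReal.ofReal_lt_ofReal_iff (by positivity)] at hp
  exact ⟨_, polyVec_mem_span hω p, by rw [dist_eq_norm]; exact lt_of_pow_lt_pow_left₀ 2 hε.le hp⟩

theorem polynomialsDense_of_le (hω : IsWeight ω)
    (h1 : ∀ f ∈ dirichletSpace ω, ∃ x ∈ dirGraph ω, EqOn f (hext x.fst) disc)
    (h2 : dirGraph ω ≤ (Submodule.span ℂ (range (dvec hω))).topologicalClosure) :
    PolynomialsDense ω := by
  intro f hf ε hε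
  obtain ⟨x, hx, hfx⟩ := h1 f hf
  obtain ⟨δ, hδ, hδε⟩ : ∃ δ : ℝ, 0 < δ ∧ ENNReal.ofReal (δ ^ 2) ≤ ε := by
    rcases eq_or_ne ε ∞ with rfl | hε'
    · exact ⟨1, one_pos, le_top⟩
    · refine ⟨Real.sqrt ε.toReal, Real.sqrt_pos.2 (ENNReal.toReal_pos hε.ne' hε'), ?_⟩
      rw [Real.sq_sqrt ENNReal.toReal_nonneg, ENNReal.ofReal_toReal hε']
  obtain ⟨y, hy, hxy⟩ := Metric.mem_closure_iff.1 (h2 hx) δ hδ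
  obtain ⟨p, rfl⟩ := exists_polyVec hω hy
  refine ⟨p, lt_of_lt_of_le ?_ hδε⟩
  rw [hω.dirichletNormSq_sub_poly hx hfx, enorm_sq_eq, ENNReal.ofReal_lt_ofReal_iff (by positivity)]
  rw [dist_eq_norm] at hxy
  gcongr

theorem IsWeight.exists_dirGraph_eqOn (hω : IsWeight ω) (h : dirichletSpace ω ⊆ hardySpace) {f : ℂ → ℂ}
    (hf : f ∈ dirichletSpace ω) : ∃ x ∈ dirGraph ω, EqOn f (hext x.fst) disc := by
  obtain ⟨g, hg⟩ := exists_hext_eq (h hf)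
  obtain ⟨x, hx, hxg⟩ := hω.exists_dirGraph (h := g) (by rw [← dirichletEnergy_congr hg]; exact hf.2)
  exact ⟨x, hx, by rw [hxg]; exact hg⟩

/-! ### Square roots of defect operators -/

section Defect

variable {H : Type*} [NormedAddCommGroup H] [InnerProductSpace ℂ H] [CompleteSpace H]

theorem opSqrt_apply_apply {A : H →L[ℂ] H} (hA : A.IsPositive) (f : H) :
    opSqrt A (opSqrt A f) = A f := by
  have h : 0 ≤ A := (ContinuousLinearMap.nonneg_iff_isPositive A).2 hA
  have h1 : opSqrt A * opSqrt A = A := CFC.sqrt_mul_sqrt_self A h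
  exact congrArg (fun B : H →L[ℂ] H => B f) h1

theorem isPositive_opSqrt (A : H →L[ℂ] H) : (opSqrt A).IsPositive :=
  (ContinuousLinearMap.nonneg_iff_isPositive _).1 (CFC.sqrt_nonneg A)

theorem opSqrt_inner (A : H →L[ℂ] H) (f g : H) : inner ℂ (opSqrt A f) g = inner ℂ f (opSqrt A g) :=
  (isPositive_opSqrt A).isSymmetric f g

theorem isPositive_defect {T : H →L[ℂ] H} (hT : ‖T‖ ≤ 1) :
    (1 - T ∘L ContinuousLinearMap.adjoint T).IsPositive := by
  rw [ContinuousLinearMap.isPositive_def']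
  refine ⟨?_, fun f => ?_⟩
  · refine (IsSelfAdjoint.one _).sub ?_
    exact IsSelfAdjoint.mul_star_self T
  · have h1 : (1 - T ∘L ContinuousLinearMap.adjoint T).reApplyInnerSelf f =
        ‖f‖ ^ 2 - ‖ContinuousLinearMap.adjoint T f‖ ^ 2 := by
      rw [ContinuousLinearMap.reApplyInnerSelf_apply]
      simp only [sub_apply, one_apply_eq_self,
        ContinuousLinearMap.comp_apply, inner_sub_left, map_sub]
      rw [← ContinuousLinearMap.adjoint_inner_right, inner_self_eq_norm_sq, inner_self_eq_norm_sq]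
    rw [h1, sub_nonneg]
    have h2 : ‖ContinuousLinearMap.adjoint T‖ ≤ 1 := by rwa [LinearIsometryEquiv.norm_map]
    have h3 := (ContinuousLinearMap.adjoint T).le_of_opNorm_le h2 f
    rw [one_mul] at h3
    gcongr

/-- The square root of a positive operator fixes the vectors which its square fixes. -/
theorem opSqrt_eq_self {A : H →L[ℂ] H} (hA : A.IsPositive) {g : H} (hg : A g = g) :
    opSqrt A g = g := by
  set S := opSqrt A with hS
  have h1 : S (S g) = g := (opSqrt_apply_apply hA g).trans hg
  -- Since `S² g = g`, the vector `S g - g` is an eigenvector for -1 unless it is zero, and `S` is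
  -- positive.
  have h2 : S (S g - g) = -(S g - g) := by rw [map_sub, h1]; abel
  have h3 := (isPositive_opSqrt A).re_inner_nonneg_left (S g - g)
  rw [← hS, h2, inner_neg_left, map_neg, inner_self_eq_norm_sq] at h3
  have h4 : ‖S g - g‖ = 0 := by nlinarith [norm_nonneg (S g - g), sq_nonneg ‖S g - g‖]
  exact sub_eq_zero.1 (norm_eq_zero.1 h4)

end Defect

theorem norm_toeplitz_le {b : LInf} (hb1 : ‖b‖ ≤ 1) : ‖toeplitz b‖ ≤ 1 :=
  ContinuousLinearMap.opNorm_le_bound _ zero_le_one fun f =>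
    (norm_toeplitz_apply_le b f).trans (by gcongr)

theorem defectSqrt_sq {b : LInf} (hb1 : ‖b‖ ≤ 1) (f : hardyTwo) :
    defectSqrt b (defectSqrt b f) = f - toeplitz b (toeplitz (star b) f) := by
  have h := isPositive_defect (norm_toeplitz_le hb1)
  rw [← toeplitz_star] at h
  exact opSqrt_apply_apply h f

theorem defectSqrt_inner (b : LInf) (f g : hardyTwo) :
    inner ℂ (defectSqrt b f) g = inner ℂ f (defectSqrt b g) := opSqrt_inner _ f g

theorem defectSqrt_eq_self {b : LInf} (hb1 : ‖b‖ ≤ 1) {g : hardyTwo}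
    (hg : toeplitz (star b) g = 0) : defectSqrt b g = g := by
  have h := isPositive_defect (norm_toeplitz_le hb1)
  rw [← toeplitz_star] at h
  refine opSqrt_eq_self h ?_
  change g - toeplitz b (toeplitz (star b) g) = g
  rw [hg, map_zero, sub_zero]

theorem range_defectSqrt_le (b : LInf) (x : hardyTwo) :
    defectSqrt b x ∈ (LinearMap.ker (defectSqrt b : hardyTwo →ₗ[ℂ] hardyTwo))ᗮ := by
  rw [Submodule.mem_orthogonal]
  intro y hy
  rw [← defectSqrt_inner, show defectSqrt b y = 0 from hy]
  exact inner_zero_left (𝕜 := ℂ) (E := hardyTwo) _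

/-! ### Pairs -/

/-- Multiplication by `z^k` is isometric, so products with an outer function come close to it. -/
theorem norm_mulOp_star_sub_le (p a : LInf) (k : ℤ) :
    ‖mulOp (star p) (mulOp (star a) (fourierLp 2 k)) - fourierLp 2 k‖ ≤
      ‖mulOp p (toTwo a) - fourierLp 2 0‖ := by
  refine Lp.norm_le_norm_of_ae_le ?_
  filter_upwards [Lp.coeFn_sub (mulOp (star p) (mulOp (star a) (fourierLp 2 k))) (fourierLp 2 k),
    coeFn_mulOp (star p) (mulOp (star a) (fourierLp 2 k)), coeFn_mulOp (star a) (fourierLp 2 k),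
    Lp.coeFn_star p, Lp.coeFn_star a, Lp.coeFn_sub (mulOp p (toTwo a)) (fourierLp 2 0),
    coeFn_mulOp p (toTwo a), coeFn_toTwo a, coeFn_fourierLp (T := 1) 2 k,
    coeFn_fourierLp (T := 1) 2 0] with t h1 h2 h3 h4 h5 h6 h7 h8 h9 h10
  rw [h1, h6, Pi.sub_apply, Pi.sub_apply, h2, h3, h4, h5, h7, h8, h9, h10, fourier_zero]
  have h : star (p : UnitAddCircle → ℂ) t * (star (a : UnitAddCircle → ℂ) t * fourier k t) - fourier k t =
      conj (p t * a t - 1) * fourier k t := by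
    simp only [Pi.star_apply, RCLike.star_def, map_sub, map_mul, map_one]
    ring
  rw [h, norm_mul, RCLike.norm_conj]
  have h' : ‖(fourier k t : ℂ)‖ = 1 := by rw [fourier_apply]; exact norm_toCircle _
  rw [h', mul_one]

/-- A Smirnov-type principle. As `a` is cyclic, some bounded analytic `p` makes `p a` close to 1 in
`L²`, and `p a h` has no negative frequencies. -/
theorem mem_hardyTwo_of_mulOp_outer {a : LInf} (ha : AnalyticSymbol a) (ho : IsOuter (ext a))
    {h : LTwo} (hh : mulOp a h ∈ hardyTwo) : h ∈ hardyTwo := by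
  intro n hn
  rw [← inner_fourierLp]
  refine norm_le_zero_iff.1 (le_of_forall_pos_le_add fun ε hε => ?_)
  obtain ⟨p, hp, hpa⟩ := exists_mulOp_near_one ha ho (ε := ε / (‖h‖ + 1)) (by positivity)
  have h1 : inner ℂ (mulOp (star p) (mulOp (star a) (fourierLp 2 n))) h = 0 := by
    rw [inner_mulOp_left, inner_mulOp_left, mulOp_comm, inner_fourierLp]
    exact hp.mulOp_mem ⟨_, hh⟩ n hn
  have h2 : inner ℂ (fourierLp 2 n) h =
      -inner ℂ (mulOp (star p) (mulOp (star a) (fourierLp 2 n)) - fourierLp 2 n) h := by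
    rw [inner_sub_left, h1, zero_sub, neg_neg]
  rw [h2, norm_neg, zero_add]
  refine (norm_inner_le_norm _ _).trans ?_
  calc _ ≤ (ε / (‖h‖ + 1)) * ‖h‖ := by
        gcongr
        exact (norm_mulOp_star_sub_le p a n).trans hpa.le
    _ ≤ ε := by
        rw [div_mul_eq_mul_div, div_le_iff₀ (by positivity)]
        nlinarith [norm_nonneg h]

theorem norm_mulOp_mulOp_sub_le (p a : LInf) (k : ℤ) :
    ‖mulOp a (mulOp p (fourierLp 2 k)) - fourierLp 2 k‖ ≤
      ‖mulOp p (toTwo a) - fourierLp 2 0‖ := by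
  refine Lp.norm_le_norm_of_ae_le ?_
  filter_upwards [Lp.coeFn_sub (mulOp a (mulOp p (fourierLp 2 k))) (fourierLp 2 k),
    coeFn_mulOp a (mulOp p (fourierLp 2 k)), coeFn_mulOp p (fourierLp 2 k),
    Lp.coeFn_sub (mulOp p (toTwo a)) (fourierLp 2 0),
    coeFn_mulOp p (toTwo a), coeFn_toTwo a, coeFn_fourierLp (T := 1) 2 k,
    coeFn_fourierLp (T := 1) 2 0] with t h1 h2 h3 h6 h7 h8 h9 h10
  rw [h1, h6, Pi.sub_apply, Pi.sub_apply, h2, h3, h7, h8, h9, h10, fourier_zero]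
  have h : a t * (p t * fourier k t) - fourier k t = (p t * a t - 1) * fourier k t := by ring
  have h' : ‖(fourier k t : ℂ)‖ = 1 := by rw [fourier_apply]; exact norm_toCircle _
  rw [h, norm_mul, h', mul_one]

theorem hnorm_coe (f : hardyTwo) : ‖f‖ = ‖(f : LTwo)‖ := rfl

/-- Cyclicity puts every monomial in the closure of the range of `T_a`, so the kernel of the adjoint
is trivial. -/
theorem toeplitz_star_injective_of_outer {a : LInf} (ha : AnalyticSymbol a) (ho : IsOuter (ext a))
    {g : hardyTwo} (hg : toeplitz (star a) g = 0) : g = 0 := by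
  refine hardyTwo_ext_coeff fun n => ?_
  rw [inner_zero_right]
  refine norm_le_zero_iff.1 (le_of_forall_pos_le_add fun ε hε => ?_)
  obtain ⟨p, hp, hpa⟩ := exists_mulOp_near_one ha ho (ε := ε / (‖g‖ + 1)) (by positivity)
  have h1 : inner ℂ (toeplitz a (toeplitz p (mono n))) g = 0 := by
    rw [← inner_conj_symm (𝕜 := ℂ) (E := hardyTwo), ← inner_toeplitz_star, hg,
      inner_zero_left (𝕜 := ℂ) (E := hardyTwo), map_zero]
  have h2 : inner ℂ (mono n) g = -inner ℂ (toeplitz a (toeplitz p (mono n)) - mono n) g := by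
    rw [inner_sub_left, h1, zero_sub, neg_neg]
  rw [h2, norm_neg, zero_add]
  have h3 : ‖toeplitz a (toeplitz p (mono n)) - mono n‖ ≤ ε / (‖g‖ + 1) := by
    refine le_trans (le_of_eq ?_) ((norm_mulOp_mulOp_sub_le p a n).trans hpa.le)
    have h4 : ((toeplitz a (toeplitz p (mono n)) - mono n : hardyTwo) : LTwo) =
        mulOp a (mulOp p (fourierLp 2 n)) - fourierLp 2 n := by
      rw [Submodule.coe_sub, ha.toeplitz_coe, hp.toeplitz_coe]; rfl
    rw [hnorm_coe, h4]
  refine (norm_inner_le_norm (𝕜 := ℂ) (E := hardyTwo) _ _).trans ?_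
  calc _ ≤ (ε / (‖g‖ + 1)) * ‖g‖ := by gcongr
    _ ≤ ε := by
        rw [div_mul_eq_mul_div, div_le_iff₀ (by positivity)]
        nlinarith [norm_nonneg g]

theorem inner_mulOp_add {a b : LInf} (h : ∀ᵐ t ∂arc, ‖a t‖ ^ 2 + ‖b t‖ ^ 2 = 1) (f : LTwo) :
    mulOp (star b) (mulOp b f) + mulOp (star a) (mulOp a f) = f := by
  refine Lp.ext ?_
  filter_upwards [Lp.coeFn_add (mulOp (star b) (mulOp b f)) (mulOp (star a) (mulOp a f)),
    coeFn_mulOp (star b) (mulOp b f), coeFn_mulOp b f, coeFn_mulOp (star a) (mulOp a f),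
    coeFn_mulOp a f, Lp.coeFn_star b, Lp.coeFn_star a, h] with t h1 h2 h3 h4 h5 h6 h7 h8
  rw [h1, Pi.add_apply, h2, h3, h4, h5, h6, h7]
  have h9 : (conj (a t) * a t + conj (b t) * b t : ℂ) = 1 := by
    rw [Complex.conj_mul', Complex.conj_mul']
    exact_mod_cast h8
  simp only [Pi.star_apply, RCLike.star_def]
  linear_combination f t * h9

theorem IsPair.defectData {b a : LInf} (h : IsPair b a) (hb : AnalyticSymbol b) (hb1 : ‖b‖ ≤ 1) :
    DefectData (toeplitz b) (toeplitz a) (defectSqrt b) where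
  isometry f g := by
    have ha : AnalyticSymbol a := h.analytic
    rw [Submodule.coe_inner, Submodule.coe_inner, Submodule.coe_inner, hb.toeplitz_coe,
      hb.toeplitz_coe, ha.toeplitz_coe, ha.toeplitz_coe, ← inner_mulOp_left, ← inner_mulOp_left,
      ← inner_add_left, inner_mulOp_add h.sq_add_sq]
  injective g hg := toeplitz_star_injective_of_outer h.analytic h.outer (by rwa [toeplitz_star])
  selfAdjoint := defectSqrt_inner b
  sq f := by rw [← toeplitz_star]; exact defectSqrt_sq hb1 f

/-- The space of pairs `(f, f⁺)` with `T_{b̄} f = T_{ā} f⁺`. -/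
abbrev pairGraph (b a : LInf) : Submodule ℂ (WithLp 2 (hardyTwo × hardyTwo)) :=
  graphSpace (toeplitz b) (toeplitz a)

theorem mem_pairGraph {b a : LInf} {x : WithLp 2 (hardyTwo × hardyTwo)} :
    x ∈ pairGraph b a ↔ toeplitz (star b) x.fst = toeplitz (star a) x.snd := by
  rw [toeplitz_star, toeplitz_star]; exact mem_graphSpace

/-- The kernel `(k_w, conj (b/a)(w) k_w)`. -/
def pairKer (b a : LInf) (w : ℂ) : WithLp 2 (hardyTwo × hardyTwo) :=
  WithLp.toLp 2 (cauchyKer w, conj (ext b w / ext a w) • cauchyKer w)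

theorem IsPair.pairKer_mem {b a : LInf} (h : IsPair b a) (hb : AnalyticSymbol b) {w : ℂ}
    (hw : w ∈ disc) : pairKer b a w ∈ pairGraph b a := by
  rw [mem_pairGraph]
  change toeplitz (star b) (cauchyKer w) = toeplitz (star a) (conj (ext b w / ext a w) • cauchyKer w)
  rw [map_smul, hb.toeplitz_star_cauchyKer hw, AnalyticSymbol.toeplitz_star_cauchyKer h.analytic hw,
    smul_smul, ← map_mul, div_mul_cancel₀ _ (h.ext_ne_zero hw)]

theorem inner_pairKer (b a : LInf) {w : ℂ} (hw : w ∈ disc) (x : WithLp 2 (hardyTwo × hardyTwo)) :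
    inner ℂ (pairKer b a w) x = hext x.fst w + ext b w / ext a w * hext x.snd w := by
  have h1 : inner ℂ (pairKer b a w) x = inner ℂ (cauchyKer w) x.fst +
      inner ℂ (conj (ext b w / ext a w) • cauchyKer w) x.snd := WithLp.prod_inner_apply _ _
  rw [h1, hinner_smul_left, Complex.conj_conj, ← hext_eq_inner hw, ← hext_eq_inner hw]

/-- Orthogonality to the kernels means `a f + b g = 0`. With `|a|² + |b|² = 1` this gives `(f, g) =
(-b k, a k)` on the circle for `k = ā g - b̄ f`. As `a` is outer and `a k = g` is in `H²`, so is
`k`; but the graph relation says that `P₊ k = 0`. -/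
theorem IsPair.eq_zero_of_orthogonal {b a : LInf} (h : IsPair b a) (hb : AnalyticSymbol b)
    {x : WithLp 2 (hardyTwo × hardyTwo)} (hx : x ∈ pairGraph b a)
    (hk : ∀ w ∈ disc, inner ℂ (pairKer b a w) x = 0) : x = 0 := by
  have ha : AnalyticSymbol a := h.analytic
  have h1 : toeplitz a x.fst + toeplitz b x.snd = 0 := by
    refine hext_injective fun w hw => ?_
    have h2 := hk w hw
    rw [inner_pairKer b a hw] at h2
    have h3 := h.ext_ne_zero hw
    rw [hext_add _ _ hw, ha.hext_toeplitz _ hw, hb.hext_toeplitz _ hw]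
    have h4 : hext (0 : hardyTwo) w = 0 := by
      rw [hext_eq_inner hw]; exact inner_zero_right (𝕜 := ℂ) (E := hardyTwo) _
    rw [h4]
    field_simp at h2
    linear_combination h2
  have h2 : mulOp a (x.fst : LTwo) + mulOp b (x.snd : LTwo) = 0 := by
    rw [← ha.toeplitz_coe, ← hb.toeplitz_coe, ← Submodule.coe_add, h1]; rfl
  set k : LTwo := mulOp (star a) (x.snd : LTwo) - mulOp (star b) (x.fst : LTwo) with hkdef
  have hboundary : ∀ᵐ t ∂arc, a t * k t = (x.snd : LTwo) t ∧ b t * k t = -(x.fst : LTwo) t := by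
    have h3 := h2 ▸ Lp.coeFn_zero ℂ 2 arc
    filter_upwards [h3, Lp.coeFn_add (mulOp a (x.fst : LTwo)) (mulOp b (x.snd : LTwo)),
      coeFn_mulOp a (x.fst : LTwo), coeFn_mulOp b (x.snd : LTwo),
      Lp.coeFn_sub (mulOp (star a) (x.snd : LTwo)) (mulOp (star b) (x.fst : LTwo)),
      coeFn_mulOp (star a) (x.snd : LTwo), coeFn_mulOp (star b) (x.fst : LTwo), Lp.coeFn_star a,
      Lp.coeFn_star b, h.sq_add_sq] with t e0 e1 e2 e3 e4 e5 e6 e7 e8 e9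
    have e10 : (conj (a t) * a t + conj (b t) * b t : ℂ) = 1 := by
      rw [Complex.conj_mul', Complex.conj_mul']
      exact_mod_cast e9
    rw [e0, Pi.add_apply, e2, e3, Pi.zero_apply] at e1
    rw [← hkdef] at e4
    rw [e4, Pi.sub_apply, e5, e6, e7, e8]
    simp only [Pi.star_apply, RCLike.star_def]
    constructor
    · linear_combination (x.snd : LTwo) t * e10 + conj (b t) * e1
    · linear_combination (-(x.fst : LTwo) t) * e10 - conj (a t) * e1
  have hak : mulOp a k = (x.snd : LTwo) := by
    refine Lp.ext ?_
    filter_upwards [coeFn_mulOp a k, hboundary] with t e1 e2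
    rw [e1, e2.1]
  have hkm : k ∈ hardyTwo := mem_hardyTwo_of_mulOp_outer ha h.outer (by rw [hak]; exact x.snd.2)
  have hP : hardyTwo.orthogonalProjectionOnto k = 0 := by
    rw [hkdef, map_sub, sub_eq_zero]
    exact (mem_pairGraph.1 hx).symm
  have hk0 : k = 0 := by
    have := hardyTwo.orthogonalProjectionOnto_mem_subspace_eq_self ⟨k, hkm⟩
    rw [hP] at this
    exact (congrArg Subtype.val this).symm
  have hs : x.snd = 0 := by
    apply Subtype.ext
    rw [← hak, hk0, map_zero]; rfl
  have hf : x.fst = 0 := by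
    apply Subtype.ext
    refine Lp.ext ?_
    have h3 := hk0 ▸ Lp.coeFn_zero ℂ 2 arc
    filter_upwards [hboundary, h3, Lp.coeFn_zero ℂ 2 arc] with t e1 e2 e3
    have e4 := e1.2
    rw [e2, Pi.zero_apply, mul_zero, eq_comm, neg_eq_zero] at e4
    rw [e4]; exact e3.symm
  exact WithLp.ofLp_injective 2 (Prod.ext hf hs)

theorem IsPair.closure_span_pairKer {b a : LInf} (h : IsPair b a) (hb : AnalyticSymbol b) :
    (Submodule.span ℂ (range fun w : disc => pairKer b a w)).topologicalClosure =
      pairGraph b a := by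
  set V := (Submodule.span ℂ (range fun w : disc => pairKer b a w)).topologicalClosure with hV
  have hVle : V ≤ pairGraph b a := by
    refine Submodule.topologicalClosure_minimal _ ?_ (isClosed_graphSpace _ _)
    rw [Submodule.span_le]
    rintro _ ⟨w, rfl⟩
    exact h.pairKer_mem hb w.2
  refine le_antisymm hVle fun x hx => ?_
  have : CompleteSpace V := (Submodule.isClosed_topologicalClosure _).completeSpace_coe
  obtain ⟨y, hy, z, hz, rfl⟩ := V.exists_add_mem_mem_orthogonal x
  have hzg : z ∈ pairGraph b a := by
    have := Submodule.sub_mem _ hx (hVle hy)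
    rwa [add_sub_cancel_left] at this
  rw [h.eq_zero_of_orthogonal hb hzg fun w hw =>
    hz _ (Submodule.le_topologicalClosure _ (Submodule.subset_span ⟨⟨w, hw⟩, rfl⟩)), add_zero]
  exact hy

/-! ### Shifts and inner functions -/

theorem exists_shift_symbol : ∃ Z : LInf, AnalyticSymbol Z ∧ (∀ᵐ t ∂arc, Z t = t.toCircle) ∧
    (∀ z ∈ disc, ext Z z = z) := by
  obtain ⟨Z, hZ, -⟩ := exists_LInf (f := fun t : UnitAddCircle => (t.toCircle : ℂ)) (C := 1)
    (Continuous.aestronglyMeasurable (by fun_prop)) zero_le_one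
    (Eventually.of_forall fun t => (norm_toCircle t).le)
  have h1 : toTwo Z = (mono 1 : LTwo) := by
    refine Lp.ext ?_
    filter_upwards [coeFn_toTwo Z, hZ, coeFn_fourierLp (T := 1) 2 ((1 : ℕ) : ℤ)] with t e1 e2 e3
    have e4 : (mono 1 : LTwo) t = fourier ((1 : ℕ) : ℤ) t := e3
    rw [e1, e2, e4, ← toCircle_pow, pow_one]
  have hZa : AnalyticSymbol Z := fun n hn => by
    rw [← fourierCoeff_toTwo, h1]; exact (mono 1).2 n hn
  refine ⟨Z, hZa, hZ, fun z hz => ?_⟩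
  rw [← hZa.hext_toHardy, show hZa.toHardy = mono 1 from Subtype.ext h1, hext_mono 1 hz, pow_one]

theorem toeplitz_of_mul {b c d : LInf} (hb : AnalyticSymbol b) (hc : AnalyticSymbol c)
    (hd : d =ᵐ[arc] fun t => b t * c t) (g : hardyTwo) :
    toeplitz d g = toeplitz b (toeplitz c g) := by
  refine hext_injective fun z hz => ?_
  rw [(hb.of_mul hc hd).hext_toeplitz _ hz, hb.hext_toeplitz _ hz, hc.hext_toeplitz _ hz,
    ext_of_mul hb hc hd hz, mul_assoc]

theorem inner_toeplitz_toeplitz {i : LInf} (hi : AnalyticSymbol i) (h1 : ∀ᵐ t ∂arc, ‖i t‖ = 1)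
    (f g : hardyTwo) : inner ℂ (toeplitz i f) (toeplitz i g) = inner ℂ f g := by
  rw [Submodule.coe_inner, Submodule.coe_inner, hi.toeplitz_coe, hi.toeplitz_coe,
    ← inner_mulOp_left]
  congr 1
  refine Lp.ext ?_
  filter_upwards [coeFn_mulOp (star i) (mulOp i f), coeFn_mulOp i f, Lp.coeFn_star i, h1]
    with t e1 e2 e3 e4
  rw [e1, e2, e3, Pi.star_apply, RCLike.star_def, ← mul_assoc, Complex.conj_mul', e4]
  simp

theorem toeplitz_mono_zero {i : LInf} (hi : AnalyticSymbol i) : toeplitz i (mono 0) = hi.toHardy := by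
  refine hext_injective fun z hz => ?_
  rw [hi.hext_toeplitz _ hz, hext_mono 0 hz, pow_zero, mul_one, hi.hext_toHardy]

/-- A bounded analytic function vanishing at the origin is divisible by `z`. -/
theorem exists_div_shift {b : LInf} (hb : AnalyticSymbol b) (h0 : ext b 0 = 0) :
    ∃ (Z b₁ : LInf), AnalyticSymbol Z ∧ (∀ᵐ t ∂arc, ‖Z t‖ = 1) ∧ (∀ z ∈ disc, ext Z z = z) ∧
      AnalyticSymbol b₁ ∧ ‖b₁‖ ≤ ‖b‖ ∧ b =ᵐ[arc] fun t => Z t * b₁ t := by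
  obtain ⟨Z, hZ, hZt, hZe⟩ := exists_shift_symbol
  have hZ1 : ∀ᵐ t ∂arc, ‖Z t‖ = 1 := hZt.mono fun t ht => by rw [ht, norm_toCircle]
  obtain ⟨b₁, hb₁⟩ := exists_mul (star Z) b
  have hb₁' : ∀ᵐ t ∂arc, b₁ t = fourier (-1) t * b t := by
    filter_upwards [hb₁, Lp.coeFn_star Z, hZt] with t e1 e2 e3
    rw [e1, e2, Pi.star_apply, e3, RCLike.star_def, fourier_neg, fourier_one]
  refine ⟨Z, b₁, hZ, hZ1, hZe, fun n hn => ?_, LInf_norm_le (norm_nonneg _) ?_, ?_⟩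
  · have h1 : fourierCoeff (b₁ : UnitAddCircle → ℂ) n = fourierCoeff (b : UnitAddCircle → ℂ) (n + 1) := by
      simp only [fourierCoeff]
      refine integral_congr_ae ?_
      filter_upwards [hb₁'] with t e1
      rw [e1, neg_add, fourier_add, smul_eq_mul, smul_eq_mul, mul_assoc]
    rw [h1]
    rcases (show n + 1 ≤ 0 by omega).eq_or_lt with h2 | h2
    · rw [h2]
      have h3 := hext_zero_eq hb.toHardy
      rw [hb.hext_toHardy, h0, inner_mono] at h3
      rw [← fourierCoeff_toTwo]
      exact h3.symm
    · exact hb _ h2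
  · filter_upwards [hb₁', ae_norm_le b] with t e1 e2
    have h' : ‖(fourier (-1) t : ℂ)‖ = 1 := by rw [fourier_apply]; exact norm_toCircle _
    rwa [e1, norm_mul, h', one_mul]
  · filter_upwards [hb₁, Lp.coeFn_star Z, hZ1] with t e1 e2 e3
    rw [e1, e2, Pi.star_apply, RCLike.star_def, ← mul_assoc, Complex.mul_conj', e3]
    simp

/-! ### Weighted Dirichlet spaces which are de Branges--Rovnyak spaces -/

theorem exists_defect_preimage {b : LInf} {h : hardyTwo} (hh : h ∈ deBranges b) :
    ∃ x ∈ (LinearMap.ker (defectSqrt b : hardyTwo →ₗ[ℂ] hardyTwo))ᗮ, defectSqrt b x = h := by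
  obtain ⟨g, rfl⟩ := hh
  set K := LinearMap.ker (defectSqrt b : hardyTwo →ₗ[ℂ] hardyTwo) with hK
  have : CompleteSpace K :=
    (ContinuousLinearMap.isClosed_ker (defectSqrt b)).completeSpace_coe
  obtain ⟨y, hy, x, hx, rfl⟩ := K.exists_add_mem_mem_orthogonal g
  have hy0 : defectSqrt b y = 0 := hy
  refine ⟨x, hx, ?_⟩
  change defectSqrt b x = defectSqrt b (y + x)
  rw [map_add, hy0, zero_add]

theorem norm_defectSqrt_sq {b : LInf} (hb1 : ‖b‖ ≤ 1) (f : hardyTwo) :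
    ‖defectSqrt b f‖ ^ 2 = ‖f‖ ^ 2 - ‖toeplitz (star b) f‖ ^ 2 := by
  have h1 : (inner ℂ (defectSqrt b f) (defectSqrt b f) : ℂ) =
      inner ℂ f f - inner ℂ (toeplitz (star b) f) (toeplitz (star b) f) := by
    rw [defectSqrt_inner, defectSqrt_sq hb1, hinner_sub_right, inner_toeplitz_star]
  have h2 := congrArg RCLike.re h1
  rw [map_sub] at h2
  rwa [inner_self_eq_norm_sq (𝕜 := ℂ) (E := hardyTwo), inner_self_eq_norm_sq (𝕜 := ℂ) (E := hardyTwo),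
    inner_self_eq_norm_sq (𝕜 := ℂ) (E := hardyTwo)] at h2

variable {b : LInf}

/-- A vector killed by `T_{b̄}` is fixed by `defectSqrt b`, so it lies in the range, hence in
`(ker)ᗮ`, and its `ℋ(b)` norm is its `H²` norm. Nothing is left for the energy. -/
theorem DirichletEqDeBranges.hext_eq_const (hE : DirichletEqDeBranges ω b) (hω : IsWeight ω)
    (hb1 : ‖b‖ ≤ 1) {g : hardyTwo} (hg : toeplitz (star b) g = 0) {z : ℂ} (hz : z ∈ disc) :
    hext g z = hext g 0 := by
  refine hω.hext_eq_const ?_ hz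
  have hS := defectSqrt_eq_self hb1 hg
  have h1 := hE.2 g (by rw [← hS]; exact range_defectSqrt_le b g)
  rw [hS] at h1
  change dirichletNormSq ω (hext g) = _ at h1
  rw [dirichletNormSq, hardyNormSq_hext] at h1
  refine (ENNReal.add_right_inj (a := ‖g‖ₑ ^ 2) (by finiteness)).1 ?_
  rw [h1, add_zero]

theorem DirichletEqDeBranges.exists_preimage (hE : DirichletEqDeBranges ω b) (hω : IsWeight ω)
    {y : DirPair ω} (hy : y ∈ dirGraph ω) :
    ∃ x ∈ (LinearMap.ker (defectSqrt b : hardyTwo →ₗ[ℂ] hardyTwo))ᗮ,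
      defectSqrt b x = y.fst ∧ ‖x‖ = ‖y‖ := by
  obtain ⟨h, hh, hyh⟩ := (hE.1 _).1 (hω.hext_mem_dirichletSpace hy)
  obtain ⟨x, hx, rfl⟩ := exists_defect_preimage hh
  have h1 : y.fst = defectSqrt b x := hext_injective hyh
  refine ⟨x, hx, h1.symm, ?_⟩
  have h2 := hE.2 x hx
  change dirichletNormSq ω (hext (defectSqrt b x)) = _ at h2
  rw [← h1, hω.dirichletNormSq_eq hy, enorm_sq_eq, enorm_sq_eq,
    ENNReal.ofReal_eq_ofReal_iff (by positivity) (by positivity)] at h2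
  exact ((sq_eq_sq₀ (norm_nonneg _) (norm_nonneg _)).1 h2).symm

/-- The normalization of `ω` is what gives `z` the squared norm 2; it later yields `|c| = 1`. -/
theorem norm_dvec_sq (hω : IsWeight ω) : ‖dvec hω 0‖ ^ 2 = 1 ∧ ‖dvec hω 1‖ ^ 2 = 2 := by
  have h0 : ‖(dvec hω 0).fst‖ = 1 := norm_mono 0
  have h1 : ‖(dvec hω 1).fst‖ = 1 := norm_mono 1
  have h2 : ‖(dvec hω 0).snd‖ ≤ (0 : ℕ) := norm_dmono_le hω 0
  have h3 : ‖(dvec hω 1).snd‖ ^ 2 = 1 := by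
    have := congrArg Complex.re (inner_dmono_one_one hω)
    rw [← RCLike.re_to_complex, inner_self_eq_norm_sq] at this
    exact this
  have h4 : ‖(dvec hω 0).snd‖ = 0 := le_antisymm (by simpa using h2) (norm_nonneg _)
  rw [dirPair_norm_sq, dirPair_norm_sq, h0, h1, h3, h4]
  norm_num

/-- Write `1 = S x` with `‖x‖ = 1`. Then `‖S x‖² = ‖x‖² - ‖T_{b̄} x‖²` forces `T_{b̄} x = 0`, and
then `S x = x`. -/
theorem DirichletEqDeBranges.toeplitz_star_one (hE : DirichletEqDeBranges ω b) (hω : IsWeight ω)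
    (hb1 : ‖b‖ ≤ 1) : toeplitz (star b) (mono 0) = 0 := by
  obtain ⟨x, hx, hSx, hn⟩ := hE.exists_preimage hω (dvec_mem hω 0)
  have hSx' : defectSqrt b x = mono 0 := hSx
  have h1 := norm_defectSqrt_sq hb1 x
  rw [hSx', norm_mono, hn, (norm_dvec_sq hω).1] at h1
  have h2 : toeplitz (star b) x = 0 := by
    have : ‖toeplitz (star b) x‖ ^ 2 = 0 := by linarith
    exact norm_eq_zero.1 (pow_eq_zero_iff two_ne_zero |>.1 this)
  rw [← hSx', defectSqrt_eq_self hb1 h2, h2]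

theorem DirichletEqDeBranges.ext_zero (hE : DirichletEqDeBranges ω b) (hω : IsWeight ω)
    (hb : AnalyticSymbol b) (hb1 : ‖b‖ ≤ 1) : ext b 0 = 0 := by
  have h1 := inner_toeplitz_star b (mono 0) (mono 0)
  rw [hE.toeplitz_star_one hω hb1, inner_zero_left (𝕜 := ℂ) (E := hardyTwo), ← hext_zero_eq,
    hb.hext_toeplitz _ zero_mem_disc, hext_mono 0 zero_mem_disc] at h1
  simpa using h1.symm

theorem inner_mono_one_toeplitz {Z b₁ : LInf} (hZ : AnalyticSymbol Z) (hZ1 : ∀ᵐ t ∂arc, ‖Z t‖ = 1)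
    (hZe : ∀ z ∈ disc, ext Z z = z) (hb₁ : AnalyticSymbol b₁)
    (hbZ : b =ᵐ[arc] fun t => Z t * b₁ t) (g : hardyTwo) :
    inner ℂ (mono 1) (toeplitz b g) = ext b₁ 0 * hext g 0 := by
  have h1 : toeplitz Z (mono 0) = mono 1 := by
    refine hext_injective fun z hz => ?_
    rw [hZ.hext_toeplitz _ hz, hZe z hz, hext_mono 0 hz, hext_mono 1 hz, pow_zero, pow_one, mul_one]
  rw [toeplitz_of_mul hZ hb₁ hbZ, ← h1, inner_toeplitz_toeplitz hZ hZ1, ← hext_zero_eq,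
    hb₁.hext_toeplitz _ zero_mem_disc]

/-- Expand `‖h - T_{b̄} T_b h‖² ≥ 0`. -/
theorem norm_defectSqrt_toeplitz_le (hb1 : ‖b‖ ≤ 1) (h : hardyTwo) :
    ‖defectSqrt b (toeplitz b h)‖ ^ 2 ≤ ‖h‖ ^ 2 - ‖toeplitz b h‖ ^ 2 := by
  have h1 := norm_sub_sq (𝕜 := ℂ) (E := hardyTwo) h (toeplitz (star b) (toeplitz b h))
  have h2 : (inner ℂ h (toeplitz (star b) (toeplitz b h)) : ℂ) =
      conj (inner ℂ (toeplitz b h) (toeplitz b h)) := by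
    rw [← inner_conj_symm (𝕜 := ℂ) (E := hardyTwo), inner_toeplitz_star]
  rw [h2, RCLike.conj_re, inner_self_eq_norm_sq (𝕜 := ℂ) (E := hardyTwo)] at h1
  rw [norm_defectSqrt_sq hb1]
  nlinarith [sq_nonneg ‖h - toeplitz (star b) (toeplitz b h)‖]

/-- The structure of `b` when `𝒟_ω = ℋ(b)`. -/
theorem DirichletEqDeBranges.exists_factor (hE : DirichletEqDeBranges ω b) (hω : IsWeight ω)
    (hb : AnalyticSymbol b) (hb1 : ‖b‖ ≤ 1) :
    ∃ b₁ : LInf, AnalyticSymbol b₁ ∧ (∀ z ∈ disc, ext b z = z * ext b₁ z) ∧ ext b₁ 0 ≠ 0 ∧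
      (∀ g, inner ℂ (mono 1) (toeplitz b g) = ext b₁ 0 * hext g 0) ∧
      ∃ (c : ℂ) (u : UnitAddCircle → ℝ), ‖c‖ = 1 ∧ Integrable u arc ∧
        ∀ z ∈ disc, ext b₁ z = c * outerFn u z := by
  obtain ⟨Z, b₁, hZ, hZ1, hZe, hb₁, hb₁n, hbZ⟩ := exists_div_shift hb (hE.ext_zero hω hb hb1)
  have hin := inner_mono_one_toeplitz hZ hZ1 hZe hb₁ hbZ
  have h0 : ext b₁ 0 ≠ 0 := by
    intro h0
    -- A double zero at the origin would make `T_{b̄}` kill `z`, which is not constant.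
    have h1 : toeplitz (star b) (mono 1) = 0 := hardy_ext_inner_left fun q => by
      rw [inner_toeplitz_star, hin, h0, zero_mul, inner_zero_left (𝕜 := ℂ) (E := hardyTwo)]
    have h2 : (1 / 2 : ℂ) ∈ disc := mem_disc.2 (by norm_num)
    have h3 := hE.hext_eq_const hω hb1 h1 h2
    rw [hext_mono 1 h2, hext_mono 1 zero_mem_disc] at h3
    norm_num at h3
  refine ⟨b₁, hb₁, fun z hz => by rw [ext_of_mul hZ hb₁ hbZ hz, hZe z hz], h0, hin, ?_⟩
  obtain ⟨i, f, u, hi, hf, hu, hfe, hi1, hif⟩ := exists_inner_outer hb₁ (hb₁n.trans hb1) h0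
  -- The inner factor `i` of `b₁` is killed as well: `⟨i, i z f q⟩ = ⟨1, z f q⟩ = 0`. Hence `i` is
  -- constant and `b₁` is outer.
  have hTi : toeplitz (star b) hi.toHardy = 0 := hardy_ext_inner_left fun q => by
    rw [inner_toeplitz_star, inner_zero_left (𝕜 := ℂ) (E := hardyTwo), ← toeplitz_mono_zero hi]
    have h1 : toeplitz b q = toeplitz i (toeplitz Z (toeplitz f q)) := by
      refine hext_injective fun z hz => ?_
      rw [hb.hext_toeplitz _ hz, hi.hext_toeplitz _ hz, hZ.hext_toeplitz _ hz,
        hf.hext_toeplitz _ hz, ext_of_mul hZ hb₁ hbZ hz, ext_of_mul hi hf hif hz]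
      ring
    rw [h1, inner_toeplitz_toeplitz hi hi1, ← hext_zero_eq, hZ.hext_toeplitz _ zero_mem_disc,
      hZe 0 zero_mem_disc, zero_mul]
  have hconst : ∀ z ∈ disc, ext i z = ext i 0 := fun z hz => by
    have := hE.hext_eq_const hω hb1 hTi hz
    rwa [hi.hext_toHardy] at this
  refine ⟨ext i 0, u, ?_, hu, fun z hz => by rw [ext_of_mul hi hf hif hz, hconst z hz, hfe z hz]⟩
  have h1 : hi.toHardy = ext i 0 • mono 0 := by
    refine hext_injective fun z hz => ?_
    rw [hext_smul _ _ hz, hext_mono 0 hz, hi.hext_toHardy, hconst z hz, pow_zero, mul_one]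
  have h2 : ‖hi.toHardy‖ = ‖ext i 0‖ := by rw [h1, hnorm_smul, norm_mono, mul_one]
  have h3 : ‖hi.toHardy‖ = 1 := by
    have h4 := inner_toeplitz_toeplitz hi hi1 (mono 0) (mono 0)
    rw [toeplitz_mono_zero hi, inner_mono_mono, if_pos rfl] at h4
    have h5 := congrArg RCLike.re h4
    rw [inner_self_eq_norm_sq (𝕜 := ℂ) (E := hardyTwo), RCLike.one_re] at h5
    exact (pow_eq_one_iff_of_nonneg (norm_nonneg _) two_ne_zero).1 h5
  rw [← h2, h3]

/-- With `z = S x` and `‖x‖² = 2`, Cauchy–Schwarz in `⟨z, b h⟩ = ⟨x, S(b h)⟩` gives `|b₁(0) h(0)|² ≤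
2(‖h‖² - ‖b h‖²)`, which is the Szegő bound with `κ = |b₁(0)|²/2`. -/
theorem DirichletEqDeBranges.exists_isPair (hE : DirichletEqDeBranges ω b) (hω : IsWeight ω)
    (hb : AnalyticSymbol b) (hb1 : ‖b‖ ≤ 1) : ∃ a : LInf, IsPair b a := by
  obtain ⟨b₁, -, -, h0, hin, -⟩ := hE.exists_factor hω hb hb1
  obtain ⟨x, hx, hSx, hn⟩ := hE.exists_preimage hω (dvec_mem hω 1)
  have hSx' : defectSqrt b x = mono 1 := hSx
  have hx2 : ‖x‖ ^ 2 = 2 := by rw [hn, (norm_dvec_sq hω).2]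
  obtain ⟨h1, h2⟩ := integrable_log_of_szego hb hb1 (κ := ‖ext b₁ 0‖ ^ 2 / 2)
    (by have := norm_pos_iff.2 h0; positivity) fun h => by
      have e1 : ‖ext b₁ 0 * hext h 0‖ ≤ ‖x‖ * ‖defectSqrt b (toeplitz b h)‖ := by
        rw [← hin, ← hSx', defectSqrt_inner]
        exact norm_inner_le_norm (𝕜 := ℂ) (E := hardyTwo) _ _
      have e2 := pow_le_pow_left₀ (norm_nonneg _) e1 2
      rw [norm_mul, mul_pow, mul_pow, hx2] at e2
      have e3 := norm_defectSqrt_toeplitz_le hb1 h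
      nlinarith
  exact WeightedDirichlet.exists_isPair h1 h2

/-! ### Comparison of the two graph spaces -/

theorem dirGraph_ext {x y : DirPair ω} (hx : x ∈ dirGraph ω) (hy : y ∈ dirGraph ω)
    (h : x.fst = y.fst) : x = y := by
  refine WithLp.ofLp_injective 2 (Prod.ext h (Lp.ext ?_))
  have h1 := mem_dirGraph.1 hx
  rw [h] at h1
  exact h1.trans (mem_dirGraph.1 hy).symm

/-- Both norms are the `ℋ(b)` norm of the common first coordinate. Polarization then equates inner
products, in particular the Gram matrices of the kernels. -/
theorem norm_eq_of_fst_eq (hE : DirichletEqDeBranges ω b) (hω : IsWeight ω)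
    (hb : AnalyticSymbol b) (hb1 : ‖b‖ ≤ 1) {a : LInf} (ha : IsPair b a) {y : DirPair ω}
    (hy : y ∈ dirGraph ω) {x : WithLp 2 (hardyTwo × hardyTwo)} (hx : x ∈ pairGraph b a)
    (h : y.fst = x.fst) : ‖y‖ = ‖x‖ := by
  obtain ⟨g, hg, hSg, hn⟩ := (ha.defectData hb hb1).exists_range hx
  have h1 := hE.2 g hg
  change dirichletNormSq ω (hext (defectSqrt b g)) = _ at h1
  rw [hSg, ← h, hω.dirichletNormSq_eq hy, enorm_sq_eq, enorm_sq_eq,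
    ENNReal.ofReal_eq_ofReal_iff (by positivity) (by positivity)] at h1
  rw [← hn]
  exact (sq_eq_sq₀ (norm_nonneg _) (norm_nonneg _)).1 h1

theorem inner_eq_of_norm_eq {X Y : Type*} [NormedAddCommGroup X] [InnerProductSpace ℂ X]
    [NormedAddCommGroup Y] [InnerProductSpace ℂ Y] {x x' : X} {y y' : Y}
    (key : ∀ c : ℂ, ‖y + c • y'‖ = ‖x + c • x'‖) : inner ℂ y y' = inner ℂ x x' := by
  have e1 := key 1
  have e2 := key (-1)
  have e3 := key Complex.I
  have e4 := key (-Complex.I)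
  simp only [one_smul, neg_smul, ← sub_eq_add_neg] at e1 e2 e3 e4
  rw [inner_eq_sum_norm_sq_div_four (𝕜 := ℂ) y y', inner_eq_sum_norm_sq_div_four (𝕜 := ℂ) x x']
  simp only [RCLike.I_to_complex, e1, e2, e3, e4]

theorem inner_eq_of_fst_eq (hE : DirichletEqDeBranges ω b) (hω : IsWeight ω)
    (hb : AnalyticSymbol b) (hb1 : ‖b‖ ≤ 1) {a : LInf} (ha : IsPair b a) {y y' : DirPair ω}
    (hy : y ∈ dirGraph ω) (hy' : y' ∈ dirGraph ω) {x x' : WithLp 2 (hardyTwo × hardyTwo)}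
    (hx : x ∈ pairGraph b a) (hx' : x' ∈ pairGraph b a)
    (h : y.fst = x.fst) (h' : y'.fst = x'.fst) : inner ℂ y y' = inner ℂ x x' := by
  have key : ∀ c : ℂ, ‖y + c • y'‖ = ‖x + c • x'‖ := fun c =>
    norm_eq_of_fst_eq hE hω hb hb1 ha (Submodule.add_mem _ hy (Submodule.smul_mem _ c hy'))
      (Submodule.add_mem _ hx (Submodule.smul_mem _ c hx'))
      (by rw [WithLp.add_fst, WithLp.add_fst, WithLp.smul_fst, WithLp.smul_fst, h, h'])
  exact inner_eq_of_norm_eq key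

theorem DirichletEqDeBranges.gram (hE : DirichletEqDeBranges ω b) (hω : IsWeight ω)
    (hb : AnalyticSymbol b) (hb1 : ‖b‖ ≤ 1) {a : LInf} (ha : IsPair b a) {v w : ℂ} (hv : v ∈ disc)
    (hw : w ∈ disc) : inner ℂ (kerSum (dvec hω) v) (kerSum (dvec hω) w) =
      inner ℂ (pairKer b a v) (pairKer b a w) :=
  inner_eq_of_fst_eq hE hω hb hb1 ha (kerSum_dvec_mem hω hv) (kerSum_dvec_mem hω hw)
    (ha.pairKer_mem hb hv) (ha.pairKer_mem hb hw) (by rw [kerSum_dvec hω hv]; rfl)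
    (by rw [kerSum_dvec hω hw]; rfl)

/-- The kernels are dense in `pairGraph`, so the isometry produces a pair in the closed span of the
polynomials with the same first coordinate; its second coordinate is then the same derivative. -/
theorem DirichletEqDeBranges.dirGraph_le (hE : DirichletEqDeBranges ω b) (hω : IsWeight ω)
    (hb : AnalyticSymbol b) (hb1 : ‖b‖ ≤ 1) :
    dirGraph ω ≤ (Submodule.span ℂ (range (dvec hω))).topologicalClosure := by
  intro y hy
  obtain ⟨a, ha⟩ := hE.exists_isPair hω hb hb1
  obtain ⟨g, hg, hSg, -⟩ := hE.exists_preimage hω hy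
  obtain ⟨x, hx, hxg, -⟩ := (ha.defectData hb hb1).exists_graph hg
  have hx : x ∈ pairGraph b a := hx
  rw [← ha.closure_span_pairKer hb] at hx
  obtain ⟨y', hy', h1, -⟩ := exists_mem_closure_of_gram (κ := fun w : disc => pairKer b a w)
    (ε := fun w : disc => kerSum (dvec hω) w)
    (fun v w => (hE.gram hω hb hb1 ha v.2 w.2).symm) (fstL _ _) (fstL _ _)
    (fun w => by rw [fstL_apply, fstL_apply, kerSum_dvec hω w.2]; rfl) hx
  rw [← image_eq_range (kerSum (dvec hω)) disc, closure_span_kerSum (norm_dvec_le hω)] at hy'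
  have h2 : y' ∈ dirGraph ω :=
    Submodule.topologicalClosure_minimal _ (span_dvec_le hω) (isClosed_dirGraph ω) hy'
  rw [dirGraph_ext hy h2 (by rw [← hSg, ← hxg]; exact h1)]
  exact hy'

theorem DirichletEqDeBranges.subset_hardySpace (hE : DirichletEqDeBranges ω b) :
    dirichletSpace ω ⊆ hardySpace := by
  intro f hf
  obtain ⟨h, -, hfh⟩ := (hE.1 f).1 hf
  refine ⟨hf.1, ?_⟩
  rw [hardyNormSq_congr (g := hext h) hfh]
  exact (hext_mem_hardySpace h).2

theorem DirichletEqDeBranges.polynomialsDense (hE : DirichletEqDeBranges ω b) (hω : IsWeight ω)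
    (hb : AnalyticSymbol b) (hb1 : ‖b‖ ≤ 1) : PolynomialsDense ω :=
  polynomialsDense_of_le hω (fun _ hf => hω.exists_dirGraph_eqOn hE.subset_hardySpace hf)
    (hE.dirGraph_le hω hb hb1)

/-! ### Gram matrices of the kernels -/

theorem inner_kerSum_dvec (hω : IsWeight ω) {w : ℂ} (hw : w ∈ disc) (x : DirPair ω) :
    inner ℂ (kerSum (dvec hω) w) x = hext x.fst w + inner ℂ (kerSum (dmono hω) w) x.snd := by
  rw [kerSum_dvec hω hw, hext_eq_inner hw]
  exact WithLp.prod_inner_apply _ _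

theorem inner_kerSum_dvec_kerSum (hω : IsWeight ω) {v w : ℂ} (hv : v ∈ disc) (hw : w ∈ disc) :
    inner ℂ (kerSum (dvec hω) v) (kerSum (dvec hω) w) =
      (1 - conj w * v)⁻¹ + inner ℂ (kerSum (dmono hω) v) (kerSum (dmono hω) w) := by
  rw [inner_kerSum_dvec hω hv, kerSum_dvec hω hw]
  congr 1
  exact hext_cauchyKer hv hw

theorem inner_pairKer_pairKer (b a : LInf) {v w : ℂ} (hv : v ∈ disc) (hw : w ∈ disc) :
    inner ℂ (pairKer b a v) (pairKer b a w) = (1 - conj w * v)⁻¹ +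
      ext b v / ext a v * conj (ext b w / ext a w) * (1 - conj w * v)⁻¹ := by
  rw [inner_pairKer b a hv]
  change hext (cauchyKer w) v + ext b v / ext a v *
    hext (conj (ext b w / ext a w) • cauchyKer w) v = _
  rw [hext_smul _ _ hv, hext_cauchyKer hv hw, mul_assoc]

theorem one_sub_norm_sq_pos {w : ℂ} (hw : w ∈ disc) : 0 < 1 - ‖w‖ ^ 2 := by
  have := pow_lt_one₀ (norm_nonneg w) (mem_disc.1 hw) two_ne_zero
  linarith

theorem ofReal_one_sub_norm_sq (w : ℂ) : ((1 - ‖w‖ ^ 2 : ℝ) : ℂ) = 1 - conj w * w := by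
  rw [Complex.conj_mul']; push_cast; rfl

/-! ### The necessary conditions -/

theorem DirichletEqDeBranges.exists_const (hE : DirichletEqDeBranges ω b) (hω : IsWeight ω)
    (hb : AnalyticSymbol b) (hb1 : ‖b‖ ≤ 1) {a : LInf} (ha : IsPair b a) {β : ℂ}
    (hin : ∀ g, inner ℂ (mono 1) (toeplitz b g) = β * hext g 0) :
    ‖β / ext a 0‖ = 1 ∧ ∀ w ∈ disc, ext b w / ext a w = β / ext a 0 * w * bergman ω w := by
  have haa : AnalyticSymbol a := ha.analytic
  have ha0 : ext a 0 ≠ 0 := ha.ext_ne_zero zero_mem_disc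
  set c := β / ext a 0 with hc
  -- The companion of `z` in `pairGraph`: `T_{b̄} z` is the constant `conj β`, and `c = β/a(0)`
  -- makes `T_{ā}` of the constant `conj c` agree with it.
  set x : WithLp 2 (hardyTwo × hardyTwo) := WithLp.toLp 2 (mono 1, conj c • mono 0) with hx
  have hxm : x ∈ pairGraph b a := by
    rw [mem_pairGraph]
    refine hardy_ext_inner_left fun q => ?_
    rw [inner_toeplitz_star, inner_toeplitz_star]
    change inner ℂ (mono 1) (toeplitz b q) = inner ℂ (conj c • mono 0) (toeplitz a q)
    rw [hin, hinner_smul_left, Complex.conj_conj, ← hext_zero_eq,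
      haa.hext_toeplitz _ zero_mem_disc, ← mul_assoc, hc, div_mul_cancel₀ _ ha0]
  have hfst : (dvec hω 1).fst = x.fst := rfl
  have hn := norm_eq_of_fst_eq hE hω hb hb1 ha (dvec_mem hω 1) hxm hfst
  have hc1 : ‖c‖ = 1 := by
    have h1 : ‖x‖ ^ 2 = ‖mono 1‖ ^ 2 + ‖conj c • mono 0‖ ^ 2 := WithLp.prod_norm_sq_eq_of_L2 x
    rw [← hn, (norm_dvec_sq hω).2, hnorm_smul, norm_mono, norm_mono, RCLike.norm_conj] at h1
    refine (pow_eq_one_iff_of_nonneg (norm_nonneg _) two_ne_zero).1 ?_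
    linarith
  have hcc : c * conj c = 1 := by rw [Complex.mul_conj', hc1]; simp
  refine ⟨hc1, fun w hw => ?_⟩
  -- Pairing the kernel at `w` with `z` in both graphs gives `w + w Qω(w) = w + φ(w) conj c`.
  have h2 := inner_eq_of_fst_eq hE hω hb hb1 ha (kerSum_dvec_mem hω hw) (dvec_mem hω 1)
    (ha.pairKer_mem hb hw) hxm (by rw [kerSum_dvec hω hw]; rfl) hfst
  rw [inner_kerSum_dvec hω hw, inner_pairKer b a hw] at h2
  have h3 : hext (dvec hω 1).fst w = hext x.fst w := rfl
  have h4 : inner ℂ (kerSum (dmono hω) w) (dvec hω 1).snd = w * bergman ω w :=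
    inner_kerSum_dmono_one hω hw
  have h5 : hext x.snd w = conj c := by
    change hext (conj c • mono 0) w = _
    rw [hext_smul _ _ hw, hext_mono 0 hw, pow_zero, mul_one]
  rw [h3, h4, h5] at h2
  linear_combination (-(ext b w / ext a w)) * hcc - c * h2

theorem DirichletEqDeBranges.berezin_eq (hE : DirichletEqDeBranges ω b) (hω : IsWeight ω)
    (hb : AnalyticSymbol b) (hb1 : ‖b‖ ≤ 1) {w : ℂ} (hw : w ∈ disc) :
    (1 - ‖w‖ ^ 2) * ‖bergman ω w‖ ^ 2 = berezin ω w := by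
  -- The Gram identity carries a factor `|w|²`; at the origin both sides are 1 because `ω` has mass
  -- one.
  rcases eq_or_ne w 0 with rfl | hw0
  · simp [hω.bergman_zero, hω.berezin_zero]
  obtain ⟨b₁, -, -, -, hin, -⟩ := hE.exists_factor hω hb hb1
  obtain ⟨a, ha⟩ := hE.exists_isPair hω hb hb1
  obtain ⟨hc, hφ⟩ := hE.exists_const hω hb hb1 ha hin
  have h1 := hE.gram hω hb hb1 ha hw hw
  rw [inner_kerSum_dvec_kerSum hω hw hw, inner_pairKer_pairKer b a hw hw, add_right_inj,
    hφ w hw, Complex.mul_conj', norm_mul, norm_mul, hc, one_mul] at h1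
  have h2 := inner_kerSum_dmono_self hω hw
  have h3 := one_sub_norm_sq_pos hw
  have h4 : ((1 - ‖w‖ ^ 2 : ℝ) : ℂ) ≠ 0 := Complex.ofReal_ne_zero.2 h3.ne'
  rw [h1, ← ofReal_one_sub_norm_sq] at h2
  have h5 : (‖w‖ ^ 2 * ((1 - ‖w‖ ^ 2) * ‖bergman ω w‖ ^ 2) : ℝ) = ‖w‖ ^ 2 * berezin ω w := by
    apply Complex.ofReal_injective
    rw [← h2]
    push_cast at h4 ⊢
    field_simp
  exact mul_left_cancel₀ (pow_ne_zero 2 (norm_ne_zero_iff.2 hw0)) h5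

theorem DirichletEqDeBranges.isOuter_bergman (hE : DirichletEqDeBranges ω b) (hω : IsWeight ω)
    (hb : AnalyticSymbol b) (hb1 : ‖b‖ ≤ 1) : IsOuter (bergman ω) := by
  obtain ⟨b₁, -, hb₁, -, hin, c₀, u, hc₀, hu, hbu⟩ := hE.exists_factor hω hb hb1
  obtain ⟨a, ha⟩ := hE.exists_isPair hω hb hb1
  obtain ⟨hc, hφ⟩ := hE.exists_const hω hb hb1 ha hin
  obtain ⟨c', v, hc', hv, hav⟩ := isOuter_iff.1 ha.outer
  set c := ext b₁ 0 / ext a 0 with hcdef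
  have hc0 : c ≠ 0 := norm_ne_zero_iff.1 (by rw [hc]; exact one_ne_zero)
  have hc'0 : c' ≠ 0 := norm_ne_zero_iff.1 (by rw [hc']; exact one_ne_zero)
  have key : ∀ w ∈ disc, ext b₁ w = c * ext a w * bergman ω w := by
    intro w hw
    have ha0 := ha.ext_ne_zero hw
    -- The factor `w` in `b = z b₁` cannot be cancelled at the origin, where `Qω(0) = 1` and the
    -- choice of `c` give the identity.
    rcases eq_or_ne w 0 with rfl | hw0
    · rw [hω.bergman_zero, hcdef, mul_one, div_mul_cancel₀ _ ha0]
    · have h1 := hφ w hw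
      rw [hb₁ w hw, div_eq_iff ha0] at h1
      apply mul_left_cancel₀ hw0
      rw [h1]; ring
  refine isOuter_iff.2 ⟨c₀ / (c * c'), fun t => u t + -v t, ?_, hu.add hv.neg, fun w hw => ?_⟩
  · rw [norm_div, norm_mul, hc, hc', hc₀]; norm_num
  · have h1 := key w hw
    rw [hbu w hw, hav w hw] at h1
    rw [outerFn_add hu (v := fun t => -v t) hv.neg hw, outerFn_neg]
    have h2 := outerFn_ne_zero v w
    field_simp
    rw [h1]; ring

/-! ### Sufficiency -/

/-- The Berezin identity says that `‖K_w‖² (1 - |w|²) = |⟨K_w, 1⟩|²`, where `K_w` is the derivative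
kernel and `⟨K_w, 1⟩ = w Qω(w)`. Polarized by `gram_of_diagonal`, this is the full Gram identity. -/
theorem gram_of_berezin_eq (hω : IsWeight ω)
    (h : ∀ z ∈ disc, (1 - ‖z‖ ^ 2) * ‖bergman ω z‖ ^ 2 = berezin ω z) {a : LInf}
    (hφ : ∀ w ∈ disc, ext b w / ext a w = w * bergman ω w) {v w : ℂ} (hv : v ∈ disc)
    (hw : w ∈ disc) : inner ℂ (kerSum (dvec hω) v) (kerSum (dvec hω) w) =
      inner ℂ (pairKer b a v) (pairKer b a w) := by
  have hdiag : ∀ w ∈ disc, inner ℂ (kerSum (dmono hω) w) (kerSum (dmono hω) w) * (1 - w * conj w) =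
      inner ℂ (kerSum (dmono hω) w) (dmono hω 1) * inner ℂ (dmono hω 1) (kerSum (dmono hω) w) := by
    intro w hw
    have h1 := inner_kerSum_dmono_self hω hw
    have h4 : ((1 - ‖w‖ ^ 2 : ℝ) : ℂ) ≠ 0 :=
      Complex.ofReal_ne_zero.2 (one_sub_norm_sq_pos hw).ne'
    rw [← inner_conj_symm (dmono hω 1), inner_kerSum_dmono_one hω hw,
      Complex.mul_conj' (w * bergman ω w), norm_mul, mul_comm w (conj w),
      ← ofReal_one_sub_norm_sq]
    apply mul_right_cancel₀ h4
    rw [← h w hw] at h1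
    push_cast at h1 ⊢
    linear_combination h1
  have h1 := gram_of_diagonal (norm_dmono_le' hω) (dmono hω 1) hdiag hv hw
  rw [← inner_conj_symm (dmono hω 1), inner_kerSum_dmono_one hω hw,
    inner_kerSum_dmono_one hω hv] at h1
  rw [inner_kerSum_dvec_kerSum hω hv hw, inner_pairKer_pairKer b a hv hw, hφ v hv, hφ w hw, ← h1]
  have h2 := one_sub_ne_zero_of_disc (conj_mem_disc hw) hv
  rw [mul_comm v (conj w), mul_inv_cancel_right₀ h2]

theorem exists_pair_of_outer {F : ℂ → ℂ} (hF : IsOuter F) :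
    ∃ b a : LInf, AnalyticSymbol b ∧ ‖b‖ ≤ 1 ∧ IsPair b a ∧
      ∀ w ∈ disc, ext b w / ext a w = w * F w := by
  obtain ⟨c, u, hc, hu, hFu⟩ := isOuter_iff.1 hF
  -- With `|F| = e^u` on the circle, `|a|² + |b|² = 1` and `|b/a| = e^u` force `|a| = (1 +
  -- e^{2u})^{-1/2} = e^α`. Then `b = z F a` has modulus `e^{u+α} ≤ 1`.
  set α : UnitAddCircle → ℝ := fun t => -(Real.log (1 + Real.exp (2 * u t)) / 2) with hα
  have hpos : ∀ t, 0 < 1 + Real.exp (2 * u t) := fun t => by positivity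
  have hlog0 : ∀ t, 0 ≤ Real.log (1 + Real.exp (2 * u t)) := fun t =>
    Real.log_nonneg (by linarith [Real.exp_pos (2 * u t)])
  have hlogu : ∀ t, 2 * u t ≤ Real.log (1 + Real.exp (2 * u t)) := fun t => by
    rw [Real.le_log_iff_exp_le (hpos t)]; linarith
  have hle : ∀ t, Real.log (1 + Real.exp (2 * u t)) ≤ Real.log 2 + 2 * |u t| := fun t => by
    rw [Real.log_le_iff_le_exp (hpos t), Real.exp_add, Real.exp_log two_pos]
    have h1 : Real.exp (2 * u t) ≤ Real.exp (2 * |u t|) :=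
      Real.exp_le_exp.2 (by linarith [le_abs_self (u t)])
    have h2 : 1 ≤ Real.exp (2 * |u t|) := Real.one_le_exp (by positivity)
    linarith
  have hαi : Integrable α arc := by
    refine ((integrable_const (Real.log 2)).add (hu.norm.const_mul 2)).mono' ?_
      (Eventually.of_forall fun t => ?_)
    · refine AEMeasurable.aestronglyMeasurable ?_
      exact ((Real.measurable_log.comp_aemeasurable ((Real.measurable_exp.comp_aemeasurable
        (hu.aemeasurable.const_mul 2)).const_add 1)).div_const 2).neg
    · rw [hα, norm_neg, Real.norm_of_nonneg (by have := hlog0 t; positivity)]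
      refine le_trans (by linarith [hlog0 t]) (hle t)
  obtain ⟨a, haa, hae, -, han⟩ := exists_outer_symbol hαi (C := 0)
    (Eventually.of_forall fun t => by simp only [hα]; linarith [hlog0 t])
  have huα : Integrable (fun t => u t + α t) arc := hu.add hαi
  have huα0 : ∀ᵐ t ∂arc, u t + α t ≤ 0 :=
    Eventually.of_forall fun t => by simp only [hα]; linarith [hlogu t]
  obtain ⟨f, hf, hfe, -⟩ := exists_boundary (F := fun z => c * outerFn (fun t => u t + α t) z)
    ((differentiableOn_outerFn huα).const_mul c) zero_le_one (fun z hz => by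
      rw [norm_mul, hc, one_mul]
      simpa using norm_outerFn_le huα huα0 hz)
  have hfn := norm_boundary_of_outer_symbol hf hc huα hfe
  obtain ⟨Z, hZ, hZt, hZe⟩ := exists_shift_symbol
  obtain ⟨b, hb⟩ := exists_mul Z f
  have hbn : ∀ᵐ t ∂arc, ‖b t‖ = Real.exp (u t + α t) := by
    filter_upwards [hb, hZt, hfn] with t e1 e2 e3
    rw [e1, norm_mul, e2, norm_toCircle, one_mul, e3]
  refine ⟨b, a, hZ.of_mul hf hb, LInf_norm_le zero_le_one ?_, ⟨haa, ?_, ?_, ?_⟩, fun w hw => ?_⟩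
  · filter_upwards [hbn, huα0] with t e1 e2
    rw [e1]; exact Real.exp_le_one_iff.2 e2
  · exact isOuter_iff.2 ⟨1, α, norm_one, hαi, fun z hz => by rw [hae hz, one_mul]⟩
  · exact ⟨_, Real.exp_pos _, (hae zero_mem_disc).trans (outerFn_zero α)⟩
  · filter_upwards [hbn, han] with t e1 e2
    rw [e1, e2, Real.exp_add, mul_pow, exp_neg_half_log (hpos t), ← Real.exp_nat_mul]
    have := (hpos t).ne'
    push_cast
    field_simp
  · rw [ext_of_mul hZ hf hb hw, hZe w hw, hfe hw, hae hw, hFu w hw]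
    simp only
    rw [outerFn_add hu hαi hw]
    have := outerFn_ne_zero α w
    field_simp

/-- The two kernel families span dense subspaces of `dirGraph` and `pairGraph`, so Gram equality
matches the graphs isometrically over equal first coordinates. `DefectData` then translates
`pairGraph` into the range of the defect root. -/
theorem dirichletEqDeBranges_of_gram (hω : IsWeight ω) (hsub : dirichletSpace ω ⊆ hardySpace)
    (hpoly : PolynomialsDense ω) (hb : AnalyticSymbol b) (hb1 : ‖b‖ ≤ 1) {a : LInf}
    (ha : IsPair b a)
    (h : ∀ v ∈ disc, ∀ w ∈ disc, inner ℂ (kerSum (dvec hω) v) (kerSum (dvec hω) w) =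
      inner ℂ (pairKer b a v) (pairKer b a w)) : DirichletEqDeBranges ω b := by
  have hd := ha.defectData hb hb1
  set V := (Submodule.span ℂ (range fun w : disc => kerSum (dvec hω) w)).topologicalClosure with hV
  have hVeq : V = (Submodule.span ℂ (range (dvec hω))).topologicalClosure := by
    rw [hV, ← image_eq_range (kerSum (dvec hω)) disc, closure_span_kerSum (norm_dvec_le hω)]
  have hVle : V ≤ dirGraph ω := by
    rw [hVeq]
    exact Submodule.topologicalClosure_minimal _ (span_dvec_le hω) (isClosed_dirGraph ω)
  -- Condition (ii) enters here; without it the kernels might span only a proper subspace of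
  -- `dirGraph`.
  have hle : dirGraph ω ≤ V := by rw [hVeq]; exact dirGraph_le_of_polynomialsDense hω hpoly
  have hfst : ∀ w : disc, fstL _ _ (kerSum (dvec hω) w) = fstL _ _ (pairKer b a w) := fun w => by
    rw [fstL_apply, fstL_apply, kerSum_dvec hω w.2]; rfl
  have hto : ∀ g ∈ (LinearMap.ker (defectSqrt b : hardyTwo →ₗ[ℂ] hardyTwo))ᗮ,
      ∃ y ∈ dirGraph ω, y.fst = defectSqrt b g ∧ ‖y‖ = ‖g‖ := fun g hg => by
    obtain ⟨x, hx, hxg, hn⟩ := hd.exists_graph hg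
    have hx : x ∈ pairGraph b a := hx
    rw [← ha.closure_span_pairKer hb] at hx
    obtain ⟨y, hy, h1, h2⟩ := exists_mem_closure_of_gram (κ := fun w : disc => pairKer b a w)
      (ε := fun w : disc => kerSum (dvec hω) w) (fun v w => (h v v.2 w w.2).symm) (fstL _ _)
      (fstL _ _) (fun w => (hfst w).symm) hx
    exact ⟨y, hVle hy, h1.symm.trans hxg, by rw [← h2, hn]⟩
  refine ⟨fun f => ⟨fun hf => ?_, ?_⟩, fun g hg => ?_⟩
  · obtain ⟨y, hy, hfy⟩ := hω.exists_dirGraph_eqOn hsub hf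
    obtain ⟨x, hx, h1, -⟩ := exists_mem_closure_of_gram (ε := fun w : disc => pairKer b a w)
      (κ := fun w : disc => kerSum (dvec hω) w) (fun v w => h v v.2 w w.2) (fstL _ _)
      (fstL _ _) hfst (hle hy)
    rw [ha.closure_span_pairKer hb] at hx
    obtain ⟨g, -, hSg, -⟩ := hd.exists_range hx
    have h1 : y.fst = x.fst := h1
    exact ⟨y.fst, ⟨g, by rw [h1]; exact hSg⟩, hfy⟩
  · rintro ⟨k, hk, hfk⟩
    obtain ⟨g, hg, rfl⟩ := exists_defect_preimage hk
    obtain ⟨y, hy, hyg, -⟩ := hto g hg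
    have h1 := hω.hext_mem_dirichletSpace hy
    rw [hyg] at h1
    exact ⟨h1.1.congr hfk, by rw [dirichletEnergy_congr hfk]; exact h1.2⟩
  · obtain ⟨y, hy, hyg, hn⟩ := hto g hg
    change dirichletNormSq ω (hext (defectSqrt b g)) = _
    rw [← hyg, hω.dirichletNormSq_eq hy, enorm_sq_eq, enorm_sq_eq, hn]

end WeightedDirichlet

end

/-! ### The theorem. -/

open WeightedDirichlet in
theorem mainTheorem5 (ω : ℂ → ℝ) (hω_nonneg : ∀ᵐ z ∂areaD, 0 ≤ ω z)
    (hω_int : Integrable ω areaD) (hω_one : ∫ z, ω z ∂areaD = 1) :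
    ((∃ b ∈ hInfBall, DirichletEqDeBranges ω b) ↔
      (dirichletSpace ω ⊆ hardySpace ∧
        PolynomialsDense ω ∧
        (IsOuter (bergman ω) ∧
          ∀ z ∈ disc, (1 - ‖z‖ ^ 2) * ‖bergman ω z‖ ^ 2 = berezin ω z))) ∧
    (∀ b ∈ hInfBall, DirichletEqDeBranges ω b →
      (∃! a : LInf, IsPair b a) ∧
      ∀ a : LInf, IsPair b a → ∃ c : ℂ, ‖c‖ = 1 ∧
        ∀ z ∈ disc, ext b z / ext a z = c * z * bergman ω z) := by
  have hω : IsWeight ω := ⟨hω_nonneg, hω_int, hω_one⟩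
  refine ⟨⟨?_, ?_⟩, ?_⟩
  · rintro ⟨b, ⟨hb, hb1⟩, hE⟩
    exact ⟨hE.subset_hardySpace, hE.polynomialsDense hω hb hb1, hE.isOuter_bergman hω hb hb1,
      fun z hz => hE.berezin_eq hω hb hb1 hz⟩
  · rintro ⟨hsub, hpoly, hout, hber⟩
    obtain ⟨b, a, hb, hb1, ha, hφ⟩ := exists_pair_of_outer hout
    exact ⟨b, ⟨hb, hb1⟩, dirichletEqDeBranges_of_gram hω hsub hpoly hb hb1 ha
      fun v hv w hw => gram_of_berezin_eq hω hber hφ hv hw⟩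
  · rintro b ⟨hb, hb1⟩ hE
    obtain ⟨a, ha⟩ := hE.exists_isPair hω hb hb1
    obtain ⟨b₁, -, -, -, hin, -⟩ := hE.exists_factor hω hb hb1
    exact ⟨⟨a, ha, fun a' ha' => ha'.unique ha⟩, fun a ha =>
      ⟨_, hE.exists_const hω hb hb1 ha hin⟩⟩
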